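/- **Conventions.** Let $k$ be a field, $\log=\log_2$. A division-free straight-line program over a ring $R$ is a list of additions, subtractions and multiplications of inputs, constants and earlier results; its cost is its number of steps. An element $\omega$ of a ring $R$ is a principal $n$-th root of unity if $\omega^n=1$ and $1-\omega^j$ is not a zero divisor for $1\le j<n$; $\mathrm{DFT}_n^\omega:R^n\to R^n$ is $a\mapsto(\sum_{j<n}\omega^{ij}a_j)_{i<n}$, and the order $n$ is $c$-suitable over $R$ if $\mathrm{DFT}_n^\omega$ has cost at most $c\,n\log n$ over $R$ for a principal root $\omega$. An order sequence of constant sparseness over $k$ is a sequence $n_i=n_i'n_i''$ with $n_i<n_{i+1}\le s(n_i)\,n_i$ for a bounded function $s>1$, $n_i\mid n_{i+1}$, such that for a constant $c$ and every $i$ some $k$-algebra of dimension $n_i'$ contains a principal $n_i''$-th root of unity and $n_i''$ is $c$-suitable over it. **The scheme $\mathcal D$.** A step for an algebra $A_N=k[x]/P_N$ ($P_N$ monic of degree $N=N'N''$) consists of a monic $P_{N'}\in k[y]$ of degree $N'$, $A_{N'}=k[y]/P_{N'}$, a transform $\psi:A_N\to A_{N'}^{m}$ and a back-transform $\psi^{-}:A_{N'}^{m}\to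 k[x]$. It multiplies $a,b\in A_N$ by computing $\psi(a),\psi(b)$, the $m$ componentwise products in $A_{N'}$, then $c=\psi^{-}$ of the result, and $c\bmod P_N$. It is a $\mathcal D$-step with constant $K$ and order sequence $(n_i'n_i'')$ if: $(N',N'')=(n_i',n_i'')$ for some $i$; $A_{N'}$ contains a principal $N''$-th root of unity; $m\le 2N''$; $\psi$ is $k$-linear and injective, and $\psi^{-}(\psi(a))\equiv a \pmod{P_N}$; each of $\psi$, $\psi^{-}$ is computed by means of DFTs, i.e. is a composition of a $k$-linear map, of at most $K$ DFTs over $A_{N'}$ of $K$-suitable orders at most $KN''$, and of a $k$-linear map, both linear maps having cost at most $KN$ over $k$ (in coordinates; $\psi^-$ yields polynomials of degree less than $2N$). A family of algorithms, indexed by $n\ge n_0$, is an *instance of $\mathcal D$* if there are one constant $K$ and one order sequence of constant sparseness over $k$ such that for all $n\ge n_0$: the algorithm embeds two polynomials of degree at most $n-1$ in an algebra $A_N$ with $2n-1\le N\le Kn$; it applies a $\mathcal D$-step for which $\psi^{-}(\psi(a)\psi(b))$ is the ordinary product $ab$ in $k[x]$ for all inputs; the products in $A_{N'}$ are computed recursively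 by $\mathcal D$-steps with the same $K$ and the same order sequence, each of which multiplies arbitrary elements of its algebra correctly, down to direct multiplication in an algebra of dimension at most $K$; and the output is $ab$. **Theorem.** The following four algorithms are instances of $\mathcal D$, with the indicated $P_N$, $N'$, $N''$, $\psi$. The inverse DFT of order $m$ is $\frac1m\mathrm{DFT}_m^{\omega^{-1}}$. 1. ($\mathcal A$, plain FFT multiplication, $n\ge1$.) Let $s\ge2$ and let $k$ contain a primitive $s^\nu$-th root of unity for every $\nu$. With $N=s^{\lceil\log_s(2n-1)\rceil}$: $P_N=x^N-1$, $N'=1$, $N''=N$, $A_{N'}=k$ (as $k[y]/(y-1)$), $\psi$ is the DFT of order $N$ over $k$. 2. ($\mathcal B$, Schönhage–Strassen, $\operatorname{char}k\ne2$, $n\ge3$.) With $\nu=\lceil\log_2(2n-1)\rceil$ and $N=2^\nu$: $P_N=x^N+1$, $N'=2^{\lceil\nu/2\rceil}$, $N''=2^{\lfloor\nu/2\rfloor}$, $P_{N'}=y^{N'}+1$. The coefficients of $a$ are grouped into $2N''$ blocks $\bar a_i=\sum_{j<N'/2}a_{iN'/2+j}\,y^j\in A_{N'}$, and $\psi$ is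 the DFT of order $2N''$ of $(\bar a_i)$ with respect to $y^{N'/N''}$; the back-transform applies the inverse DFT and substitutes $y\mapsto x$, sending the $i$-th component $\bar c_i$ to $\bar c_i(x)\,x^{iN'/2}$. The products in $A_{N'}$ (arbitrary elements) are computed recursively by the step with the same $N',N''$ (for $\nu$ replaced by $\lceil\nu/2\rceil$, and so on, while $\nu\ge2$) and a DFT of the same order $2N''$ over $A_{N'}$ for the grouping $\bar a_i=\sum_{j<N'}a_{i+N''j}\,y^j$, $i<N''$, padded with $N''$ zeros, where $y$ stands for $x^{N''}$. 3. ($\mathcal B$, Schönhage, $\operatorname{char}k=2$, $n\ge3$.) With $\nu=\lceil\log_3(n-\frac12)\rceil$, $N_1=3^{\lceil\nu/2\rceil}$, $N_2=3^{\lfloor\nu/2\rfloor}$: $P_N=x^{2\cdot3^\nu}+x^{3^\nu}+1$, of degree $N=2\cdot3^\nu$, $N'=2N_1$, $N''=N_2$, $P_{N'}=y^{2N_1}+y^{N_1}+1$. The coefficients are grouped into $2N_2$ blocks $\bar a_i=\sum_{j<N_1}a_{N_1i+j}\,y^j$, padded with $N_2$ zeros; $\psi$ is the DFT of order $3N''$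 over $A_{N'}$ with respect to $\omega=y^{N_1/N_2}$, of which only the $2N''$ components with index not divisible by $3$ are kept. The back-transform uses two inverse DFTs of order $N_2$ with respect to $\omega^3$, recovers the coefficients modulo $\bar x^{2N_2}+\bar x^{N_2}+1$ from them, and substitutes $y\mapsto x$, $\bar x\mapsto x^{N_1}$. The recursion replaces $\nu$ by $\lceil\nu/2\rceil$ while $\nu\ge2$. 4. ($\mathcal C$, Cantor–Kaltofen, any $k$.) Let $s\ge2$ be an integer with $\operatorname{char}k\nmid s$, $n\ge s^3$, and let $\nu$ be either the least integer with $\varphi(s^\nu)\ge2n-1$ or $\lceil\log_s((4n-2)\log s)\rceil$ (the same choice for all $n$). Then $P_N=\Phi_{s^\nu}$, $N=\varphi(s^\nu)$, $N'=\varphi(N_3)$ with $N_3=s^{\lfloor\nu/2\rfloor+1}$, $N''=s^{\lceil\nu/2\rceil-1}$, $P_{N'}=\Phi_{N_3}$. With $\bar a(\bar x)=\sum_{i<N''}\big(\sum_{j<N'}a_{i+N''j}\,y^j\big)\bar x^i$ and $\xi=y^{N_3/(sN'')}$, $\psi(a)$ consists of the two DFTs of order $N''$ over $A_{N'}$, with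 respect to $\xi^s$, of $\bar a(\bar x)$ and of $\bar a(\xi\bar x)$. The back-transform applies two inverse DFTs, obtains the coefficients of the product of degree at most $2N''-2$ in $\bar x$ by means of $\frac1{1-\xi^{N''}}=\frac1\tau\prod_{2\le i<s,\ (i,s)=1}(1-\xi^{N''i})$ ($\tau=p$ if $s$ is a power of a prime $p$, else $\tau=1$), and substitutes $y\mapsto x^{N''}$, $\bar x\mapsto x$. The recursion replaces $\nu$ by $\lfloor\nu/2\rfloor+1$ while $\nu\ge3$. -/

import Mathlib

open Polynomial

universe u

noncomputable section

namespace DFTMul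

/-! ## Division-free straight-line programs -/

/-- An operand of an arithmetic step: an input, a constant, or the result of an earlier step. -/
inductive Operand (R : Type*) (ι : Type*) where
  | input (i : ι) : Operand R ι
  | const (c : R) : Operand R ι
  | result (t : ℕ) : Operand R ι

/-- One arithmetic step: an addition, a subtraction or a multiplication of two operands. -/
inductive Instr (R : Type*) (ι : Type*) where
  | add (p q : Operand R ι) : Instr R ι
  | sub (p q : Operand R ι) : Instr R ι
  | mul (p q : Operand R ι) : Instr R ι

/-- The value of an operand, for the input `v` and the list `w` of results computed so far. -/
def Operand.eval {R ι : Type*} [Ring R] (v : ι → R) (w : List R) : Operand R ι → R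
  | .input i => v i
  | .const c => c
  | .result t => w.getD t 0

def Instr.eval {R ι : Type*} [Ring R] (v : ι → R) (w : List R) : Instr R ι → R
  | .add p q => p.eval v w + q.eval v w
  | .sub p q => p.eval v w - q.eval v w
  | .mul p q => p.eval v w * q.eval v w

/-- The results of all steps of a program on the input `v`. -/
def runProgram {R ι : Type*} [Ring R] (p : List (Instr R ι)) (v : ι → R) : List R :=
  p.foldl (fun w i => w ++ [i.eval v w]) []

/-- The map `f : R^ι → R^κ` is computed by a division-free straight-line program over `R` with at
most `T` arithmetic steps. -/
def SLPComputes {R ι κ : Type*} [Ring R] (T : ℝ) (f : (ι → R) → (κ → R)) : Prop :=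
  ∃ p : List (Instr R ι), (p.length : ℝ) ≤ T ∧
    ∃ out : κ → Operand R ι, ∀ v j, (out j).eval v (runProgram p v) = f v j

/-- The map `f : V → W` is computed with at most `T` operations in `k`, where elements of `V` and
`W` are given by their coordinates through `e₁` and `e₂`. -/
def ComputableWithin {k ι κ V W : Type*} [Field k] (T : ℝ)
    (e₁ : (ι → k) → V) (e₂ : (κ → k) → W) (f : V → W) : Prop :=
  ∃ g : (ι → k) → (κ → k), SLPComputes T g ∧ ∀ v, f (e₁ v) = e₂ (g v)

/-! ## Principal roots of unity, the DFT, order sequences -/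

/-- `ω` is a principal `n`-th root of unity. -/
def IsPrincipalRoot {R : Type*} [Ring R] (n : ℕ) (ω : R) : Prop :=
  ω ^ n = 1 ∧ ∀ j : ℕ, 1 ≤ j → j < n → (1 - ω ^ j) ∈ nonZeroDivisors R

/-- The discrete Fourier transform of order `n` with respect to `ω`. -/
def dft {R : Type*} [Ring R] (n : ℕ) (ω : R) (a : Fin n → R) : Fin n → R :=
  fun i => ∑ j : Fin n, ω ^ ((i : ℕ) * (j : ℕ)) * a j

/-- `ω` is a principal `n`-th root of unity of `R`, and the DFT of order `n` with respect to `ω`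
is computed with at most `c n log n` operations in `R`: that is, `n` is `c`-suitable over `R`. -/
def SuitableRoot {R : Type*} [Ring R] (c : ℝ) (n : ℕ) (ω : R) : Prop :=
  IsPrincipalRoot n ω ∧ SLPComputes (c * n * Real.logb 2 n) (dft n ω)

/-- The numbers `n i = n' i * n'' i` form an order sequence of sparseness `s` over `k`. -/
def IsOrderSequence (k : Type u) [Field k] (s : ℕ → ℝ) (n' n'' : ℕ → ℕ) : Prop :=
  (∀ n, 1 < s n) ∧
  (∀ i, n' i * n'' i < n' (i + 1) * n'' (i + 1) ∧
    ((n' (i + 1) * n'' (i + 1) : ℕ) : ℝ) ≤ s (n' i * n'' i) * ((n' i * n'' i : ℕ) : ℝ) ∧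
    n' i * n'' i ∣ n' (i + 1) * n'' (i + 1)) ∧
  ∃ c : ℝ, ∀ i, ∃ (R : Type u) (_ : Ring R) (_ : Algebra k R),
    Module.finrank k R = n' i ∧ ∃ ω : R, SuitableRoot c (n'' i) ω

/-- An order sequence of constant sparseness. -/
def IsConstSparseOrderSequence (k : Type u) [Field k] (n' n'' : ℕ → ℕ) : Prop :=
  ∃ s : ℕ → ℝ, IsOrderSequence k s n' n'' ∧ ∃ K : ℝ, ∀ n, s n ≤ K

/-! ## Coordinates -/

section Coordinates

variable {k : Type u} [Field k]

/-- The polynomial with coefficients `v 0, …, v (N-1)`. -/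
def ofCoeffs (N : ℕ) (v : Fin N → k) : k[X] := ∑ i : Fin N, C (v i) * X ^ (i : ℕ)

/-- The element of `k[x]/P` with coordinates `v` in the basis `1, x, …, x^(N-1)`. -/
def ofCoords (P : k[X]) (N : ℕ) (v : Fin N → k) : AdjoinRoot P := AdjoinRoot.mk P (ofCoeffs N v)

/-- The representative of degree less than `deg P` of an element of `k[x]/P`, for monic `P`. -/
def rep (P : k[X]) (a : AdjoinRoot P) : k[X] :=
  (AdjoinRoot.mk_surjective (g := P) a).choose %ₘ P

/-- The element `c 0 + c 1 * y + … + c (J-1) * y^(J-1)` of `k[y]/Q`. -/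
def pack (Q : k[X]) (J : ℕ) (c : ℕ → k) : AdjoinRoot Q :=
  AdjoinRoot.mk Q (∑ j ∈ Finset.range J, C (c j) * X ^ j)

end Coordinates

/-! ## Recursive multiplication algorithms -/

/-- The data of one recursive step for multiplication in `k[x]/P`: the numbers `N'` and `N''`, the
polynomial `Q` that defines the smaller algebra `k[y]/Q`, the index set of the products that are
computed in `k[y]/Q`, the transform and the back-transform. -/
structure Level (k : Type u) [Field k] (P : k[X]) where
  N' : ℕ
  N'' : ℕ
  Q : k[X]
  idx : Type
  [fin : Fintype idx]
  fwd : AdjoinRoot P → (idx → AdjoinRoot Q)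
  bwd : (idx → AdjoinRoot Q) → k[X]

attribute [instance] Level.fin

/-- An algorithm for multiplication in `k[x]/P`: direct multiplication, or a step whose products in
the smaller algebra are computed by an algorithm for that algebra. -/
inductive MulAlg (k : Type u) [Field k] : k[X] → Type (max u 1) where
  | direct (P : k[X]) : MulAlg k P
  | step {P : k[X]} (L : Level k P) (inner : MulAlg k L.Q) : MulAlg k P

/-- Transform both factors, multiply componentwise by `mul`, transform back, reduce modulo `P`. -/
def Level.exec {k : Type u} [Field k] {P : k[X]} (L : Level k P)
    (mul : AdjoinRoot L.Q → AdjoinRoot L.Q → AdjoinRoot L.Q) (a b : AdjoinRoot P) : AdjoinRoot P :=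
  AdjoinRoot.mk P (L.bwd fun i => mul (L.fwd a i) (L.fwd b i))

def MulAlg.run {k : Type u} [Field k] : {P : k[X]} → MulAlg k P →
    AdjoinRoot P → AdjoinRoot P → AdjoinRoot P
  | _, .direct _ => fun a b => a * b
  | _, .step L inner => L.exec inner.run

/-- An algorithm for multiplication of polynomials over `k`: embed into `k[x]/P`, carry out the step
`top`, and compute the products in the smaller algebra by `inner`. -/
structure PolyAlg (k : Type u) [Field k] where
  P : k[X]
  top : Level k P
  inner : MulAlg k top.Q

def PolyAlg.run {k : Type u} [Field k] (A : PolyAlg k) (a b : k[X]) : k[X] :=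
  rep A.P (A.top.exec A.inner.run (AdjoinRoot.mk A.P a) (AdjoinRoot.mk A.P b))

/-! ## The generic scheme `𝒟` -/

section Scheme

variable {k : Type u} [Field k]

/-- The map `f : V → W` is computed by means of DFTs over `k[y]/Q`: it is the composition of a linear
map `pre`, of DFTs of the given `orders`, and of a linear map `post`. The number of DFTs is at most
`K`, their orders are at most `K * N''` and `K`-suitable, and `pre` and `post` are
computed with at most `K * size` operations in `k`. -/
def ByDFTs {ι κ V W : Type*} [AddCommGroup V] [Module k V] [AddCommGroup W] [Module k W]
    (K : ℝ) (size : ℕ) (Q : k[X]) (N' N'' : ℕ) (orders : List ℕ)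
    (e₁ : (ι → k) → V) (e₂ : (κ → k) → W) (f : V → W) : Prop :=
  (orders.length : ℝ) ≤ K ∧ (∀ m ∈ orders, 1 ≤ m ∧ (m : ℝ) ≤ K * N'') ∧
  ∃ ω : Fin orders.length → AdjoinRoot Q,
  ∃ pre : V →ₗ[k] ((j : Fin orders.length) → Fin (orders.get j) → AdjoinRoot Q),
  ∃ post : ((j : Fin orders.length) → Fin (orders.get j) → AdjoinRoot Q) →ₗ[k] W,
    (∀ j, SuitableRoot K (orders.get j) (ω j)) ∧
    ComputableWithin (ι := ι) (κ := (j : Fin orders.length) × Fin (orders.get j) × Fin N')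
      (K * size) e₁ (fun v j i => ofCoords Q N' fun l => v ⟨j, i, l⟩) pre ∧
    ComputableWithin (ι := (j : Fin orders.length) × Fin (orders.get j) × Fin N') (κ := κ)
      (K * size) (fun v j i => ofCoords Q N' fun l => v ⟨j, i, l⟩) e₂ post ∧
    ∀ x, f x = post (fun j => dft (orders.get j) (ω j) (pre x j))

/-- The requirements of the scheme on one step with the constant `K` and the order sequence
`(n' i * n'' i)`; `orders` are the orders of the DFTs used in the transform. -/
structure Level.IsDStep {P : k[X]} (L : Level k P) (K : ℝ) (n' n'' : ℕ → ℕ)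
    (orders : List ℕ) : Prop where
  monic_P : P.Monic
  monic_Q : L.Q.Monic
  /-- `N = N' N''` is the degree of `P` -/
  degree_P : P.natDegree = L.N' * L.N''
  degree_Q : L.Q.natDegree = L.N'
  /-- `N = N' N''` is, with this factorization, a member of the order sequence -/
  mem_seq : ∃ i, n' i = L.N' ∧ n'' i = L.N''
  /-- the smaller algebra contains a principal `N''`-th root of unity
  (the square of a principal `2 N''`-th one is such a root) -/
  root : ∃ ω : AdjoinRoot L.Q, IsPrincipalRoot L.N'' ω
  /-- at most `2 N''` products are computed in the smaller algebra -/
  card_le : Fintype.card L.idx ≤ 2 * L.N''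
  linear : IsLinearMap k L.fwd
  injective : Function.Injective L.fwd
  leftInv : ∀ a, AdjoinRoot.mk P (L.bwd (L.fwd a)) = a
  fwd_dft : ByDFTs K P.natDegree L.Q L.N' L.N'' orders
    (ofCoords P P.natDegree)
    (fun (v : L.idx × Fin L.N' → k) i => ofCoords L.Q L.N' fun l => v (i, l)) L.fwd
  bwd_dft : ∃ orders' : List ℕ, ByDFTs K P.natDegree L.Q L.N' L.N'' orders'
    (fun (v : L.idx × Fin L.N' → k) i => ofCoords L.Q L.N' fun l => v (i, l))
    (ofCoeffs (2 * P.natDegree)) L.bwd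

/-- The algorithm for `k[x]/P` proceeds by steps of the scheme, each of which multiplies in its
algebra, down to direct multiplication in an algebra of dimension at most `K`. -/
def MulAlg.IsD (K : ℝ) (n' n'' : ℕ → ℕ) : {P : k[X]} → MulAlg k P → Prop
  | _, .direct P => P.Monic ∧ (P.natDegree : ℝ) ≤ K
  | _, .step L inner => (∃ orders, L.IsDStep K n' n'' orders) ∧
      (∀ a b, L.exec (fun u v => u * v) a b = a * b) ∧ inner.IsD K n' n''

/-- The family `A n`, `n ≥ n₀`, of algorithms for the multiplication of two polynomials of degree at
most `n - 1` is an instance of the scheme, with the polynomial `PN n`, the numbers `N' n`, `N'' n`,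
and a transform that uses DFTs of the orders `orders n` over `k[y]/P_{N'}`. -/
def IsInstanceOfD (n₀ : ℕ) (A : ℕ → PolyAlg k) (PN : ℕ → k[X]) (N' N'' : ℕ → ℕ)
    (orders : ℕ → List ℕ) : Prop :=
  ∃ (K : ℝ) (n' n'' : ℕ → ℕ), IsConstSparseOrderSequence k n' n'' ∧ ∀ n, n₀ ≤ n →
    ((A n).P = PN n ∧ (A n).top.N' = N' n ∧ (A n).top.N'' = N'' n) ∧
    (2 * n - 1 ≤ N' n * N'' n ∧ ((N' n * N'' n : ℕ) : ℝ) ≤ K * n) ∧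
    (A n).top.IsDStep K n' n'' (orders n) ∧
    -- the back-transform returns the ordinary product of the input polynomials
    (∀ a b : k[X], a.degree < n → b.degree < n →
      (A n).top.bwd (fun i => (A n).top.fwd (AdjoinRoot.mk _ a) i *
        (A n).top.fwd (AdjoinRoot.mk _ b) i) = a * b) ∧
    (A n).inner.IsD K n' n'' ∧
    -- the recursive algorithm computes the product
    (∀ a b : k[X], a.degree < n → b.degree < n → (A n).run a b = a * b)

end Scheme

/-! ## The four algorithms -/

section Algorithms

variable (k : Type u) [Field k]

/-! ### Algorithm `𝒜`: multiplication via a DFT over `k` -/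

/-- The exponent `⌈log_s (2n-1)⌉`. -/
def expA (s n : ℕ) : ℕ := ⌈Real.logb s (2 * n - 1)⌉₊

/-- The step of `𝒜` for `x^N - 1` and an `N`-th root of unity `w` of `k`. The smaller algebra is
`k[y]/(y - 1)`, a copy of `k`. -/
def levelA (N : ℕ) (w : k) : Level k (X ^ N - 1) where
  N' := 1
  N'' := N
  Q := X - 1
  idx := Fin N
  fwd a := dft N (AdjoinRoot.of (X - 1 : k[X]) w)
    fun i => AdjoinRoot.of (X - 1 : k[X]) ((rep _ a).coeff i)
  bwd v := ∑ i : Fin N,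
    rep (X - 1) (((N : k)⁻¹) • dft N (AdjoinRoot.of (X - 1 : k[X]) w ^ (N - 1)) v i) * X ^ (i : ℕ)

/-- The algorithm `𝒜`, with the `s^ν`-th root of unity `w ν`. -/
def algA (s : ℕ) (w : ℕ → k) (n : ℕ) : PolyAlg k where
  P := X ^ s ^ expA s n - 1
  top := levelA k (s ^ expA s n) (w (expA s n))
  inner := .direct _

/-! ### Algorithm `ℬ` in characteristic different from 2 (Schönhage–Strassen) -/

/-- The exponent `⌈log_2 (2n-1)⌉`. -/
def expSS (n : ℕ) : ℕ := ⌈Real.logb 2 (2 * n - 1)⌉₊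

/-- The polynomial `x^(2^ν) + 1`. -/
def polySS (ν : ℕ) : k[X] := X ^ 2 ^ ν + 1

/-- The step of the Schönhage–Strassen algorithm for input polynomials whose product has degree less
than `2^ν`. With `N₁ = 2^⌈ν/2⌉` and `N₂ = 2^(⌊ν/2⌋+1)`, the coefficients are grouped into `N₂`
consecutive blocks of length `N₁/2`, so that `y` stands for `x` and the outer variable for
`x^(N₁/2)`. -/
def levelSS (ν : ℕ) : Level k (polySS k ν) :=
  let N₁ := 2 ^ ((ν + 1) / 2)
  let N₂ := 2 ^ (ν / 2 + 1)
  let Q := polySS k ((ν + 1) / 2)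
  let w : AdjoinRoot Q := AdjoinRoot.root Q ^ (2 * N₁ / N₂)
  { N' := N₁
    N'' := 2 ^ (ν / 2)
    Q := Q
    idx := Fin N₂
    fwd := fun a => dft N₂ w fun i => pack Q (N₁ / 2) fun j => (rep _ a).coeff (N₁ / 2 * i + j)
    bwd := fun v => ∑ i : Fin N₂,
      rep Q (((N₂ : k)⁻¹) • dft N₂ (w ^ (N₂ - 1)) v i) * X ^ (N₁ / 2 * (i : ℕ)) }

/-- The recursive step, for multiplication of arbitrary elements of `k[x]/(x^(2^ν) + 1)`, with the
same numbers `N' = 2^⌈ν/2⌉`, `N'' = 2^⌊ν/2⌋` and a DFT of the same order `2 N''`; here `y` stands for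
`x^(N'')` and the outer variable for `x`. -/
def innerLevelSS (ν : ℕ) : Level k (polySS k ν) :=
  let N₁ := 2 ^ ((ν + 1) / 2)
  let M := 2 ^ (ν / 2)
  let Q := polySS k ((ν + 1) / 2)
  let w : AdjoinRoot Q := AdjoinRoot.root Q ^ (N₁ / M)
  { N' := N₁
    N'' := M
    Q := Q
    idx := Fin (2 * M)
    fwd := fun a => dft (2 * M) w fun i =>
      if (i : ℕ) < M then pack Q N₁ fun j => (rep _ a).coeff (i + M * j) else 0
    bwd := fun v => ∑ i : Fin (2 * M),
      expand k M (rep Q ((((2 * M : ℕ) : k)⁻¹) • dft (2 * M) (w ^ (2 * M - 1)) v i)) *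
        X ^ (i : ℕ) }

def innerSS (ν : ℕ) : MulAlg k (polySS k ν) :=
  if _h : ν ≤ 1 then .direct _ else .step (innerLevelSS k ν) (innerSS ((ν + 1) / 2))
termination_by ν
decreasing_by omega

/-- The Schönhage–Strassen algorithm. -/
def algSS (n : ℕ) : PolyAlg k where
  P := polySS k (expSS n)
  top := levelSS k (expSS n)
  inner := innerSS k ((expSS n + 1) / 2)

/-! ### Algorithm `ℬ` in characteristic 2 (Schönhage) -/

/-- The exponent `⌈log_3 (n - 1/2)⌉`. -/
def expSch (n : ℕ) : ℕ := ⌈Real.logb 3 (n - 1 / 2)⌉₊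

/-- The polynomial `x^(2·3^ν) + x^(3^ν) + 1`. -/
def polySch (ν : ℕ) : k[X] := X ^ (2 * 3 ^ ν) + X ^ 3 ^ ν + 1

/-- The step of Schönhage's algorithm. With `N₁ = 3^⌈ν/2⌉` and `N₂ = 3^⌊ν/2⌋`, the coefficients are
grouped into `2 N₂` consecutive blocks of length `N₁`. Only the components of the DFT of order `3 N₂`
whose index is not divisible by 3 are used. -/
def levelSch (ν : ℕ) : Level k (polySch k ν) :=
  let N₁ := 3 ^ ((ν + 1) / 2)
  let N₂ := 3 ^ (ν / 2)
  let Q := polySch k ((ν + 1) / 2)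
  -- a principal `3 N₂`-th root of unity, and its inverse
  let w : AdjoinRoot Q := AdjoinRoot.root Q ^ (N₁ / N₂)
  let w' : AdjoinRoot Q := w ^ (3 * N₂ - 1)
  { N' := 2 * N₁
    N'' := N₂
    Q := Q
    idx := Fin N₂ × Fin 2
    fwd := fun a t =>
      dft (3 * N₂) w
        (fun i => if (i : ℕ) < 2 * N₂ then pack Q N₁ fun j => (rep _ a).coeff (N₁ * i + j) else 0)
        ⟨3 * (t.1 : ℕ) + (t.2 : ℕ) + 1, by have := t.1.isLt; have := t.2.isLt; omega⟩
    bwd := fun v =>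
      let d : Fin 2 → Fin N₂ → AdjoinRoot Q := fun j i =>
        ((N₂ : k)⁻¹) • dft N₂ (w' ^ 3) (fun l => v (l, j)) i
      let lo : Fin N₂ → AdjoinRoot Q := fun i => ((3 : k)⁻¹) •
        ((1 - w' ^ (2 * N₂)) * w' ^ (i : ℕ) * d 0 i +
          (1 - w' ^ (4 * N₂)) * w' ^ (2 * (i : ℕ)) * d 1 i)
      let hi : Fin N₂ → AdjoinRoot Q := fun i => ((3 : k)⁻¹) •
        ((w' ^ N₂ - w' ^ (2 * N₂)) * w' ^ (i : ℕ) * d 0 i +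
          (w' ^ (2 * N₂) - w' ^ (4 * N₂)) * w' ^ (2 * (i : ℕ)) * d 1 i)
      ∑ i : Fin N₂, (rep Q (lo i) * X ^ (N₁ * (i : ℕ)) + rep Q (hi i) * X ^ (N₁ * ((i : ℕ) + N₂))) }

def innerSch (ν : ℕ) : MulAlg k (polySch k ν) :=
  if _h : ν ≤ 1 then .direct _ else .step (levelSch k ν) (innerSch ((ν + 1) / 2))
termination_by ν
decreasing_by omega

/-- Schönhage's algorithm. -/
def algSch (n : ℕ) : PolyAlg k where
  P := polySch k (expSch n)
  top := levelSch k (expSch n)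
  inner := innerSch k ((expSch n + 1) / 2)

/-! ### Algorithm `𝒞` (Cantor–Kaltofen) -/

/-- The exponent `⌈log_s ((4n-2) log s)⌉`. -/
def expCK (s n : ℕ) : ℕ := ⌈Real.logb s ((4 * n - 2) * Real.logb 2 s)⌉₊

/-- The least `ν` with `φ(s^ν) ≥ 2n-1`. -/
def leastExpCK (s n : ℕ) : ℕ := sInf {ν : ℕ | 2 * n - 1 ≤ Nat.totient (s ^ ν)}

/-- The step of the Cantor–Kaltofen algorithm. With `N₃ = s^(⌊ν/2⌋+1)`, `N₁ = φ(N₃)` and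
`N₂ = s^(⌈ν/2⌉-1)`, the outer variable stands for `x` and `y` for `x^(N₂)`; two DFTs of order `N₂`
are used, of `ā(x)` and of `ā(ξ x)`. -/
def levelCK (s ν : ℕ) : Level k (cyclotomic (s ^ ν) k) :=
  let N₃ := s ^ (ν / 2 + 1)
  let N₁ := Nat.totient N₃
  let N₂ := s ^ ((ν + 1) / 2 - 1)
  let Q : k[X] := cyclotomic N₃ k
  let w : AdjoinRoot Q := AdjoinRoot.root Q ^ (N₃ / N₂)
  -- a principal `s N₂`-th root of unity, and its inverse
  let ξ : AdjoinRoot Q := AdjoinRoot.root Q ^ (N₃ / (s * N₂))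
  let ξ' : AdjoinRoot Q := ξ ^ (s * N₂ - 1)
  -- the inverse of `1 - ξ ^ N₂`, written without divisions in `k[y]/Q`
  let τ : ℕ := if IsPrimePow s then s.minFac else 1
  let inv : AdjoinRoot Q := ((τ : k)⁻¹) •
    ∏ i ∈ (Finset.range s).filter (fun i => 2 ≤ i ∧ Nat.Coprime i s), (1 - ξ ^ (N₂ * i))
  { N' := N₁
    N'' := N₂
    Q := Q
    idx := Fin N₂ ⊕ Fin N₂
    fwd := fun a =>
      let c : Fin N₂ → AdjoinRoot Q := fun i => pack Q N₁ fun j => (rep _ a).coeff (i + N₂ * j)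
      Sum.elim (dft N₂ w c) (dft N₂ w fun i => ξ ^ (i : ℕ) * c i)
    bwd := fun v =>
      let c₁ : Fin N₂ → AdjoinRoot Q := fun i =>
        ((N₂ : k)⁻¹) • dft N₂ (w ^ (N₂ - 1)) (fun l => v (Sum.inl l)) i
      let c₂ : Fin N₂ → AdjoinRoot Q := fun i =>
        ξ' ^ (i : ℕ) * (((N₂ : k)⁻¹) • dft N₂ (w ^ (N₂ - 1)) (fun l => v (Sum.inr l)) i)
      ∑ i : Fin N₂, (expand k N₂ (rep Q (inv * (c₂ i - ξ ^ N₂ * c₁ i))) * X ^ (i : ℕ) +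
        expand k N₂ (rep Q (inv * (c₁ i - c₂ i))) * X ^ ((i : ℕ) + N₂)) }

def innerCK (s ν : ℕ) : MulAlg k (cyclotomic (s ^ ν) k) :=
  if _h : ν ≤ 2 then .direct _ else .step (levelCK k s ν) (innerCK s (ν / 2 + 1))
termination_by ν
decreasing_by omega

/-- The Cantor–Kaltofen algorithm with the choice `e n` of the exponent. -/
def algCK (s : ℕ) (e : ℕ → ℕ) (n : ℕ) : PolyAlg k where
  P := cyclotomic (s ^ e n) k
  top := levelCK k s (e n)
  inner := innerCK k s (e n / 2 + 1)

end Algorithms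

end DFTMul

end

noncomputable section

namespace DFTMul

/-! ## Building straight-line programs -/

section Programs

variable {R ι : Type*} [Ring R]

/-! All four algorithms are evaluation and interpolation over a small algebra `k[y]/Q`. The
coefficients of `a` are cut into `R` blocks of length `J`, which become the coefficients of an outer
polynomial over `k[y]/Q`. The transform evaluates it at certain points. Componentwise products are
values of the product polynomial. The back-transform interpolates a polynomial of degree less than
`T` and substitutes `y ↦ x ^ M` and outer variable `↦ x ^ h`. `Level.IsTransform` records this
pattern, with consecutive (`M = 1`, `h = J`) or interleaved (`h = 1`, `M = R`) blocks. Injectivity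
and the left inverse follow from it at once.

Products come out right for three reasons. If the degrees in both variables stay below `deg Q` and
`T`, nothing wraps around and the product in `k[x]` appears (`bwd_fwd_mul_fwd`). If `P` divides `Q(x
^ M)`, then `y ↦ x ^ M` is a ring homomorphism to `k[x]/P`, so reduction modulo `Q` is harmless
(`exec_mul_of_dvd`). In Schönhage's step the wrap happens in the outer variable: every point is a
root of `X ^ (2N) + X ^ N + 1`, and so is `x ^ h` in `k[x]/P`, so the outer product may be folded
modulo this polynomial (`exec_mul_of_fold`). Correctness of the recursion is then an induction
(`MulAlg.IsD.run_eq`).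

The roots of unity come from cyclotomic polynomials; the recursive moduli are `Φ` of powers of 2, 3
and `s`. An integral polynomial identity valid at complex primitive `n`-th roots of unity holds at
every root `y` of `Φ_n`, because `Φ_n` is a minimal polynomial over `ℤ`. Thus `∏ (1 - y ^ j) = n`
over `0 < j < n`, and if `n` is invertible in `k` each factor is a unit, so `y` is principal
(`isPrincipalRoot_of_aeval_cyclotomic`). The product over `j` coprime to `s` gives the division-free
inverse in the Cantor–Kaltofen step (`inverse_one_sub`).

For the cost, the radix-`s` FFT makes every order `s ^ ν` suitable with constant `2 s`
(`suitableRoot_pow`). The remaining linear maps are sparse: each output coordinate involves a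
bounded number of input coordinates. This rests on `Φ_{s^(a+1)}(y) = Φ_s(y^(s^a))`, which makes
multiplication by a power of `y` sparse, and on the fact that at most two recombined blocks meet in
one coefficient. `isDStep_of_isTransform` combines these facts. The order sequences are geometric,
and the exponents are estimated by the ceiling of a logarithm and, for the last algorithm, by `s /
φ(s) ≤ 2 log s`. -/

theorem runProgram_append_singleton (p : List (Instr R ι)) (I : Instr R ι) (v : ι → R) :
    runProgram (p ++ [I]) v = runProgram p v ++ [I.eval v (runProgram p v)] := by
  simp [runProgram]

theorem length_runProgram (p : List (Instr R ι)) (v : ι → R) :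
    (runProgram p v).length = p.length := by
  induction p using List.reverseRecOn with
  | nil => simp [runProgram]
  | append_singleton p I ih => simp [runProgram_append_singleton, ih]

theorem runProgram_append (p q : List (Instr R ι)) (v : ι → R) :
    ∃ w, runProgram (p ++ q) v = runProgram p v ++ w := by
  induction q using List.reverseRecOn with
  | nil => exact ⟨[], by simp⟩
  | append_singleton q I ih =>
    obtain ⟨w, hw⟩ := ih
    rw [← List.append_assoc, runProgram_append_singleton, hw]
    exact ⟨_, List.append_assoc _ _ _⟩

/-- The function `f` of the inputs is available after the program `p`. -/
def Avail (p : List (Instr R ι)) (f : (ι → R) → R) : Prop :=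
  ∃ o : Operand R ι, ∀ q v, o.eval v (runProgram (p ++ q) v) = f v

theorem avail_input (p : List (Instr R ι)) (i : ι) : Avail p fun v => v i :=
  ⟨.input i, fun _ _ => rfl⟩

theorem avail_const (p : List (Instr R ι)) (c : R) : Avail p fun _ => c :=
  ⟨.const c, fun _ _ => rfl⟩

/-- Availability is quantified over all continuations of the program, so extending the program only
reassociates lists. -/
theorem Avail.append {p : List (Instr R ι)} {f : (ι → R) → R} (h : Avail p f)
    (q : List (Instr R ι)) : Avail (p ++ q) f := by
  obtain ⟨o, ho⟩ := h
  exact ⟨o, fun q' v => by rw [List.append_assoc]; exact ho _ v⟩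

theorem avail_instr (p : List (Instr R ι)) (I : Instr R ι) :
    Avail (p ++ [I]) fun v => I.eval v (runProgram p v) := by
  refine ⟨.result p.length, fun q v => ?_⟩
  obtain ⟨w, hw⟩ := runProgram_append (p ++ [I]) q v
  rw [hw, runProgram_append_singleton]
  simp [Operand.eval, List.getD, ← length_runProgram p v]

/-- From the functions in `S`, those in `S'` can be computed by at most `T` steps. -/
def Cost (T : ℕ) (S S' : Set ((ι → R) → R)) : Prop :=
  ∀ p : List (Instr R ι), (∀ f ∈ S, Avail p f) →
    ∃ q : List (Instr R ι), q.length ≤ T ∧ ∀ f ∈ S', Avail (p ++ q) f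

theorem Cost.mono {T T' : ℕ} {S S' : Set ((ι → R) → R)} (h : Cost T S S') (hT : T ≤ T') :
    Cost T' S S' := fun p hp =>
  let ⟨q, hq, h'⟩ := h p hp
  ⟨q, hq.trans hT, h'⟩

theorem Cost.subset {T : ℕ} {S S₁ S' S₁' : Set ((ι → R) → R)} (h : Cost T S S') (hS : S ⊆ S₁)
    (hS' : S₁' ⊆ S') : Cost T S₁ S₁' := fun p hp =>
  let ⟨q, hq, h'⟩ := h p fun f hf => hp f (hS hf)
  ⟨q, hq, fun f hf => h' f (hS' hf)⟩

theorem Cost.trans {T T' : ℕ} {S S₁ S₂ : Set ((ι → R) → R)} (h : Cost T S S₁)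
    (h' : Cost T' S₁ S₂) : Cost (T + T') S S₂ := by
  intro p hp
  obtain ⟨q, hq, h1⟩ := h p hp
  obtain ⟨q', hq', h2⟩ := h' (p ++ q) h1
  refine ⟨q ++ q', by simp; omega, fun f hf => ?_⟩
  rw [← List.append_assoc]
  exact h2 f hf

theorem Cost.iUnion {α : Type*} (s : Finset α) {T : ℕ} {S : Set ((ι → R) → R)}
    {S' : α → Set ((ι → R) → R)} (h : ∀ a ∈ s, Cost T S (S' a)) :
    Cost (s.card * T) S (⋃ a ∈ s, S' a) := by
  classical
  induction s using Finset.induction_on with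
  | empty => exact fun p _ => ⟨[], by simp, by simp⟩
  | insert a s ha ih =>
    intro p hp
    obtain ⟨q, hq, h1⟩ := ih (fun b hb => h b (Finset.mem_insert_of_mem hb)) p hp
    obtain ⟨q', hq', h2⟩ := h a (Finset.mem_insert_self a s) (p ++ q) fun f hf => (hp f hf).append q
    refine ⟨q ++ q', ?_, fun f hf => ?_⟩
    · rw [Finset.card_insert_of_notMem ha, List.length_append, add_mul]
      omega
    · rw [← List.append_assoc]
      simp only [Finset.mem_insert, Set.iUnion_iUnion_eq_or_left, Set.mem_union] at hf
      rcases hf with hf | hf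
      · exact h2 f hf
      · exact (h1 f hf).append q'

theorem cost_linearCombination {S : Set ((ι → R) → R)} (l : List (R × ((ι → R) → R)))
    (hl : ∀ t ∈ l, t.2 ∈ S) :
    Cost (2 * l.length) S {fun v => (l.map fun t => t.1 * t.2 v).sum} := by
  induction l with
  -- The empty sum is a constant operand and costs nothing; each term then takes one multiplication
  -- and one addition.
  | nil => exact fun p _ => ⟨[], by simp, by simpa using avail_const p 0⟩
  | cons t l ih =>
    intro p hp
    obtain ⟨q, hq, h1⟩ := ih (fun t ht => hl t (List.mem_cons_of_mem _ ht)) p hp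
    obtain ⟨o, ho⟩ := h1 _ rfl
    obtain ⟨o', ho'⟩ := hp _ (hl t List.mem_cons_self)
    have h2 := avail_instr (p ++ q) (.mul (.const t.1) o')
    obtain ⟨o'', ho''⟩ := h2
    have h3 := avail_instr (p ++ q ++ [.mul (.const t.1) o']) (.add o'' o)
    refine ⟨q ++ [.mul (.const t.1) o'] ++ [.add o'' o], by simp; omega, ?_⟩
    rintro f rfl
    rw [← List.append_assoc, ← List.append_assoc]
    convert h3 using 2 with v
    have e1 := ho'' [] v
    have e2 := ho [.mul (.const t.1) o'] v
    have e3 := ho' q v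
    rw [List.append_nil] at e1
    simp only [Instr.eval, e1, e2, e3, List.map_cons, List.sum_cons]
    simp [Operand.eval]

theorem Cost.slpComputes {κ : Type*} {T : ℕ} {T' : ℝ} {f : (ι → R) → κ → R}
    (h : Cost T (Set.range fun i v => v i) (Set.range fun j v => f v j)) (hT : (T : ℝ) ≤ T') :
    SLPComputes T' f := by
  obtain ⟨q, hq, h1⟩ := h [] (by rintro _ ⟨i, rfl⟩; exact avail_input _ i)
  choose out hout using fun j => h1 _ ⟨j, rfl⟩
  refine ⟨q, le_trans (by exact_mod_cast hq) hT, out, fun v j => ?_⟩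
  simpa using hout j [] v

/-! ## The fast Fourier transform -/

theorem sum_range_mul_eq {M : Type*} [AddCommMonoid M] (f : ℕ → M) (R J : ℕ) :
    ∑ m ∈ Finset.range (R * J), f m =
      ∑ i ∈ Finset.range R, ∑ j ∈ Finset.range J, f (J * i + j) := by
  induction R with
  | zero => simp
  | succ R ih => rw [Finset.sum_range_succ, ← ih, add_mul, one_mul, Finset.sum_range_add, mul_comm J]

theorem sum_range_mul_eq' {M : Type*} [AddCommMonoid M] (f : ℕ → M) (R J : ℕ) :
    ∑ m ∈ Finset.range (R * J), f m =
      ∑ i ∈ Finset.range R, ∑ j ∈ Finset.range J, f (i + R * j) := by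
  rw [mul_comm, sum_range_mul_eq, Finset.sum_comm]
  simp only [add_comm]

/-- Splitting the summation index as `r + s j` reduces the DFT of order `s ^ (ν + 1)` to `s` DFTs of
order `s ^ ν` with respect to `ω ^ s`, followed by combinations of `s` terms: `T(ν + 1) = s T(ν) + 2
s · s ^ (ν + 1)`. The output index runs through all of `ℕ`, so the smaller transforms can be used at
the same index `i` without reduction. -/
theorem cost_fft {s : ℕ} (hs : 0 < s) (ν : ℕ) (ω : R) (hω : ω ^ s ^ ν = 1) (a : ℕ → (ι → R) → R) :
    Cost (2 * s * ν * s ^ ν) (Set.range a)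
      (Set.range fun i v => ∑ j ∈ Finset.range (s ^ ν), ω ^ (i * j) * a j v) := by
  induction ν generalizing ω a with
  | zero =>
    refine fun p hp => ⟨[], by simp, ?_⟩
    rintro _ ⟨i, rfl⟩
    simpa using hp _ ⟨0, rfl⟩
  | succ ν ih =>
    have hωs : (ω ^ s) ^ s ^ ν = 1 := by rw [← pow_mul, ← pow_succ', hω]
    have h1 := Cost.iUnion (Finset.range s) (T := 2 * s * ν * s ^ ν) (S := Set.range a)
      (S' := fun r => Set.range fun i v =>
        ∑ j ∈ Finset.range (s ^ ν), (ω ^ s) ^ (i * j) * a (r + s * j) v)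
      (fun r _ => (ih (ω ^ s) hωs fun j => a (r + s * j)).subset
        (by rintro _ ⟨j, rfl⟩; exact ⟨_, rfl⟩) subset_rfl)
    have h2 := Cost.iUnion (Finset.range (s ^ (ν + 1))) (T := 2 * s)
      (S := ⋃ r ∈ Finset.range s, Set.range fun i v =>
        ∑ j ∈ Finset.range (s ^ ν), (ω ^ s) ^ (i * j) * a (r + s * j) v)
      (S' := fun i => {fun v => ∑ j ∈ Finset.range (s ^ (ν + 1)), ω ^ (i * j) * a j v})
      (fun i _ => by
        have := cost_linearCombination (S := ⋃ r ∈ Finset.range s, Set.range fun i v =>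
            ∑ j ∈ Finset.range (s ^ ν), (ω ^ s) ^ (i * j) * a (r + s * j) v)
          ((List.range s).map fun r => (ω ^ (i * r), fun v =>
            ∑ j ∈ Finset.range (s ^ ν), (ω ^ s) ^ (i * j) * a (r + s * j) v)) (by
            intro t ht
            simp only [List.mem_map, List.mem_range] at ht
            obtain ⟨r, hr, rfl⟩ := ht
            simp only [Set.mem_iUnion, Finset.mem_range]
            exact ⟨r, hr, i, rfl⟩)
        rw [List.length_map, List.length_range] at this
        convert this using 3 with v
        rw [List.map_map, ← List.sum_toFinset _ List.nodup_range, List.toFinset_range, pow_succ',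
          sum_range_mul_eq']
        refine Finset.sum_congr rfl fun r _ => ?_
        simp only [Function.comp, Finset.mul_sum]
        refine Finset.sum_congr rfl fun j _ => ?_
        rw [← mul_assoc, ← pow_mul, ← pow_add]
        congr 2
        ring)
    refine ((h1.trans h2).subset subset_rfl ?_).mono ?_
    · rintro _ ⟨i, rfl⟩
      simp only [Set.mem_iUnion, Finset.mem_range]
      -- Only one period of outputs is computed; the others coincide with these because `ω ^ s ^ (ν
      -- + 1) = 1`.
      refine ⟨i % s ^ (ν + 1), Nat.mod_lt _ (pow_pos hs _), ?_⟩
      rw [Set.mem_singleton_iff]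
      funext v
      refine Finset.sum_congr rfl fun j _ => ?_
      congr 1
      conv_lhs =>
        rw [← Nat.mod_add_div i (s ^ (ν + 1)), add_mul, pow_add, mul_assoc,
          pow_mul ω (s ^ (ν + 1)), hω, one_pow, mul_one]
    · rw [Finset.card_range, Finset.card_range]
      apply le_of_eq
      ring

theorem suitableRoot_pow {s : ℕ} (hs : 2 ≤ s) (ν : ℕ) {ω : R} (hω : IsPrincipalRoot (s ^ ν) ω)
    {K : ℝ} (hK : 2 * s ≤ K) : SuitableRoot K (s ^ ν) ω := by
  refine ⟨hω, ?_⟩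
  have hs0 : 0 < s := by omega
  -- The FFT takes a sequence on `ℕ`; entries beyond the input are the constant zero and are free.
  have h := cost_fft (ι := Fin (s ^ ν)) hs0 ν ω hω.1
    fun j v => if hj : j < s ^ ν then v ⟨j, hj⟩ else 0
  have h0 : Cost 0 (Set.range fun (i : Fin (s ^ ν)) (v : Fin (s ^ ν) → R) => v i)
      (Set.range fun j v => if hj : j < s ^ ν then v ⟨j, hj⟩ else 0) := by
    refine fun p _ => ⟨[], by simp, ?_⟩
    rintro _ ⟨j, rfl⟩
    by_cases hj : j < s ^ ν
    · simpa [hj] using avail_input p _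
    · simpa [hj] using avail_const p 0
  refine Cost.slpComputes ((h0.trans h).subset subset_rfl ?_) ?_
  · rintro _ ⟨i, rfl⟩
    refine ⟨i, ?_⟩
    funext v
    simp [dft, Finset.sum_range]
  -- The count `2 s ν s ^ ν` has `ν = log n / log s`, and `log s ≥ 1` absorbs the difference from
  -- `log n`.
  · have h1 : (1 : ℝ) ≤ Real.logb 2 s := by
      rw [Real.le_logb_iff_rpow_le (by norm_num) (by positivity)]
      simpa using (by exact_mod_cast hs : (2 : ℝ) ≤ s)
    push_cast
    rw [Real.logb_pow, zero_add]
    have h2 : (0 : ℝ) ≤ (s : ℝ) ^ ν * ν := by positivity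
    calc (2 * s * ν * s ^ ν : ℝ) = 2 * s * (s ^ ν * ν) * 1 := by ring
      _ ≤ K * (s ^ ν * ν) * Real.logb 2 s := by gcongr; nlinarith [(by positivity : (0 : ℝ) ≤ s)]
      _ = K * s ^ ν * (ν * Real.logb 2 s) := by ring

end Programs

/-! ## Coordinates of `k[x]/P` -/

section Rep

variable {k : Type u} [Field k] {P Q : k[X]}

/-- The remainder modulo a monic `P` does not depend on the representative chosen in `rep`, so `rep`
inherits linearity from `AdjoinRoot.modByMonicHom`. -/
theorem rep_eq_modByMonicHom (hP : P.Monic) (a : AdjoinRoot P) :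
    rep P a = AdjoinRoot.modByMonicHom hP a := by
  conv_rhs => rw [← (AdjoinRoot.mk_surjective (g := P) a).choose_spec]
  rw [AdjoinRoot.modByMonicHom_mk, rep]

theorem rep_mk (hP : P.Monic) (p : k[X]) : rep P (AdjoinRoot.mk P p) = p %ₘ P := by
  rw [rep_eq_modByMonicHom hP, AdjoinRoot.modByMonicHom_mk]

theorem rep_mk_of_degree_lt (hP : P.Monic) {p : k[X]} (hp : p.degree < P.degree) :
    rep P (AdjoinRoot.mk P p) = p := by
  rw [rep_mk hP, (modByMonic_eq_self_iff hP).2 hp]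

theorem mk_rep (hP : P.Monic) (a : AdjoinRoot P) : AdjoinRoot.mk P (rep P a) = a := by
  rw [rep_eq_modByMonicHom hP]
  exact AdjoinRoot.mk_leftInverse hP a

theorem rep_add (hP : P.Monic) (a b : AdjoinRoot P) : rep P (a + b) = rep P a + rep P b := by
  simp only [rep_eq_modByMonicHom hP, map_add]

theorem rep_sub (hP : P.Monic) (a b : AdjoinRoot P) : rep P (a - b) = rep P a - rep P b := by
  simp only [rep_eq_modByMonicHom hP, map_sub]

theorem rep_smul (hP : P.Monic) (c : k) (a : AdjoinRoot P) : rep P (c • a) = c • rep P a := by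
  simp only [rep_eq_modByMonicHom hP, map_smul]

theorem rep_zero (hP : P.Monic) : rep P 0 = 0 := by
  simp only [rep_eq_modByMonicHom hP, map_zero]

theorem rep_sum (hP : P.Monic) {α : Type*} (s : Finset α) (f : α → AdjoinRoot P) :
    rep P (∑ i ∈ s, f i) = ∑ i ∈ s, rep P (f i) := by
  simp only [rep_eq_modByMonicHom hP, map_sum]

theorem degree_rep_lt (hP : P.Monic) (a : AdjoinRoot P) : (rep P a).degree < P.degree :=
  degree_modByMonic_lt _ hP

theorem coeff_rep_of_le (hP : P.Monic) (a : AdjoinRoot P) {m : ℕ} (hm : P.natDegree ≤ m) :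
    (rep P a).coeff m = 0 :=
  coeff_eq_zero_of_degree_lt ((degree_rep_lt hP a).trans_le
    (degree_le_natDegree.trans (by exact_mod_cast hm)))

theorem coeff_ofCoeffs (N : ℕ) (v : Fin N → k) (m : ℕ) :
    (ofCoeffs N v).coeff m = if h : m < N then v ⟨m, h⟩ else 0 := by
  simp only [ofCoeffs, finsetSum_coeff, coeff_C_mul, coeff_X_pow]
  split_ifs with h
  · rw [Finset.sum_eq_single ⟨m, h⟩]
    · simp
    · intro i _ hi
      have : m ≠ i := fun h => hi (Fin.ext h.symm)
      simp [this]
    · simp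
  · refine Finset.sum_eq_zero fun i _ => ?_
    have : m ≠ i := by have := i.isLt; omega
    simp [this]

theorem ofCoeffs_coeff {N : ℕ} {p : k[X]} (hp : ∀ m, N ≤ m → p.coeff m = 0) :
    ofCoeffs N (fun i => p.coeff i) = p := by
  ext m
  rw [coeff_ofCoeffs]
  split_ifs with h
  · rfl
  · exact (hp m (by omega)).symm

theorem coeff_rep_ofCoords (hP : P.Monic) {N : ℕ} (hN : P.natDegree = N) (v : Fin N → k) (m : ℕ) :
    (rep P (ofCoords P N v)).coeff m = if h : m < N then v ⟨m, h⟩ else 0 := by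
  rw [ofCoords, rep_mk_of_degree_lt hP, coeff_ofCoeffs]
  rw [degree_eq_natDegree hP.ne_zero, degree_lt_iff_coeff_zero]
  intro m hm
  rw [coeff_ofCoeffs, dif_neg (by omega)]

theorem ofCoords_coeff_rep (hP : P.Monic) {N : ℕ} (hN : P.natDegree = N) (a : AdjoinRoot P) :
    ofCoords P N (fun i => (rep P a).coeff i) = a := by
  rw [ofCoords, ofCoeffs_coeff fun m hm => coeff_rep_of_le hP a (by omega), mk_rep hP]

theorem coeff_sum_range_C_mul_X_pow (J : ℕ) (c : ℕ → k) (m : ℕ) :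
    (∑ j ∈ Finset.range J, C (c j) * X ^ j).coeff m = if m < J then c m else 0 := by
  simp [coeff_X_pow]

theorem rep_pack (hQ : Q.Monic) {J : ℕ} (hJ : J ≤ Q.natDegree) (c : ℕ → k) :
    rep Q (pack Q J c) = ∑ j ∈ Finset.range J, C (c j) * X ^ j := by
  rw [pack, rep_mk_of_degree_lt hQ]
  rw [degree_eq_natDegree hQ.ne_zero, degree_lt_iff_coeff_zero]
  intro m hm
  rw [coeff_sum_range_C_mul_X_pow, if_neg (by omega)]

theorem pack_add (J : ℕ) (c d : ℕ → k) :
    pack Q J (fun j => c j + d j) = pack Q J c + pack Q J d := by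
  simp [pack, add_mul, Finset.sum_add_distrib]

theorem pack_smul (J : ℕ) (r : k) (c : ℕ → k) :
    pack Q J (fun j => r * c j) = r • pack Q J c := by
  rw [pack, pack, AdjoinRoot.smul_mk, Finset.smul_sum]
  simp only [smul_eq_C_mul, C_mul, mul_assoc]

end Rep

/-! ## Sparse linear maps -/

section Sparse

variable {k : Type u} [Field k]

/-- The linear form `φ` involves at most `r` coordinates. -/
def SparseForm {ι : Type*} (r : ℕ) (φ : (ι → k) → k) : Prop :=
  ∃ l : List (k × ι), l.length ≤ r ∧ ∀ v, φ v = (l.map fun t => t.1 * v t.2).sum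

variable {ι κ : Type*}

theorem SparseForm.mono {r r' : ℕ} {φ : (ι → k) → k} (h : SparseForm r φ) (hr : r ≤ r') :
    SparseForm r' φ :=
  let ⟨l, hl, h⟩ := h
  ⟨l, hl.trans hr, h⟩

theorem sparseForm_zero (r : ℕ) : SparseForm r fun _ : ι → k => 0 := ⟨[], by simp, by simp⟩

theorem sparseForm_apply (i : ι) : SparseForm 1 fun v : ι → k => v i := ⟨[(1, i)], by simp, by simp⟩

theorem SparseForm.add {r r' : ℕ} {φ ψ : (ι → k) → k} (h : SparseForm r φ)
    (h' : SparseForm r' ψ) : SparseForm (r + r') fun v => φ v + ψ v := by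
  obtain ⟨l, hl, h⟩ := h
  obtain ⟨l', hl', h'⟩ := h'
  exact ⟨l ++ l', by simp; omega, fun v => by simp [h, h']⟩

theorem SparseForm.const_mul {r : ℕ} {φ : (ι → k) → k} (h : SparseForm r φ) (c : k) :
    SparseForm r fun v => c * φ v := by
  obtain ⟨l, hl, h⟩ := h
  refine ⟨l.map fun t => (c * t.1, t.2), by simpa using hl, fun v => ?_⟩
  simp [h, Function.comp_def, mul_assoc, List.sum_map_mul_left]

theorem SparseForm.sub {r r' : ℕ} {φ ψ : (ι → k) → k} (h : SparseForm r φ)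
    (h' : SparseForm r' ψ) : SparseForm (r + r') fun v => φ v - ψ v := by
  simpa [sub_eq_add_neg] using h.add (h'.const_mul (-1))

theorem SparseForm.sum {α : Type*} {r : ℕ} (s : Finset α) {φ : α → (ι → k) → k}
    (h : ∀ a ∈ s, SparseForm r (φ a)) : SparseForm (s.card * r) fun v => ∑ a ∈ s, φ a v := by
  classical
  induction s using Finset.induction_on with
  | empty => simpa using sparseForm_zero 0
  | insert a s ha ih =>
    simp only [Finset.sum_insert ha, Finset.card_insert_of_notMem ha]
    exact ((h a (Finset.mem_insert_self a s)).add
      (ih fun b hb => h b (Finset.mem_insert_of_mem hb))).mono (by linarith)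

/-- A sum of sparse forms of which few are nonzero. -/
theorem SparseForm.sum_of_subset {α : Type*} {r t : ℕ} (s T : Finset α) {φ : α → (ι → k) → k}
    (h : ∀ a ∈ s, SparseForm r (φ a)) (hT : T ⊆ s) (hcard : T.card ≤ t)
    (h0 : ∀ a ∈ s, a ∉ T → ∀ v, φ a v = 0) : SparseForm (t * r) fun v => ∑ a ∈ s, φ a v := by
  have : (fun v => ∑ a ∈ s, φ a v) = fun v => ∑ a ∈ T, φ a v :=
    _root_.funext fun v => (Finset.sum_subset hT fun a ha hn => h0 a ha hn v).symm
  rw [this]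
  exact (SparseForm.sum T fun a ha => h a (hT ha)).mono (Nat.mul_le_mul_right _ hcard)

theorem SparseForm.comp {r r' : ℕ} {φ : (κ → k) → k} (h : SparseForm r φ) {g : (ι → k) → κ → k}
    (hg : ∀ j, SparseForm r' fun v => g v j) : SparseForm (r * r') fun v => φ (g v) := by
  obtain ⟨l, hl, h⟩ := h
  refine SparseForm.mono (r := l.length * r') ?_ (Nat.mul_le_mul_right _ hl)
  simp only [h]
  clear h hl
  induction l with
  | nil => simpa using sparseForm_zero 0
  | cons t l ih =>
    simp only [List.map_cons, List.sum_cons]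
    exact (((hg t.2).const_mul t.1).add ih).mono (by simp [add_mul]; omega)

/-- Each output costs at most two operations per coordinate involved, and the outputs are computed
independently. -/
theorem slpComputes_of_sparseForm [Fintype κ] {r : ℕ} {g : (ι → k) → κ → k}
    (h : ∀ j, SparseForm r fun v => g v j) {T : ℝ} (hT : 2 * r * (Fintype.card κ : ℝ) ≤ T) :
    SLPComputes T g := by
  have h1 := Cost.iUnion (Finset.univ : Finset κ) (T := 2 * r)
    (S := Set.range fun (i : ι) (v : ι → k) => v i) (S' := fun j => {fun v => g v j}) (fun j _ => by
      obtain ⟨l, hl, hg⟩ := h j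
      have := cost_linearCombination (S := Set.range fun (i : ι) (v : ι → k) => v i)
        (l.map fun t => (t.1, fun v : ι → k => v t.2)) (by
          intro t ht
          obtain ⟨t, _, rfl⟩ := List.mem_map.1 ht
          exact ⟨t.2, rfl⟩)
      simp only [List.map_map, Function.comp_def, ← hg, List.length_map] at this
      exact this.mono (by omega))
  refine Cost.slpComputes (h1.subset subset_rfl ?_) (le_trans (le_of_eq ?_) hT)
  · rintro _ ⟨j, rfl⟩
    simp
  · push_cast [Finset.card_univ]
    ring

/-- In coordinates, the entries of `f` are linear forms that involve at most `r` coordinates. -/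
def SparseIn {V W : Type*} (r : ℕ) (e₁ : (ι → k) → V) (e₂ : (κ → k) → W) (f : V → W) : Prop :=
  ∃ g : (ι → k) → κ → k, (∀ j, SparseForm r fun v => g v j) ∧ ∀ v, f (e₁ v) = e₂ (g v)

theorem SparseIn.computableWithin [Fintype κ] {V W : Type*} {r : ℕ} {e₁ : (ι → k) → V}
    {e₂ : (κ → k) → W} {f : V → W} (h : SparseIn r e₁ e₂ f) {T : ℝ}
    (hT : 2 * r * (Fintype.card κ : ℝ) ≤ T) : ComputableWithin T e₁ e₂ f :=
  let ⟨g, hg, h⟩ := h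
  ⟨g, slpComputes_of_sparseForm hg hT, h⟩

variable {Q : k[X]}

/-- The coordinates of `f v` are linear forms in `v` that involve at most `r` coordinates. -/
def SparseMap (r : ℕ) (f : (ι → k) → AdjoinRoot Q) : Prop :=
  ∀ l, SparseForm r fun v => (rep Q (f v)).coeff l

theorem SparseMap.mono {r r' : ℕ} {f : (ι → k) → AdjoinRoot Q} (h : SparseMap r f) (hr : r ≤ r') :
    SparseMap r' f := fun l => (h l).mono hr

theorem sparseMap_zero (hQ : Q.Monic) (r : ℕ) : SparseMap r fun _ : ι → k => (0 : AdjoinRoot Q) :=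
  fun l => by simpa [rep_zero hQ] using sparseForm_zero r

theorem SparseMap.add (hQ : Q.Monic) {r r' : ℕ} {f g : (ι → k) → AdjoinRoot Q} (h : SparseMap r f)
    (h' : SparseMap r' g) : SparseMap (r + r') fun v => f v + g v := fun l => by
  simpa [rep_add hQ] using (h l).add (h' l)

theorem SparseMap.sub (hQ : Q.Monic) {r r' : ℕ} {f g : (ι → k) → AdjoinRoot Q} (h : SparseMap r f)
    (h' : SparseMap r' g) : SparseMap (r + r') fun v => f v - g v := fun l => by
  simpa [rep_sub hQ] using (h l).sub (h' l)

theorem SparseMap.smul (hQ : Q.Monic) {r : ℕ} {f : (ι → k) → AdjoinRoot Q} (h : SparseMap r f)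
    (c : k) : SparseMap r fun v => c • f v := fun l => by
  simpa [rep_smul hQ] using (h l).const_mul c

theorem sparseMap_ofCoords (hQ : Q.Monic) {N : ℕ} (hN : Q.natDegree = N) {r : ℕ}
    {g : (ι → k) → Fin N → k} (hg : ∀ l, SparseForm r fun v => g v l) :
    SparseMap r fun v => ofCoords Q N (g v) := fun l => by
  simp only [coeff_rep_ofCoords hQ hN]
  split_ifs with h
  · exact hg ⟨l, h⟩
  · exact sparseForm_zero r

theorem sparseMap_pack (hQ : Q.Monic) {J : ℕ} (hJ : J ≤ Q.natDegree) {r : ℕ} {c : (ι → k) → ℕ → k}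
    (hc : ∀ j, SparseForm r fun v => c v j) : SparseMap r fun v => pack Q J (c v) := fun l => by
  simp only [rep_pack hQ hJ, coeff_sum_range_C_mul_X_pow]
  split_ifs with h
  · exact hc l
  · exact sparseForm_zero r

/-- Each coordinate of `u * a` involves at most `r` coordinates of `a`. -/
def SparseMul (r : ℕ) (u : AdjoinRoot Q) : Prop :=
  SparseMap r fun v : Fin Q.natDegree → k => u * ofCoords Q Q.natDegree v

theorem SparseMul.mono {r r' : ℕ} {u : AdjoinRoot Q} (h : SparseMul r u) (hr : r ≤ r') :
    SparseMul r' u := SparseMap.mono h hr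

theorem SparseMul.sparseMap (hQ : Q.Monic) {r r' : ℕ} {u : AdjoinRoot Q} (hu : SparseMul r u)
    {f : (ι → k) → AdjoinRoot Q} (hf : SparseMap r' f) : SparseMap (r * r') fun v => u * f v :=
  fun l => by
    have := (hu l).comp (g := fun v i => (rep Q (f v)).coeff i) fun i => hf i
    simpa only [ofCoords_coeff_rep hQ rfl] using this

theorem sparseMul_one (hQ : Q.Monic) : SparseMul 1 (1 : AdjoinRoot Q) := by
  simpa only [SparseMul, one_mul] using
    sparseMap_ofCoords hQ rfl (g := fun v : Fin Q.natDegree → k => v) fun l => sparseForm_apply l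

theorem SparseMul.mul (hQ : Q.Monic) {r r' : ℕ} {u u' : AdjoinRoot Q} (h : SparseMul r u)
    (h' : SparseMul r' u') : SparseMul (r * r') (u * u') := by
  simpa only [SparseMul, mul_assoc] using SparseMul.sparseMap hQ h h'

theorem SparseMul.sub (hQ : Q.Monic) {r r' : ℕ} {u u' : AdjoinRoot Q} (h : SparseMul r u)
    (h' : SparseMul r' u') : SparseMul (r + r') (u - u') := by
  simpa only [SparseMul, sub_mul] using SparseMap.sub hQ h h'

theorem SparseMul.smul (hQ : Q.Monic) {r : ℕ} {u : AdjoinRoot Q} (h : SparseMul r u) (c : k) :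
    SparseMul r (c • u) := by
  simpa only [SparseMul, smul_mul_assoc] using SparseMap.smul hQ h c

theorem SparseMul.prod (hQ : Q.Monic) {α : Type*} (s : Finset α) {r : ℕ} {u : α → AdjoinRoot Q}
    (h : ∀ a ∈ s, SparseMul r (u a)) : SparseMul (r ^ s.card) (∏ a ∈ s, u a) := by
  classical
  induction s using Finset.induction_on with
  | empty => simpa using sparseMul_one hQ
  | insert a s ha ih =>
    rw [Finset.prod_insert ha, Finset.card_insert_of_notMem ha, pow_succ']
    exact (h a (Finset.mem_insert_self a s)).mul hQ
      (ih fun b hb => h b (Finset.mem_insert_of_mem hb))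

/-- Multiplication by a power of `y` in `k[y]/q(y^M)`. -/
theorem sparseMul_root_pow {M : ℕ} (hM : 0 < M) {q : k[X]} (hq : q.Monic)
    (hQ : Q = expand k M q) (e : ℕ) : SparseMul q.natDegree (AdjoinRoot.root Q ^ e) := by
  have hQm : Q.Monic := hQ ▸ hq.expand hM
  have hdeg : Q.natDegree = q.natDegree * M := by rw [hQ, natDegree_expand]
  -- Writing `X ^ t = X ^ (t % M) * (X ^ M) ^ (t / M)` and dividing by `q` in the variable `X ^ M`
  -- leaves a remainder supported on the residue class of `t` modulo `M`.
  have hmod : ∀ t : ℕ, (X ^ t : k[X]) %ₘ Q = X ^ (t % M) * expand k M (X ^ (t / M) %ₘ q) := by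
    intro t
    refine (div_modByMonic_unique (X ^ (t % M) * expand k M (X ^ (t / M) /ₘ q)) _ hQm ⟨?_, ?_⟩).2
    · rw [hQ]
      calc _ = X ^ (t % M) * expand k M (X ^ (t / M) %ₘ q + q * (X ^ (t / M) /ₘ q)) := by
            rw [map_add, map_mul]; ring
        _ = _ := by
            rw [modByMonic_add_div, map_pow, expand_X, ← pow_mul, ← pow_add, Nat.mod_add_div]
    · rw [degree_eq_natDegree hQm.ne_zero, degree_lt_iff_coeff_zero]
      intro m hm
      rw [hdeg] at hm
      rw [coeff_X_pow_mul']
      split_ifs with h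
      · rw [coeff_expand hM]
        split_ifs with h'
        · refine coeff_eq_zero_of_degree_lt ((degree_modByMonic_lt _ hq).trans_le ?_)
          rw [degree_eq_natDegree hq.ne_zero]
          obtain ⟨c, hc⟩ := h'
          rw [hc, Nat.mul_div_cancel_left _ hM]
          have h1 := Nat.mod_lt t hM
          have h2 : q.natDegree * M < (c + 1) * M := by linarith [Nat.sub_add_cancel h]
          have := Nat.lt_of_mul_lt_mul_right h2
          exact_mod_cast (by omega : q.natDegree ≤ c)
        · rfl
      · rfl
  intro m
  have hform : ∀ v : Fin Q.natDegree → k,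
      (rep Q (AdjoinRoot.root Q ^ e * ofCoords Q Q.natDegree v)).coeff m =
        ∑ l : Fin Q.natDegree, v l * ((X ^ (e + l) : k[X]) %ₘ Q).coeff m := by
    intro v
    have : AdjoinRoot.root Q ^ e * ofCoords Q Q.natDegree v =
        ∑ l : Fin Q.natDegree, v l • AdjoinRoot.mk Q (X ^ (e + l)) := by
      simp only [ofCoords, ofCoeffs, map_sum, Finset.mul_sum, AdjoinRoot.smul_mk, smul_eq_C_mul]
      refine Finset.sum_congr rfl fun l _ => ?_
      rw [← AdjoinRoot.mk_X, ← map_pow, ← map_mul]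
      congr 1
      ring
    rw [this, rep_sum hQm, finsetSum_coeff]
    exact Finset.sum_congr rfl fun l _ => by
      rw [rep_smul hQm, rep_mk hQm, coeff_smul, smul_eq_mul]
  simp only [hform]
  -- Coordinate `l` contributes to coefficient `m` only if `e + l ≡ m` modulo `M`. Such `l` below
  -- `deg q * M` lie in one residue class and are told apart by `l / M < deg q`.
  refine (SparseForm.sum_of_subset (k := k) (r := 1) (t := q.natDegree) Finset.univ
    (Finset.univ.filter fun l : Fin Q.natDegree => (e + l) % M = m % M) (fun l _ => ?_)
    (Finset.subset_univ _) ?_ fun l _ hl v => ?_).mono (by omega)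
  · simpa only [mul_comm] using (sparseForm_apply (k := k) l).const_mul
      (((X ^ (e + (l : ℕ)) : k[X]) %ₘ Q).coeff m)
  · rw [← Finset.card_range q.natDegree]
    refine Finset.card_le_card_of_injOn (fun l => (l : ℕ) / M) (fun l _ => ?_) ?_
    · simp only [Finset.coe_range, Set.mem_Iio]
      exact (Nat.div_lt_iff_lt_mul hM).2 (by have := l.isLt; omega)
    · intro l hl l' hl' h
      simp only [Finset.coe_filter, Finset.mem_univ, true_and, Set.mem_ofPred_eq] at hl hl' h
      have h1 : (l : ℕ) ≡ l' [MOD M] := Nat.ModEq.add_left_cancel' e (hl.trans hl'.symm)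
      refine Fin.ext ?_
      rw [← Nat.mod_add_div (l : ℕ) M, ← Nat.mod_add_div (l' : ℕ) M, h1, h]
  · simp only [Finset.mem_filter, Finset.mem_univ, true_and] at hl
    rw [hmod, coeff_X_pow_mul', mul_eq_zero]
    right
    split_ifs with h
    · rw [coeff_expand hM, if_neg]
      rintro ⟨c, hc⟩
      refine hl ?_
      rw [← Nat.sub_add_cancel h, hc, Nat.mul_add_mod, Nat.mod_mod]
    · rfl

/-- The coefficients of `∑ᵢ uᵢ(x ^ M) x ^ J(i)`, if few of the summands overlap. -/
theorem sparseForm_coeff_sum_expand (hQ : Q.Monic) {M : ℕ} (hM : 0 < M) {α : Type*} [Fintype α]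
    (J : α → ℕ) {r t : ℕ} {f : α → (ι → k) → AdjoinRoot Q} (hf : ∀ i, SparseMap r (f i)) (m : ℕ)
    (T : Finset α) (hT : T.card ≤ t) (hJ : ∀ i, ∀ l < Q.natDegree, M * l + J i = m → i ∈ T) :
    SparseForm (t * r) fun v => (∑ i, expand k M (rep Q (f i v)) * X ^ J i).coeff m := by
  simp only [finsetSum_coeff, coeff_mul_X_pow']
  refine SparseForm.sum_of_subset _ T (fun i _ => ?_) (Finset.subset_univ _) hT fun i _ hi v => ?_
  · split_ifs with h
    · simp only [coeff_expand hM]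
      split_ifs with h'
      · exact hf i _
      · exact sparseForm_zero r
    · exact sparseForm_zero r
  · split_ifs with h
    · rw [coeff_expand hM]
      split_ifs with h'
      · refine coeff_rep_of_le hQ _ ?_
        by_contra! hlt
        exact hi (hJ i _ hlt (by rw [Nat.mul_div_cancel' h']; omega))
      · rfl
    · rfl

theorem coeff_sum_expand_eq_zero (hQ : Q.Monic) {M : ℕ} (hM : 0 < M) {α : Type*} [Fintype α]
    (J : α → ℕ) (f : α → AdjoinRoot Q) (m : ℕ)
    (hJ : ∀ i, ∀ l < Q.natDegree, M * l + J i ≠ m) :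
    (∑ i, expand k M (rep Q (f i)) * X ^ J i).coeff m = 0 := by
  simp only [finsetSum_coeff, coeff_mul_X_pow']
  refine Finset.sum_eq_zero fun i _ => ?_
  split_ifs with h
  · rw [coeff_expand hM]
    split_ifs with h'
    · refine coeff_rep_of_le hQ _ ?_
      by_contra! hlt
      exact hJ i _ hlt (by rw [Nat.mul_div_cancel' h']; omega)
    · rfl
  · rfl

theorem sparseIn_pi (hQ : Q.Monic) {N : ℕ} (hN : Q.natDegree = N) {α : Type*} {V : Type*} {r : ℕ}
    {e₁ : (ι → k) → V} {f : V → α → AdjoinRoot Q} (h : ∀ i, SparseMap r fun v => f (e₁ v) i) :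
    SparseIn r e₁ (fun (v : α × Fin N → k) (i : α) => ofCoords Q N fun l => v (i, l)) f :=
  ⟨fun v t => (rep Q (f (e₁ v) t.1)).coeff t.2, fun t => h t.1 t.2,
    fun _ => _root_.funext fun _ => (ofCoords_coeff_rep hQ hN _).symm⟩

theorem sparseIn_ofCoeffs {N : ℕ} {V : Type*} {r : ℕ} {e₁ : (ι → k) → V} {f : V → k[X]}
    (h : ∀ m, SparseForm r fun v => (f (e₁ v)).coeff m)
    (hdeg : ∀ x m, N ≤ m → (f x).coeff m = 0) : SparseIn r e₁ (ofCoeffs N) f :=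
  ⟨fun v m => (f (e₁ v)).coeff m, fun m => h m, fun v => (ofCoeffs_coeff (hdeg (e₁ v))).symm⟩

/-- The orders in `ByDFTs` are entries of a list and equal the common order only propositionally;
this moves a DFT across that equality. -/
theorem dft_cast {R : Type*} [Ring R] {n m : ℕ} (h : n = m) (ω : R) (a : Fin m → R) (i : Fin n) :
    dft n ω (fun i => a (Fin.cast h i)) i = dft m ω a (Fin.cast h i) := by
  subst h; rfl

/-- All DFTs have the common order `m`, so the dependent index types of `ByDFTs` may be replaced by
`Fin r → Fin m`. Sparse maps cost two operations for each coordinate involved in each output; there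
are `r * (m * N')` intermediate coordinates. -/
theorem byDFTs_of_sparseIn {V W : Type*} [AddCommGroup V] [Module k V] [AddCommGroup W]
    [Module k W] [Fintype κ] {K : ℝ} {size : ℕ} (hQ : Q.Monic) {N' N'' : ℕ} (hN : Q.natDegree = N')
    (orders : List ℕ) {r m : ℕ} (hl : orders.length = r) (hm : ∀ m' ∈ orders, m' = m)
    (hr : (r : ℝ) ≤ K) (h1 : 1 ≤ m) (hmK : (m : ℝ) ≤ K * N'') (ω : Fin r → AdjoinRoot Q)
    (hω : ∀ j, SuitableRoot K m (ω j)) {e₁ : (ι → k) → V} {e₂ : (κ → k) → W} {f : V → W}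
    (pre : V → Fin r → Fin m → AdjoinRoot Q) (post : (Fin r → Fin m → AdjoinRoot Q) → W)
    (hpre : IsLinearMap k pre) (hpost : IsLinearMap k post) {ρ σ : ℕ}
    (hpre' : ∀ j i, SparseMap ρ fun v => pre (e₁ v) j i)
    (hcost : 2 * ρ * ((r * (m * N') : ℕ) : ℝ) ≤ K * size)
    (hpost' : SparseIn σ (fun (v : (Fin r × Fin m) × Fin N' → k) j i =>
      ofCoords Q N' fun l => v ((j, i), l)) e₂ post)
    (hcost' : 2 * σ * (Fintype.card κ : ℝ) ≤ K * size)
    (hf : ∀ x, f x = post fun j => dft m (ω j) (pre x j)) :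
    ByDFTs K size Q N' N'' orders e₁ e₂ f := by
  subst hl
  have hm' : ∀ j, orders.get j = m := fun j => hm _ (List.get_mem _ _)
  refine ⟨hr, fun m' h => by rw [hm m' h]; exact ⟨h1, hmK⟩, ω,
    IsLinearMap.mk' (fun x j i => pre x j (Fin.cast (hm' j) i)) ?_,
    IsLinearMap.mk' (fun y => post fun j i => y j (Fin.cast (hm' j).symm i)) ?_, ?_, ?_, ?_, ?_⟩
  · constructor
    · intro x y; funext j i; simp [hpre.map_add]
    · intro c x; funext j i; simp [hpre.map_smul]
  · constructor
    · intro x y; rw [← hpost.map_add]; rfl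
    · intro c x; rw [← hpost.map_smul]; rfl
  · intro j
    rw [hm' j]
    exact hω j
  · refine SparseIn.computableWithin (r := ρ) ⟨fun v t =>
      (rep Q (pre (e₁ v) t.1 (Fin.cast (hm' t.1) t.2.1))).coeff t.2.2, fun t => hpre' _ _ _,
      fun v => _root_.funext fun j => _root_.funext fun i => (ofCoords_coeff_rep hQ hN _).symm⟩ ?_
    refine le_trans (le_of_eq ?_) hcost
    simp only [Fintype.card_sigma, Fintype.card_prod, Fintype.card_fin, hm', Finset.sum_const,
      Finset.card_univ, smul_eq_mul]
  · obtain ⟨g, hg, h⟩ := hpost'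
    refine SparseIn.computableWithin (r := σ) ⟨fun v =>
      g fun t => v ⟨t.1.1, Fin.cast (hm' t.1.1).symm t.1.2, t.2⟩, fun j => ?_, fun v => ?_⟩ hcost'
    · have := (hg j).comp (r' := 1) (ι := (j : Fin orders.length) × Fin (orders.get j) × Fin N')
        (g := fun v t => v ⟨t.1.1, Fin.cast (hm' t.1.1).symm t.1.2, t.2⟩)
        fun t => sparseForm_apply _
      simpa using this
    · rw [← h]
      rfl
  · intro x
    rw [hf x]
    simp only [IsLinearMap.mk'_apply]
    congr 1
    funext j i
    rw [dft_cast (hm' j)]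
    rfl

theorem ByDFTs.isLinearMap {V W : Type*} [AddCommGroup V] [Module k V] [AddCommGroup W]
    [Module k W] {K : ℝ} {size : ℕ} {N' N'' : ℕ} {orders : List ℕ} {e₁ : (ι → k) → V}
    {e₂ : (κ → k) → W} {f : V → W} (h : ByDFTs K size Q N' N'' orders e₁ e₂ f) :
    IsLinearMap k f := by
  obtain ⟨-, -, ω, pre, post, -, -, -, hf⟩ := h
  constructor
  · intro x y
    rw [hf, hf, hf, ← map_add]
    congr 1
    funext j i
    simp [dft, mul_add, Finset.sum_add_distrib]
  · intro c x
    rw [hf, hf, ← map_smul]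
    congr 1
    funext j i
    simp [dft, Finset.smul_sum]

end Sparse

/-! ## Inversion of the DFT -/

theorem eval₂_eq_sum_range_of_degree_lt {A B : Type*} [Semiring A] [Semiring B] (f : A →+* B)
    {F : A[X]} {n : ℕ} (hF : F.degree < n) (x : B) :
    F.eval₂ f x = ∑ i ∈ Finset.range n, f (F.coeff i) * x ^ i := by
  rcases eq_or_ne F 0 with rfl | h
  · simp
  · exact eval₂_eq_sum_range' f ((natDegree_lt_iff_degree_lt h).2 hF) x

theorem eval_eq_sum_range_of_degree_lt {A : Type*} [Semiring A] {F : A[X]} {n : ℕ}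
    (hF : F.degree < n) (x : A) : F.eval x = ∑ i ∈ Finset.range n, F.coeff i * x ^ i :=
  eval₂_eq_sum_range_of_degree_lt (RingHom.id A) hF x

section Inversion

variable {k : Type u} [Field k] {S : Type*} [CommRing S] [Algebra k S]

/-- Multiplying the geometric sum by `1 - w ^ e` gives `1 - w ^ (e n) = 0`, and `1 - w ^ e` is not a
zero divisor. -/
theorem IsPrincipalRoot.sum_pow_eq_zero {n : ℕ} {w : S} (hw : IsPrincipalRoot n w) {e : ℕ}
    (he : ¬ n ∣ e) : ∑ l ∈ Finset.range n, (w ^ e) ^ l = 0 := by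
  rcases Nat.eq_zero_or_pos n with rfl | hn
  · simp
  have h1 : w ^ e = w ^ (e % n) := by
    conv_lhs => rw [← Nat.mod_add_div e n, pow_add, pow_mul, hw.1, one_pow, mul_one]
  have h2 := hw.2 (e % n) (Nat.pos_of_ne_zero fun h => he (Nat.dvd_of_mod_eq_zero h))
    (Nat.mod_lt _ hn)
  rw [← h1] at h2
  refine (mul_left_mem_nonZeroDivisors_eq_zero_iff h2).1 ?_
  rw [mul_neg_geom_sum, ← pow_mul, mul_comm, pow_mul, hw.1, one_pow, sub_self]

/-- Orthogonality of the powers of `w`: the composite matrix has entries `∑ l, w ^ ((j - i) l)`,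
with `w ^ (n - 1)` serving as the inverse of `w`. -/
theorem inv_smul_dft_dft {n : ℕ} {w : S} (hw : IsPrincipalRoot n w) (hn : (n : k) ≠ 0)
    (c : Fin n → S) (i : Fin n) :
    ((n : k)⁻¹) • dft n (w ^ (n - 1)) (dft n w c) i = c i := by
  have hn0 : 0 < n := i.pos
  have key : ∀ j : Fin n, ∑ l : Fin n, (w ^ (n - 1)) ^ ((i : ℕ) * l) * (w ^ ((l : ℕ) * j) * c j) =
      if j = i then (n : S) * c i else 0 := by
    intro j
    have h1 : ∀ l : Fin n, (w ^ (n - 1)) ^ ((i : ℕ) * l) * (w ^ ((l : ℕ) * j) * c j) =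
        (w ^ ((n - 1) * i + j)) ^ (l : ℕ) * c j := by
      intro l
      rw [← mul_assoc, ← pow_mul, ← pow_mul, ← pow_add]
      congr 2
      ring
    simp only [h1, ← Finset.sum_mul]
    rw [← Finset.sum_range fun l => (w ^ ((n - 1) * (i : ℕ) + j)) ^ l]
    obtain ⟨m, rfl⟩ : ∃ m, n = m + 1 := ⟨n - 1, by omega⟩
    -- This says `(n - 1) i + j ≡ j - i` modulo `n` without negative exponents; the exponent is
    -- divisible by `n` only for `i = j`.
    have h2 : (i : ℕ) + ((m + 1 - 1) * i + j) = (m + 1) * i + j := by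
      rw [Nat.add_sub_cancel]; ring
    split_ifs with hji
    · subst hji
      have : (m + 1 - 1) * (j : ℕ) + j = (m + 1) * j := by omega
      rw [this, pow_mul, hw.1]
      simp
    · rw [hw.sum_pow_eq_zero, zero_mul]
      intro hdvd
      refine hji (Fin.ext ?_)
      obtain ⟨q, hq⟩ := hdvd
      rw [hq] at h2
      have h3 := congrArg (· % (m + 1)) h2
      simp only [Nat.add_mul_mod_self_left, Nat.mul_add_mod, Nat.mod_eq_of_lt i.isLt,
        Nat.mod_eq_of_lt j.isLt] at h3
      exact h3.symm
  have : dft n (w ^ (n - 1)) (dft n w c) i = (n : S) * c i := by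
    simp only [dft, Finset.mul_sum]
    rw [Finset.sum_comm]
    simp [key]
  rw [this, ← map_natCast (algebraMap k S), ← Algebra.smul_def, smul_smul, inv_mul_cancel₀ hn,
    one_smul]

theorem dft_eq_eval {n : ℕ} (w : S) {F : S[X]} (hF : F.degree < n) :
    (dft n w fun j => F.coeff j) = fun i : Fin n => F.eval (w ^ (i : ℕ)) := by
  funext i
  rw [eval_eq_sum_range_of_degree_lt hF, Finset.sum_range]
  exact Finset.sum_congr rfl fun j _ => by rw [← pow_mul, mul_comm]

theorem inv_smul_dft_eval {n : ℕ} {w : S} (hw : IsPrincipalRoot n w) (hn : (n : k) ≠ 0)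
    {F : S[X]} (hF : F.degree < n) (i : Fin n) :
    ((n : k)⁻¹) • dft n (w ^ (n - 1)) (fun i : Fin n => F.eval (w ^ (i : ℕ))) i = F.coeff i := by
  rw [← dft_eq_eval w hF]
  exact inv_smul_dft_dft hw hn _ i

theorem sum_range_two_mul {M : Type*} [AddCommMonoid M] (f : ℕ → M) (N : ℕ) :
    ∑ t ∈ Finset.range (2 * N), f t = ∑ i ∈ Finset.range N, (f i + f (i + N)) := by
  rw [two_mul, Finset.sum_range_add, Finset.sum_add_distrib]
  simp only [add_comm N]

theorem eval_eq_sum_of_degree_lt_two_mul {N : ℕ} {F : S[X]} (hF : F.degree < (2 * N : ℕ)) (z : S) :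
    F.eval z = ∑ i ∈ Finset.range N, z ^ i * (F.coeff i + z ^ N * F.coeff (i + N)) := by
  rw [eval_eq_sum_range_of_degree_lt hF, sum_range_two_mul]
  exact Finset.sum_congr rfl fun i _ => by ring

/-- The values of `F` at the points `z w ^ l` determine `F` modulo `X ^ n - z ^ n`. -/
theorem inv_smul_dft_eval_mul {N : ℕ} {w : S} (hw : IsPrincipalRoot N w) (hN : (N : k) ≠ 0)
    (z : S) {F : S[X]} (hF : F.degree < (2 * N : ℕ)) (i : Fin N) :
    ((N : k)⁻¹) • dft N (w ^ (N - 1)) (fun l : Fin N => F.eval (z * w ^ (l : ℕ))) i =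
      z ^ (i : ℕ) * (F.coeff i + z ^ N * F.coeff (i + N)) := by
  have : (fun l : Fin N => F.eval (z * w ^ (l : ℕ))) =
      dft N w fun i : Fin N => z ^ (i : ℕ) * (F.coeff i + z ^ N * F.coeff (i + N)) := by
    funext l
    rw [eval_eq_sum_of_degree_lt_two_mul hF, Finset.sum_range, dft]
    refine Finset.sum_congr rfl fun i _ => ?_
    have h1 : (z * w ^ (l : ℕ)) ^ N = z ^ N := by
      rw [mul_pow, ← pow_mul, mul_comm (l : ℕ), pow_mul, hw.1, one_pow, mul_one]
    rw [h1, mul_pow, ← pow_mul]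
    ring
  rw [this]
  exact inv_smul_dft_dft hw hN _ i

end Inversion

/-! ## Polynomials as polynomials of polynomials -/

section Blocks

/-- The polynomial `c 0 + c 1 X + … + c (R - 1) X ^ (R - 1)`. -/
def outerPoly {A : Type*} [Semiring A] (R : ℕ) (c : ℕ → A) : A[X] :=
  ∑ i ∈ Finset.range R, C (c i) * X ^ i

section Outer

variable {A B : Type*} [CommRing A] [CommRing B]

theorem coeff_outerPoly (R : ℕ) (c : ℕ → A) (m : ℕ) :
    (outerPoly R c).coeff m = if m < R then c m else 0 := by
  simp [outerPoly, coeff_X_pow]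

theorem degree_outerPoly_lt (R : ℕ) (c : ℕ → A) : (outerPoly R c).degree < R := by
  rw [degree_lt_iff_coeff_zero]
  intro m hm
  rw [coeff_outerPoly, if_neg (by omega)]

theorem map_outerPoly (f : A →+* B) (R : ℕ) (c : ℕ → A) :
    (outerPoly R c).map f = outerPoly R fun i => f (c i) := by
  simp [outerPoly, Polynomial.map_sum]

theorem eval_outerPoly (R : ℕ) (c : ℕ → A) (z : A) :
    (outerPoly R c).eval z = ∑ i ∈ Finset.range R, c i * z ^ i := by
  simp [outerPoly, eval_finsetSum]

theorem eval₂_outerPoly (f : A →+* B) (R : ℕ) (c : ℕ → A) (z : B) :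
    (outerPoly R c).eval₂ f z = ∑ i ∈ Finset.range R, f (c i) * z ^ i := by
  simp [outerPoly, eval₂_finsetSum]

theorem degree_mul_lt_of_natDegree_le {F G : A[X]} {d T : ℕ} (hF : F.natDegree ≤ d)
    (hG : G.natDegree ≤ d) (h : 2 * d < T) : (F * G).degree < T :=
  degree_le_natDegree.trans_lt (by
    have := natDegree_mul_le (p := F) (q := G)
    exact_mod_cast (by omega : (F * G).natDegree < T))

/-- A representative of `F` modulo `X ^ (2 N) + X ^ N + 1`, for `F` of degree less than `4 N`. -/
def fold (N : ℕ) (F : A[X]) : A[X] :=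
  ∑ i ∈ Finset.range N, (C (F.coeff i - F.coeff (i + 2 * N) + F.coeff (i + 3 * N)) * X ^ i +
    C (F.coeff (i + N) - F.coeff (i + 2 * N)) * X ^ (i + N))

/-- Here `t = z ^ N` satisfies `t² + t + 1 = 0`, so `t² = -1 - t` and `t³ = 1`; the four quarters of
`F` collapse to two. -/
theorem eval₂_fold (f : A →+* B) {N : ℕ} {F : A[X]} (hF : F.degree < (4 * N : ℕ)) {z : B}
    (hz : z ^ (2 * N) + z ^ N + 1 = 0) : (fold N F).eval₂ f z = F.eval₂ f z := by
  rw [eval₂_eq_sum_range_of_degree_lt f hF, show 4 * N = 2 * (2 * N) by ring, sum_range_two_mul,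
    Finset.sum_add_distrib, sum_range_two_mul, sum_range_two_mul, ← Finset.sum_add_distrib]
  simp only [fold, eval₂_finsetSum, eval₂_add, eval₂_mul, eval₂_C, eval₂_X_pow]
  refine Finset.sum_congr rfl fun i _ => ?_
  have h2 : z ^ (2 * N) = -1 - z ^ N := by linear_combination hz
  have h3 : z ^ (3 * N) = 1 := by
    have : z ^ (3 * N) = z ^ N * z ^ (2 * N) := by ring
    rw [this, h2]
    have : (z ^ N) ^ 2 = -1 - z ^ N := by rw [← h2]; ring
    linear_combination -this
  rw [show i + N + 2 * N = i + 3 * N by ring, pow_add _ i N, pow_add _ i (2 * N),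
    pow_add _ i (3 * N), h2, h3]
  simp only [map_add, map_sub]
  ring

/-- Folding only adds and subtracts coefficients. Applied to polynomials of bounded degree, this
shows that folding does not raise the degree in the inner variable. -/
theorem coeff_fold_mem (N : ℕ) (F : A[X]) (p : AddSubgroup A) (hF : ∀ t, F.coeff t ∈ p) (t : ℕ) :
    (fold N F).coeff t ∈ p := by
  simp only [fold, finsetSum_coeff, coeff_add, coeff_C_mul_X_pow]
  refine sum_mem fun i _ => add_mem ?_ ?_
  · split_ifs
    · exact add_mem (sub_mem (hF _) (hF _)) (hF _)
    · exact zero_mem _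
  · split_ifs
    · exact sub_mem (hF _) (hF _)
    · exact zero_mem _

theorem degree_fold_lt (N : ℕ) (F : A[X]) : (fold N F).degree < (2 * N : ℕ) := by
  rw [degree_lt_iff_coeff_zero]
  intro m hm
  simp only [fold, finsetSum_coeff, coeff_add, coeff_C_mul_X_pow]
  refine Finset.sum_eq_zero fun i hi => ?_
  have := Finset.mem_range.1 hi
  rw [if_neg (by omega), if_neg (by omega), add_zero]

end Outer

variable {k : Type u} [Field k]

/-- The `i`-th block of `p`, with the coefficients `h i + M j`, `j < J`. -/
def block (h M J : ℕ) (p : k[X]) (i : ℕ) : k[X] :=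
  ∑ j ∈ Finset.range J, C (p.coeff (h * i + M * j)) * X ^ j

theorem coeff_block (h M J : ℕ) (p : k[X]) (i m : ℕ) :
    (block h M J p i).coeff m = if m < J then p.coeff (h * i + M * m) else 0 :=
  coeff_sum_range_C_mul_X_pow J _ m

/-- Recombining the blocks. -/
theorem eval₂_outerPoly_block {h M J R : ℕ} (hdec : (M = 1 ∧ h = J) ∨ (h = 1 ∧ M = R)) {p : k[X]}
    (hp : p.degree < (R * J : ℕ)) :
    (outerPoly R (block h M J p)).eval₂ (expand k M : k[X] →+* k[X]) (X ^ h) = p := by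
  rw [eval₂_outerPoly]
  have h1 : ∀ i, (expand k M : k[X] →+* k[X]) (block h M J p i) * (X ^ h) ^ i =
      ∑ j ∈ Finset.range J, C (p.coeff (h * i + M * j)) * X ^ (h * i + M * j) := by
    intro i
    simp only [block, RingHom.coe_coe, map_sum, Finset.sum_mul, map_mul, expand_C, map_pow,
      expand_X]
    exact Finset.sum_congr rfl fun j _ => by ring
  simp only [h1]
  have h2 : ∑ m ∈ Finset.range (R * J), C (p.coeff m) * X ^ m = p := by
    ext m
    rw [coeff_sum_range_C_mul_X_pow]
    split_ifs with hm
    · rfl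
    · exact ((degree_lt_iff_coeff_zero _ _).1 hp m (by omega)).symm
  -- The two decompositions enumerate the exponents below `R * J` as `J i + j` and as `i + R j`.
  rcases hdec with ⟨rfl, rfl⟩ | ⟨rfl, rfl⟩
  · rw [sum_range_mul_eq] at h2
    simpa only [one_mul] using h2
  · rw [sum_range_mul_eq'] at h2
    simpa only [one_mul] using h2

end Blocks

/-! ## Steps that evaluate and interpolate -/

section Transform

variable {k : Type u} [Field k]

/-- Recombining polynomials of small degree from their classes. -/
theorem sum_expand_rep_coeff_map {Q : k[X]} (hQ : Q.Monic) (h M : ℕ) {T : ℕ} {F : k[X][X]}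
    (hF : F.degree < T) (hc : ∀ t, (F.coeff t).degree < Q.degree) :
    ∑ t ∈ Finset.range T, expand k M (rep Q ((F.map (AdjoinRoot.mk Q)).coeff t)) * X ^ (h * t) =
      F.eval₂ (expand k M : k[X] →+* k[X]) (X ^ h) := by
  rw [eval₂_eq_sum_range_of_degree_lt _ hF]
  refine Finset.sum_congr rfl fun t _ => ?_
  rw [coeff_map, rep_mk_of_degree_lt hQ (hc t), pow_mul]
  rfl

/-- The transform evaluates the polynomial whose coefficients are the blocks of `a` at the points
`pts`; the back-transform interpolates and recombines. -/
structure Level.IsTransform {P : k[X]} (L : Level k P) (h M J R T : ℕ)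
    (pts : L.idx → AdjoinRoot L.Q) : Prop where
  monic_P : P.Monic
  monic_Q : L.Q.Monic
  degree_P : P.natDegree = R * J
  le_degree_Q : J ≤ L.Q.natDegree
  le : R ≤ T
  blocks : (M = 1 ∧ h = J) ∨ (h = 1 ∧ M = R)
  fwd_eq : ∀ a i, L.fwd a i =
    ((outerPoly R (block h M J (rep P a))).map (AdjoinRoot.mk L.Q)).eval (pts i)
  bwd_eq : ∀ F : (AdjoinRoot L.Q)[X], F.degree < T → L.bwd (fun i => F.eval (pts i)) =
    ∑ t ∈ Finset.range T, expand k M (rep L.Q (F.coeff t)) * X ^ (h * t)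

namespace Level.IsTransform

variable {P : k[X]} {L : Level k P} {h M J R T : ℕ} {pts : L.idx → AdjoinRoot L.Q}

theorem eval₂_rep (H : L.IsTransform h M J R T pts) (a : AdjoinRoot P) :
    (outerPoly R (block h M J (rep P a))).eval₂ (expand k M : k[X] →+* k[X]) (X ^ h) = rep P a :=
  eval₂_outerPoly_block H.blocks (by
    have := degree_rep_lt H.monic_P a
    rwa [degree_eq_natDegree H.monic_P.ne_zero, H.degree_P] at this)

/-- The blocks have degree below `J ≤ deg Q` and number `R ≤ T`, so interpolation recovers them
exactly and recombination gives the canonical representative. -/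
theorem bwd_fwd (H : L.IsTransform h M J R T pts) (a : AdjoinRoot P) :
    L.bwd (L.fwd a) = rep P a := by
  have hlt : (outerPoly R (block h M J (rep P a))).degree < T :=
    (degree_outerPoly_lt _ _).trans_le (by exact_mod_cast H.le)
  rw [show L.fwd a = _ from _root_.funext (H.fwd_eq a), H.bwd_eq _ (degree_map_le.trans_lt hlt),
    sum_expand_rep_coeff_map H.monic_Q h M hlt, H.eval₂_rep]
  intro t
  rw [coeff_outerPoly, degree_eq_natDegree H.monic_Q.ne_zero, degree_lt_iff_coeff_zero]
  intro m hm
  split_ifs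
  · rw [coeff_block, if_neg (by have := H.le_degree_Q; omega)]
  · rfl

theorem mk_bwd_fwd (H : L.IsTransform h M J R T pts) (a : AdjoinRoot P) :
    AdjoinRoot.mk P (L.bwd (L.fwd a)) = a := by
  rw [H.bwd_fwd, mk_rep H.monic_P]

theorem injective (H : L.IsTransform h M J R T pts) : Function.Injective L.fwd :=
  Function.LeftInverse.injective (g := fun v => AdjoinRoot.mk P (L.bwd v)) H.mk_bwd_fwd

theorem fwd_mul_fwd (H : L.IsTransform h M J R T pts) (a b : AdjoinRoot P) (i : L.idx) :
    L.fwd a i * L.fwd b i = ((outerPoly R (block h M J (rep P a)) *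
      outerPoly R (block h M J (rep P b))).map (AdjoinRoot.mk L.Q)).eval (pts i) := by
  rw [H.fwd_eq, H.fwd_eq, Polynomial.map_mul, eval_mul]

/-- The back-transform returns the product in `k[x]` if neither the degree in the outer variable nor
that in the inner variable is too large. -/
theorem bwd_fwd_mul_fwd (H : L.IsTransform h M J R T pts) {n d e : ℕ} (hn : n ≤ P.natDegree)
    (hd : ∀ p : k[X], p.degree < n → ∀ i, (block h M J p i).natDegree ≤ d)
    (he : ∀ p : k[X], p.degree < n → (outerPoly R (block h M J p)).natDegree ≤ e)
    (hdQ : 2 * d < L.Q.natDegree) (heT : 2 * e < T) {a b : k[X]} (ha : a.degree < n)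
    (hb : b.degree < n) :
    L.bwd (fun i => L.fwd (AdjoinRoot.mk _ a) i * L.fwd (AdjoinRoot.mk _ b) i) = a * b := by
  have hrep : ∀ p : k[X], p.degree < n → rep P (AdjoinRoot.mk P p) = p := fun p hp =>
    rep_mk_of_degree_lt H.monic_P (hp.trans_le (by
      rw [degree_eq_natDegree H.monic_P.ne_zero]; exact_mod_cast hn))
  have hlt := degree_mul_lt_of_natDegree_le (he a ha) (he b hb) heT
  rw [show (fun i => L.fwd (AdjoinRoot.mk _ a) i * L.fwd (AdjoinRoot.mk _ b) i) = _ from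
    _root_.funext (H.fwd_mul_fwd _ _), hrep a ha, hrep b hb,
    H.bwd_eq _ (degree_map_le.trans_lt hlt), sum_expand_rep_coeff_map H.monic_Q h M hlt,
    eval₂_mul]
  · have h1 := H.eval₂_rep (AdjoinRoot.mk P a)
    have h2 := H.eval₂_rep (AdjoinRoot.mk P b)
    rw [hrep a ha] at h1
    rw [hrep b hb] at h2
    rw [h1, h2]
  · intro t
    have hco : ∀ p : k[X], p.degree < n → ∀ i,
        ((outerPoly R (block h M J p)).coeff i).natDegree ≤ d := by
      intro p hp i
      rw [coeff_outerPoly]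
      split_ifs
      · exact hd p hp i
      · simp
    -- Every inner coefficient of the product has degree at most `2 * d < deg Q`, so it is its own
    -- representative.
    rw [coeff_mul, degree_eq_natDegree H.monic_Q.ne_zero]
    refine degree_le_natDegree.trans_lt ?_
    refine Nat.cast_lt.2 (lt_of_le_of_lt ?_ hdQ)
    refine natDegree_sum_le_of_forall_le _ _ fun t _ => natDegree_mul_le.trans ?_
    have h1 := hco a ha t.1
    have h2 := hco b hb t.2
    omega

/-- For consecutive blocks. -/
theorem bwd_fwd_mul_fwd_consecutive (H : L.IsTransform J 1 J R T pts) {n : ℕ} (hJ : 0 < J)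
    (hn : n ≤ P.natDegree) (hJQ : 2 * J ≤ L.Q.natDegree + 1) (hT : 2 * n ≤ J * T + 1)
    (hT0 : 0 < T) {a b : k[X]} (ha : a.degree < n) (hb : b.degree < n) :
    L.bwd (fun i => L.fwd (AdjoinRoot.mk _ a) i * L.fwd (AdjoinRoot.mk _ b) i) = a * b := by
  -- `J - 1` bounds the degree inside a block, and `(n - 1) / J` is the index of the last block that
  -- meets an exponent below `n`.
  refine H.bwd_fwd_mul_fwd hn (d := J - 1) (e := (n - 1) / J) (fun p _ i => ?_) (fun p hp => ?_)
    (by omega) ?_ ha hb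
  · refine natDegree_le_iff_coeff_eq_zero.2 fun m hm => ?_
    rw [coeff_block, if_neg (by omega)]
  · refine natDegree_le_iff_coeff_eq_zero.2 fun m hm => ?_
    rw [coeff_outerPoly]
    split_ifs
    · ext l
      rw [coeff_block, coeff_zero]
      split_ifs
      · refine (degree_lt_iff_coeff_zero _ _).1 hp _ ?_
        have := (Nat.div_lt_iff_lt_mul hJ).1 hm
        rw [mul_comm J]
        omega
      · rfl
    · rfl
  · have h1 := Nat.div_mul_le_self (n - 1) J
    -- For `n = 0` the truncated `n - 1` is `0`, and the bound reduces to `0 < T`.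
    rcases Nat.eq_zero_or_pos n with rfl | hn0
    · simpa using hT0
    · by_contra! hlt
      have := Nat.mul_le_mul_left J hlt
      have h3 : J * (2 * ((n - 1) / J)) = 2 * ((n - 1) / J * J) := by ring
      omega

/-- For interleaved blocks. -/
theorem bwd_fwd_mul_fwd_interleaved (H : L.IsTransform 1 R J R T pts) {n : ℕ} (hR : 0 < R)
    (hn : n ≤ P.natDegree) (hn' : 2 * n ≤ R * L.Q.natDegree + 1) (hQ : 0 < L.Q.natDegree)
    (hT : 2 * R ≤ T + 1) {a b : k[X]}
    (ha : a.degree < n) (hb : b.degree < n) :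
    L.bwd (fun i => L.fwd (AdjoinRoot.mk _ a) i * L.fwd (AdjoinRoot.mk _ b) i) = a * b := by
  -- The roles are exchanged: `(n - 1) / R` bounds the inner degree and `R - 1` the outer one.
  refine H.bwd_fwd_mul_fwd hn (d := (n - 1) / R) (e := R - 1) (fun p hp i => ?_) (fun p _ => ?_)
    ?_ (by omega) ha hb
  · refine natDegree_le_iff_coeff_eq_zero.2 fun m hm => ?_
    rw [coeff_block]
    split_ifs
    · refine (degree_lt_iff_coeff_zero _ _).1 hp _ ?_
      have := (Nat.div_lt_iff_lt_mul hR).1 hm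
      rw [mul_comm R]
      omega
    · rfl
  · refine natDegree_le_iff_coeff_eq_zero.2 fun m hm => ?_
    rw [coeff_outerPoly, if_neg (by omega)]
  · have h1 := Nat.div_mul_le_self (n - 1) R
    rcases Nat.eq_zero_or_pos n with rfl | hn0
    · simpa using hQ
    · by_contra! hlt
      have := Nat.mul_le_mul_left R hlt
      have h3 : R * (2 * ((n - 1) / R)) = 2 * ((n - 1) / R * R) := by ring
      omega

theorem mk_eval₂_expand (M h : ℕ) (F : k[X][X]) :
    AdjoinRoot.mk P (F.eval₂ (expand k M : k[X] →+* k[X]) (X ^ h)) =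
      F.eval₂ ((AdjoinRoot.mk P).comp (expand k M : k[X] →+* k[X])) (AdjoinRoot.root P ^ h) := by
  rw [hom_eval₂, map_pow, AdjoinRoot.mk_X]

theorem mk_expand (M : ℕ) (p : k[X]) :
    AdjoinRoot.mk P (expand k M p) = p.eval₂ (AdjoinRoot.of P) (AdjoinRoot.root P ^ M) := by
  change AdjoinRoot.mk P (p.eval₂ C (X ^ M)) = _
  rw [hom_eval₂, map_pow, AdjoinRoot.mk_X]
  rfl

/-- The step multiplies in `k[x]/P` if `y` stands for a power of `x` with `Q(y) = 0`. -/
theorem exec_mul_of_dvd (H : L.IsTransform h M J R T pts) (hPQ : P ∣ expand k M L.Q)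
    (hT : 2 * R ≤ T + 1) (hR : 0 < R) (a b : AdjoinRoot P) :
    L.exec (fun u v => u * v) a b = a * b := by
  set F := outerPoly R (block h M J (rep P a)) * outerPoly R (block h M J (rep P b)) with hF
  have hnat : ∀ c : ℕ → k[X], (outerPoly R c).natDegree ≤ R - 1 := fun c =>
    natDegree_le_iff_coeff_eq_zero.2 fun m hm => by rw [coeff_outerPoly, if_neg (by omega)]
  have hlt : F.degree < T := degree_mul_lt_of_natDegree_le (hnat _) (hnat _) (by omega)
  -- Since `P` divides `Q(x ^ M)`, the class of `x ^ M` is a root of `Q`; hence `y ↦ x ^ M` is a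
  -- ring homomorphism on `k[y]/Q` and the reductions modulo `Q` do not matter.
  have hroot : L.Q.eval₂ (AdjoinRoot.of P) (AdjoinRoot.root P ^ M) = 0 := by
    rw [← mk_expand]
    exact AdjoinRoot.mk_eq_zero.2 hPQ
  have hcomp : ∀ p : k[X], AdjoinRoot.lift (AdjoinRoot.of P) (AdjoinRoot.root P ^ M) hroot
      (AdjoinRoot.mk L.Q p) = (AdjoinRoot.mk P).comp (expand k M : k[X] →+* k[X]) p := by
    intro p
    rw [AdjoinRoot.lift_mk, ← mk_expand]
    rfl
  have hE : ∀ u : AdjoinRoot L.Q, AdjoinRoot.mk P (expand k M (rep L.Q u)) =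
      AdjoinRoot.lift (AdjoinRoot.of P) (AdjoinRoot.root P ^ M) hroot u := by
    intro u
    conv_rhs => rw [← mk_rep H.monic_Q u]
    rw [hcomp]
    rfl
  rw [Level.exec, show (fun i => L.fwd a i * L.fwd b i) = _ from _root_.funext (H.fwd_mul_fwd _ _),
    ← hF, H.bwd_eq _ (degree_map_le.trans_lt hlt), map_sum]
  simp only [map_mul, hE, map_pow, AdjoinRoot.mk_X, pow_mul, coeff_map, hcomp]
  rw [← eval₂_eq_sum_range_of_degree_lt _ hlt, ← mk_eval₂_expand, hF, eval₂_mul, H.eval₂_rep,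
    H.eval₂_rep, map_mul, mk_rep H.monic_P, mk_rep H.monic_P]

/-- The step multiplies in `k[x]/P` if the outer variable stands for `x ^ h`, where
`P = x ^ (2 h N) + x ^ (h N) + 1`. -/
theorem exec_mul_of_fold {N : ℕ} (H : L.IsTransform h 1 h (2 * N) (2 * N) pts)
    (hP : P = X ^ (h * (2 * N)) + X ^ (h * N) + 1) (hh : 2 * h ≤ L.Q.natDegree + 1) (hh0 : 0 < h)
    (hN : 0 < N) (hpts : ∀ i, pts i ^ (2 * N) + pts i ^ N + 1 = 0) (a b : AdjoinRoot P) :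
    L.exec (fun u v => u * v) a b = a * b := by
  set F := outerPoly (2 * N) (block h 1 h (rep P a)) * outerPoly (2 * N) (block h 1 h (rep P b))
    with hF
  have hnat : ∀ c : ℕ → k[X], (outerPoly (2 * N) c).natDegree ≤ 2 * N - 1 := fun c =>
    natDegree_le_iff_coeff_eq_zero.2 fun m hm => by rw [coeff_outerPoly, if_neg (by omega)]
  have hlt : F.degree < (4 * N : ℕ) :=
    degree_mul_lt_of_natDegree_le (hnat _) (hnat _) (by omega)
  -- The outer product has too large a degree to be interpolated from `2 N` points, but its folding
  -- has the same values there.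
  have h1 : (fun i => L.fwd a i * L.fwd b i) =
      fun i => ((fold N F).map (AdjoinRoot.mk L.Q)).eval (pts i) := by
    funext i
    rw [H.fwd_mul_fwd, eval_map, eval_map, eval₂_fold _ hlt (hpts i)]
  rw [Level.exec, h1, H.bwd_eq _ (degree_map_le.trans_lt (degree_fold_lt N F)),
    sum_expand_rep_coeff_map H.monic_Q h 1 (degree_fold_lt N F), mk_eval₂_expand, eval₂_fold _ hlt,
    ← mk_eval₂_expand, hF, eval₂_mul, H.eval₂_rep, H.eval₂_rep, map_mul, mk_rep H.monic_P,
    mk_rep H.monic_P]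
  -- The class of `x ^ h` satisfies the same equation as the points, by the form of `P`; so undoing
  -- the folding is legitimate modulo `P`.
  · rw [← pow_mul, ← pow_mul, ← AdjoinRoot.mk_X, ← map_pow, ← map_pow, ← map_one (AdjoinRoot.mk P),
      ← map_add, ← map_add]
    exact AdjoinRoot.mk_eq_zero.2 (dvd_of_eq hP)
  · intro t
    rw [degree_eq_natDegree H.monic_Q.ne_zero, ← mem_degreeLT]
    refine coeff_fold_mem N F (degreeLT k _).toAddSubgroup (fun t => ?_) t
    rw [Submodule.mem_toAddSubgroup, mem_degreeLT, hF, coeff_mul]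
    refine degree_le_natDegree.trans_lt (Nat.cast_lt.2 (lt_of_le_of_lt
      (natDegree_sum_le_of_forall_le (n := 2 * (h - 1)) _ _ fun t _ => natDegree_mul_le.trans ?_)
      (by omega)))
    have hco : ∀ (p : k[X]) (i : ℕ),
        ((outerPoly (2 * N) (block h 1 h p)).coeff i).natDegree ≤ h - 1 := by
      intro p i
      rw [coeff_outerPoly]
      split_ifs
      · refine natDegree_le_iff_coeff_eq_zero.2 fun m hm => ?_
        rw [coeff_block, if_neg (by omega)]
      · simp
    have h1 := hco (rep P a) t.1
    have h2 := hco (rep P b) t.2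
    omega

end Level.IsTransform

/-! ## Correctness of the recursive algorithms -/

/-- Each step is correct with exact inner products, and by induction the inner products are exact.
-/
theorem MulAlg.IsD.run_eq {K : ℝ} {n' n'' : ℕ → ℕ} {P : k[X]} {A : MulAlg k P}
    (hA : A.IsD K n' n'') (a b : AdjoinRoot P) : A.run a b = a * b := by
  induction A with
  | direct P => rfl
  | step L inner ih =>
    obtain ⟨-, hL, hinner⟩ := hA
    rw [MulAlg.run, ← hL a b]
    congr 1
    funext u v
    exact ih hinner u v

theorem PolyAlg.run_eq {A : PolyAlg k} {K : ℝ} {n' n'' : ℕ → ℕ} (hinner : A.inner.IsD K n' n'')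
    (hP : A.P.Monic) {a b : k[X]} (hab : (a * b).degree < A.P.degree)
    (h : A.top.bwd (fun i => A.top.fwd (AdjoinRoot.mk _ a) i * A.top.fwd (AdjoinRoot.mk _ b) i) =
      a * b) : A.run a b = a * b := by
  have : A.inner.run = fun u v => u * v :=
    _root_.funext fun u => _root_.funext fun v => hinner.run_eq u v
  rw [PolyAlg.run, this, Level.exec, h, rep_mk_of_degree_lt hP hab]

end Transform

/-! ## Roots of cyclotomic polynomials -/

section Cyclotomic

theorem IsPrincipalRoot.pow {R : Type*} [Ring R] {m n : ℕ} {y : R} (h : IsPrincipalRoot (m * n) y)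
    (hm : 0 < m) : IsPrincipalRoot n (y ^ m) := by
  refine ⟨by rw [← pow_mul, h.1], fun j hj hjn => ?_⟩
  rw [← pow_mul]
  exact h.2 _ (Nat.mul_pos hm hj) (Nat.mul_lt_mul_of_pos_left hjn hm)

/-- Integral polynomial identities satisfied by the complex primitive `n`-th roots of unity hold for
each root of the `n`-th cyclotomic polynomial in a commutative ring. -/
theorem aeval_eq_zero_of_aeval_cyclotomic {S : Type*} [CommRing S] {n : ℕ} (hn : 0 < n) {y : S}
    (hy : aeval y (cyclotomic n ℤ) = 0) {p : ℤ[X]}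
    (hp : ∀ ζ : ℂ, IsPrimitiveRoot ζ n → aeval ζ p = 0) : aeval y p = 0 := by
  have hζ := Complex.isPrimitiveRoot_exp n hn.ne'
  -- The `n`-th cyclotomic polynomial is the minimal polynomial of `ζ` over the integrally closed
  -- ring `ℤ`.
  have hdvd : cyclotomic n ℤ ∣ p := by
    rw [cyclotomic_eq_minpoly hζ hn]
    exact minpoly.isIntegrallyClosed_dvd (hζ.isIntegral hn) (hp _ hζ)
  obtain ⟨q, rfl⟩ := hdvd
  rw [map_mul, hy, zero_mul]

theorem prod_one_sub_pow_eq {S : Type*} [CommRing S] {n : ℕ} {y : S}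
    (hy : aeval y (cyclotomic (n + 1) ℤ) = 0) :
    ∏ j ∈ Finset.range n, (1 - y ^ (j + 1)) = n + 1 := by
  have := aeval_eq_zero_of_aeval_cyclotomic n.succ_pos hy
    (p := ∏ j ∈ Finset.range n, (1 - X ^ (j + 1)) - (n + 1)) (fun ζ hζ => by
      simpa [map_prod, sub_eq_zero] using hζ.prod_one_sub_pow_eq_order)
  simpa [map_prod, sub_eq_zero] using this

/-- Over `ℂ` the powers `ζ ^ j` with `j` coprime to `n` are the primitive roots, so the product is
`Φ_n(1)`; the identity then transfers. -/
theorem prod_coprime_one_sub_pow_eq {S : Type*} [CommRing S] {n : ℕ} (hn : 0 < n) {y : S}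
    (hy : aeval y (cyclotomic n ℤ) = 0) :
    ∏ j ∈ (Finset.range n).filter (fun j => Nat.Coprime j n), (1 - y ^ j) =
      ((cyclotomic n ℤ).eval 1 : ℤ) := by
  have := aeval_eq_zero_of_aeval_cyclotomic hn hy
    (p := ∏ j ∈ (Finset.range n).filter (fun j => Nat.Coprime j n), (1 - X ^ j) -
      C ((cyclotomic n ℤ).eval 1)) (fun ζ hζ => by
      have : NeZero n := ⟨hn.ne'⟩
      have h1 : (((cyclotomic n ℤ).eval 1 : ℤ) : ℂ) = (cyclotomic n ℂ).eval 1 := by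
        have := eval_intCast_map (Int.castRingHom ℂ) (cyclotomic n ℤ) 1
        simpa only [map_cyclotomic, Int.cast_one, eq_intCast] using this.symm
      rw [map_sub, aeval_C, eq_intCast, h1, cyclotomic_eq_prod_X_sub_primitiveRoots hζ,
        eval_prod, map_prod, sub_eq_zero]
      refine Finset.prod_bij (fun j _ => ζ ^ j) (fun j hj => ?_) (fun i hi j hj h => ?_)
        (fun μ hμ => ?_) (fun j hj => by simp)
      · exact (mem_primitiveRoots hn).2 (hζ.pow_of_coprime j (Finset.mem_filter.1 hj).2)
      · exact hζ.pow_inj (Finset.mem_range.1 (Finset.mem_filter.1 hi).1)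
          (Finset.mem_range.1 (Finset.mem_filter.1 hj).1) h
      · obtain ⟨i, hi, hc, rfl⟩ := hζ.isPrimitiveRoot_iff.1 ((mem_primitiveRoots hn).1 hμ)
        exact ⟨i, Finset.mem_filter.2 ⟨Finset.mem_range.2 hi, hc⟩, rfl⟩)
  simpa [map_prod, sub_eq_zero] using this

variable {k : Type u} [Field k]

theorem aeval_cyclotomic_int {S : Type*} [CommRing S] [Algebra k S] (n : ℕ) (y : S) :
    aeval y (cyclotomic n ℤ) = aeval y (cyclotomic n k) := by
  rw [← map_cyclotomic_int n k, aeval_def, aeval_def, eval₂_map]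
  congr 1
  exact RingHom.ext_int _ _

/-- The product of all `1 - y ^ j` with `0 < j < n` equals `n`, a unit of `k`; every factor divides
it, hence is a unit and not merely a non-zero-divisor. -/
theorem isPrincipalRoot_of_aeval_cyclotomic {S : Type*} [CommRing S] [Algebra k S] {n : ℕ}
    (hn : (n : k) ≠ 0) {y : S} (hy : aeval y (cyclotomic n k) = 0) : IsPrincipalRoot n y := by
  rw [← aeval_cyclotomic_int] at hy
  obtain ⟨m, rfl⟩ : ∃ m, n = m + 1 := Nat.exists_eq_succ_of_ne_zero (by rintro rfl; simp at hn)
  constructor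
  · have := aeval_eq_zero_of_aeval_cyclotomic m.succ_pos hy (p := X ^ (m + 1) - 1) (fun ζ hζ => by
      simp [hζ.pow_eq_one])
    simpa [sub_eq_zero] using this
  · intro j hj hjn
    have hunit : IsUnit (∏ j ∈ Finset.range m, (1 - y ^ (j + 1))) := by
      rw [prod_one_sub_pow_eq hy]
      simpa using (IsUnit.mk0 _ hn).map (algebraMap k S)
    have hdvd : 1 - y ^ j ∣ ∏ j ∈ Finset.range m, (1 - y ^ (j + 1)) := by
      have := Finset.dvd_prod_of_mem (fun j => 1 - y ^ (j + 1))
        (Finset.mem_range.2 (by omega : j - 1 < m))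
      simpa [Nat.sub_add_cancel hj] using this
    exact (isUnit_of_dvd_unit hdvd hunit).mem_nonZeroDivisors

theorem isPrincipalRoot_root_cyclotomic {n : ℕ} (hn : (n : k) ≠ 0) :
    IsPrincipalRoot n (AdjoinRoot.root (cyclotomic n k)) :=
  isPrincipalRoot_of_aeval_cyclotomic hn (by rw [AdjoinRoot.aeval_eq, AdjoinRoot.mk_self])

/-- The primes of `m` are adjoined one at a time: `Φ_{np}(x) = Φ_n(x ^ p)` whenever `p` already
divides `n`. -/
theorem cyclotomic_mul_eq_expand {n m : ℕ} (hm : m ≠ 0) (h : ∀ p : ℕ, p.Prime → p ∣ m → p ∣ n) :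
    cyclotomic (n * m) k = expand k m (cyclotomic n k) := by
  induction m using induction_on_primes with
  | zero => exact absurd rfl hm
  | one => simp
  | prime_mul p m hp ih =>
    have hp' := hp
    rw [expand_mul, ← ih (right_ne_zero_of_mul hm) fun q hq hqm => h q hq (hqm.mul_left p),
      cyclotomic_expand_eq_cyclotomic hp ((h p hp (Dvd.intro m rfl)).mul_right m)]
    congr 1
    ring

theorem cyclotomic_pow_add_eq_expand {s : ℕ} (hs : s ≠ 0) (a b : ℕ) :
    cyclotomic (s ^ (a + 1 + b)) k = expand k (s ^ b) (cyclotomic (s ^ (a + 1)) k) := by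
  rw [pow_add _ (a + 1)]
  exact cyclotomic_mul_eq_expand (pow_ne_zero _ hs) fun p hp hdvd =>
    (hp.dvd_of_dvd_pow hdvd).trans (dvd_pow_self s (by omega))

/-- Compare degrees in the corresponding identity of cyclotomic polynomials, here over `ℚ`. -/
theorem totient_pow_add {s : ℕ} (hs : s ≠ 0) (a b : ℕ) :
    Nat.totient (s ^ (a + 1 + b)) = Nat.totient (s ^ (a + 1)) * s ^ b := by
  have := congrArg natDegree (cyclotomic_pow_add_eq_expand (k := ℚ) hs a b)
  simpa [natDegree_cyclotomic, natDegree_expand] using this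

theorem polySS_eq_cyclotomic (ν : ℕ) : polySS k ν = cyclotomic (2 ^ (ν + 1)) k := by
  rw [cyclotomic_prime_pow_eq_geom_sum Nat.prime_two, Finset.sum_range_succ, Finset.sum_range_one,
    polySS]
  ring

theorem polySch_eq_cyclotomic (ν : ℕ) : polySch k ν = cyclotomic (3 ^ (ν + 1)) k := by
  rw [cyclotomic_prime_pow_eq_geom_sum Nat.prime_three, Finset.sum_range_succ,
    Finset.sum_range_succ, Finset.sum_range_one, polySch]
  ring

end Cyclotomic

/-! ## A common form of the requirements on a step -/

section Step

variable {k : Type u} [Field k]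

/-- A step that evaluates and interpolates and uses `r` DFTs of order `m`, preceded and followed by
sparse linear maps, meets the requirements of the scheme. -/
theorem isDStep_of_isTransform {P Q : k[X]} {N' N'' : ℕ} {idx : Type} [Fintype idx]
    {fwd : AdjoinRoot P → idx → AdjoinRoot Q} {bwd : (idx → AdjoinRoot Q) → k[X]}
    {h M J R T : ℕ} {pts : idx → AdjoinRoot Q}
    (H : (⟨N', N'', Q, idx, fwd, bwd⟩ : Level k P).IsTransform h M J R T pts) {K : ℝ} {n' n'' : ℕ → ℕ} (hdeg : P.natDegree = N' * N'')
    (hdegQ : Q.natDegree = N') (hseq : ∃ i, n' i = N' ∧ n'' i = N'')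
    (hroot : ∃ ω : AdjoinRoot Q, IsPrincipalRoot N'' ω)
    (hcard : Fintype.card idx ≤ 2 * N'')
    {ρ : ℕ} {orders : List ℕ} {r m : ℕ} (hl : orders.length = r)
    (hord : ∀ m' ∈ orders, m' = m) (hr : r ≤ 2) (hm0 : 1 ≤ m) (hm : m ≤ 3 * N'')
    (ω : Fin r → AdjoinRoot Q) (hω : ∀ j, SuitableRoot K m (ω j))
    (pre : AdjoinRoot P → Fin r → Fin m → AdjoinRoot Q)
    (post : (Fin r → Fin m → AdjoinRoot Q) → idx → AdjoinRoot Q)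
    (hpre : IsLinearMap k pre) (hpost : IsLinearMap k post)
    (hpre' : ∀ j i, SparseMap ρ fun v => pre (ofCoords P P.natDegree v) j i)
    (hpost' : ∀ i, SparseMap ρ fun v : (Fin r × Fin m) × Fin N' → k =>
      post (fun j i => ofCoords Q N' fun l => v ((j, i), l)) i)
    (hf : ∀ x, fwd x = post fun j => dft m (ω j) (pre x j))
    {r' m' : ℕ} (hr' : r' ≤ 2) (hm0' : 1 ≤ m') (hm' : m' ≤ 3 * N'')
    (ω' : Fin r' → AdjoinRoot Q) (hω' : ∀ j, SuitableRoot K m' (ω' j))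
    (pre' : (idx → AdjoinRoot Q) → Fin r' → Fin m' → AdjoinRoot Q)
    (post' : (Fin r' → Fin m' → AdjoinRoot Q) → k[X])
    (hprel : IsLinearMap k pre') (hpostl : IsLinearMap k post')
    (hpres : ∀ j i, SparseMap ρ fun v : idx × Fin N' → k =>
      pre' (fun i => ofCoords Q N' fun l => v (i, l)) j i)
    (hposts : ∀ m, SparseForm ρ fun v : (Fin r' × Fin m') × Fin N' → k =>
      (post' fun j i => ofCoords Q N' fun l => v ((j, i), l)).coeff m)
    (hpostd : ∀ y m, 2 * P.natDegree ≤ m → (post' y).coeff m = 0)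
    (hb : ∀ x, bwd x = post' fun j => dft m' (ω' j) (pre' x j))
    (hK : 12 * ρ + 3 ≤ K) : (⟨N', N'', Q, idx, fwd, bwd⟩ : Level k P).IsDStep K n' n'' orders := by
  have hQ : Q.Monic := H.monic_Q
  have hK0 : 3 ≤ K := le_trans (by linarith [(Nat.cast_nonneg ρ : (0 : ℝ) ≤ ρ)]) hK
  have hrK : ∀ r : ℕ, r ≤ 2 → (r : ℝ) ≤ K := fun r hr =>
    le_trans (by exact_mod_cast hr : (r : ℝ) ≤ 2) (by linarith)
  have hmK : ∀ m : ℕ, m ≤ 3 * N'' → (m : ℝ) ≤ K * N'' := fun m hm => by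
    have : (m : ℝ) ≤ 3 * N'' := by exact_mod_cast hm
    exact this.trans (by gcongr)
  -- At most two DFTs of order at most `3 N''` over an algebra of dimension `N'` have at most `6 N'
  -- N''` coordinates; at `2 ρ` operations each this gives the `12 ρ` in `K`. The summand `3` covers
  -- the number and the orders of the DFTs.
  have hcost : ∀ n : ℕ, n ≤ 6 * (N' * N'') → 2 * ρ * (n : ℝ) ≤ K * P.natDegree := by
    intro n hn
    rw [hdeg]
    have h1 : (n : ℝ) ≤ 6 * ((N' * N'' : ℕ) : ℝ) := by exact_mod_cast hn
    calc 2 * ρ * (n : ℝ) ≤ 2 * ρ * (6 * ((N' * N'' : ℕ) : ℝ)) := by gcongr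
      _ = 12 * ρ * ((N' * N'' : ℕ) : ℝ) := by ring
      _ ≤ K * ((N' * N'' : ℕ) : ℝ) := by gcongr; linarith
  have hcost' : ∀ r m : ℕ, r ≤ 2 → m ≤ 3 * N'' →
      2 * ρ * ((r * (m * N') : ℕ) : ℝ) ≤ K * P.natDegree := by
    intro r m hr hm
    refine hcost _ ?_
    calc r * (m * N') ≤ 2 * (3 * N'' * N') := by gcongr
      _ = 6 * (N' * N'') := by ring
  have hfwd : ByDFTs K P.natDegree Q N' N'' orders (ofCoords P P.natDegree)
      (fun (v : idx × Fin N' → k) i => ofCoords Q N' fun l => v (i, l)) fwd := by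
    refine byDFTs_of_sparseIn hQ hdegQ orders hl hord (hrK r hr) hm0 (hmK m hm) ω hω pre
      post hpre hpost hpre' (hcost' r m hr hm) (sparseIn_pi hQ hdegQ hpost') (hcost _ ?_) hf
    rw [Fintype.card_prod, Fintype.card_fin]
    calc Fintype.card idx * N' ≤ 2 * N'' * N' := by gcongr
      _ ≤ 6 * (N' * N'') := by nlinarith [Nat.zero_le (N' * N'')]
  exact {
    monic_P := H.monic_P
    monic_Q := H.monic_Q
    degree_P := hdeg
    degree_Q := hdegQ
    mem_seq := hseq
    root := hroot
    card_le := hcard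
    linear := hfwd.isLinearMap
    injective := H.injective
    leftInv := H.mk_bwd_fwd
    fwd_dft := hfwd
    bwd_dft := by
      refine ⟨List.replicate r' m', byDFTs_of_sparseIn hQ hdegQ _ List.length_replicate
        (fun _ h => List.eq_of_mem_replicate h) (hrK r' hr') hm0' (hmK m' hm') ω' hω' pre' post'
        hprel hpostl hpres (hcost' r' m' hr' hm') (sparseIn_ofCoeffs hposts hpostd) (hcost _ ?_) hb⟩
      rw [Fintype.card_fin, hdeg]
      omega }

end Step

/-! ### Auxiliary facts on inverse roots, linearity and overlapping blocks -/

section Tools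

variable {k : Type u} [Field k] {P Q : k[X]}

/-- The power `w ^ (n - 1)` is the inverse of `w`, and `w ^ (-j) = w ^ (n - j)` with `n - j` again
strictly between `0` and `n`. -/
theorem IsPrincipalRoot.pow_sub_one {R : Type*} [Ring R] {n : ℕ} {w : R}
    (hw : IsPrincipalRoot n w) : IsPrincipalRoot n (w ^ (n - 1)) := by
  refine ⟨by rw [← pow_mul, mul_comm, pow_mul, hw.1, one_pow], fun j hj hjn => ?_⟩
  have : (n - 1) * j = n * (j - 1) + (n - j) := by
    obtain ⟨i, rfl⟩ : ∃ i, j = i + 1 := ⟨j - 1, by omega⟩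
    obtain ⟨d, rfl⟩ : ∃ d, n = i + 1 + d := ⟨n - (i + 1), by omega⟩
    rw [Nat.add_sub_cancel, Nat.add_sub_cancel_left, show i + 1 + d - 1 = i + d by omega]
    ring
  rw [← pow_mul, this, pow_add, pow_mul, hw.1, one_pow, one_mul]
  exact hw.2 _ (by omega) (by omega)

theorem eval_map_outerPoly_block (Q : k[X]) (h M J R : ℕ) (p : k[X]) (z : AdjoinRoot Q) :
    ((outerPoly R (block h M J p)).map (AdjoinRoot.mk Q)).eval z =
      ∑ i ∈ Finset.range R, pack Q J (fun j => p.coeff (h * i + M * j)) * z ^ i := by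
  rw [map_outerPoly, eval_outerPoly]
  rfl

theorem sparseForm_coeff_rep_ofCoords (hP : P.Monic) (m : ℕ) :
    SparseForm 1 fun v => (rep P (ofCoords P P.natDegree v)).coeff m := by
  simp only [coeff_rep_ofCoords hP rfl]
  split_ifs with h
  · exact sparseForm_apply _
  · exact sparseForm_zero 1

theorem sparseMap_coords {ι : Type*} (hQ : Q.Monic) {N : ℕ} (hN : Q.natDegree = N)
    (φ : Fin N → ι) : SparseMap 1 fun v : ι → k => ofCoords Q N fun l => v (φ l) :=
  sparseMap_ofCoords hQ hN fun l => sparseForm_apply (φ l)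

theorem isLinearMap_pack (hP : P.Monic) (J : ℕ) (g : ℕ → ℕ) :
    IsLinearMap k fun a : AdjoinRoot P => pack Q J fun j => (rep P a).coeff (g j) :=
  ⟨fun a b => by simp only [rep_add hP, coeff_add, pack_add],
    fun c a => by simp only [rep_smul hP, coeff_smul, smul_eq_mul, pack_smul]⟩

theorem isLinearMap_smul_apply {α β : Type*} (c : k) (a : α) :
    IsLinearMap k fun (y : α → β → AdjoinRoot Q) (i : β) => c • y a i :=
  ⟨fun x y => _root_.funext fun i => smul_add c (x a i) (y a i),
    fun d x => _root_.funext fun i => smul_comm c d (x a i)⟩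

theorem isLinearMap_sum_expand (hQ : Q.Monic) {V : Type*} [AddCommMonoid V] [Module k V] (M : ℕ)
    {α : Type*} [Fintype α] (J : α → ℕ) {u : V → α → AdjoinRoot Q} (hu : IsLinearMap k u) :
    IsLinearMap k fun y => ∑ i, expand k M (rep Q (u y i)) * X ^ J i := by
  constructor
  · intro x y
    simp only [hu.map_add, Pi.add_apply, rep_add hQ, map_add, add_mul, Finset.sum_add_distrib]
  · intro c x
    simp only [hu.map_smul, Pi.smul_apply, rep_smul hQ, map_smul, smul_mul_assoc, Finset.smul_sum]

theorem card_filter_mem_le (n : ℕ) (U : Finset ℕ) :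
    (Finset.univ.filter fun i : Fin n => (i : ℕ) ∈ U).card ≤ U.card := by
  refine Finset.card_le_card_of_injOn (fun i => (i : ℕ)) (fun i hi => ?_) Fin.val_injective.injOn
  simpa using hi

/-- An offset `l < 2 h` changes the quotient of the exponent by `h` by at most one, so at most two
blocks reach the exponent `c`. -/
theorem overlap_consecutive {h N : ℕ} (hh : 0 < h) (hN : N ≤ 2 * h) {i l c : ℕ} (hl : l < N)
    (hc : 1 * l + h * i = c) : i ∈ ({c / h, c / h - 1} : Finset ℕ) := by
  have h1 : c / h = i + l / h := by
    rw [← hc, one_mul, Nat.add_mul_div_left _ _ hh, add_comm]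
  have h2 : l / h < 2 := (Nat.div_lt_iff_lt_mul hh).2 (by omega)
  simp only [Finset.mem_insert, Finset.mem_singleton]
  generalize l / h = q at *
  omega

/-- The exponent determines `i` modulo `M`, and `i < 2 M` leaves two possibilities. -/
theorem overlap_interleaved {M : ℕ} {i l c : ℕ} (hi : i < 2 * M)
    (hc : M * l + 1 * i = c) : i ∈ ({c % M, c % M + M} : Finset ℕ) := by
  have h1 : c % M = i % M := by rw [← hc, one_mul, Nat.mul_add_mod]
  have h2 : i / M < 2 := (Nat.div_lt_iff_lt_mul (by omega)).2 hi
  have h3 := Nat.mod_add_div i M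
  simp only [Finset.mem_insert, Finset.mem_singleton]
  rw [h1]
  interval_cases i / M <;> omega

end Tools

/-! ## Steps with a single DFT -/

section DFTLevel

variable {k : Type u} [Field k]

/-- The step that evaluates at all powers of a principal `m`-th root of unity `w`. -/
def dftLevel (P Q : k[X]) (N' N'' m : ℕ) (w : AdjoinRoot Q) (h M J R : ℕ) : Level k P where
  N' := N'
  N'' := N''
  Q := Q
  idx := Fin m
  fwd a := dft m w fun i =>
    if (i : ℕ) < R then pack Q J fun j => (rep P a).coeff (h * i + M * j) else 0
  bwd v := ∑ i : Fin m, expand k M (rep Q (((m : k)⁻¹) • dft m (w ^ (m - 1)) v i)) * X ^ (h * (i : ℕ))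

variable {P Q : k[X]} {N' N'' m h M J R : ℕ} {w : AdjoinRoot Q}

theorem dft_pack_eq_eval (hR : R ≤ m) (p : k[X]) (i : Fin m) :
    dft m w (fun i => if (i : ℕ) < R then pack Q J fun j => p.coeff (h * i + M * j) else 0) i =
      ((outerPoly R (block h M J p)).map (AdjoinRoot.mk Q)).eval (w ^ (i : ℕ)) := by
  rw [eval_map_outerPoly_block, dft]
  have := Finset.sum_range (n := m) fun j => w ^ ((i : ℕ) * j) *
    if j < R then pack Q J fun l => p.coeff (h * j + M * l) else 0
  rw [← this, ← Finset.sum_subset (Finset.range_subset_range.2 hR)]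
  · refine Finset.sum_congr rfl fun j hj => ?_
    rw [if_pos (Finset.mem_range.1 hj), ← pow_mul, mul_comm]
  · intro j _ hj
    rw [if_neg (by simpa using hj), mul_zero]

theorem sum_expand_inv_smul_dft (hw : IsPrincipalRoot m w) (hm : (m : k) ≠ 0) (h M : ℕ)
    {F : (AdjoinRoot Q)[X]} (hF : F.degree < m) :
    ∑ i : Fin m, expand k M (rep Q (((m : k)⁻¹) • dft m (w ^ (m - 1))
      (fun i : Fin m => F.eval (w ^ (i : ℕ))) i)) * X ^ (h * (i : ℕ)) =
    ∑ t ∈ Finset.range m, expand k M (rep Q (F.coeff t)) * X ^ (h * t) := by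
  simp only [inv_smul_dft_eval hw hm hF]
  exact (Finset.sum_range fun t => expand k M (rep Q (F.coeff t)) * X ^ (h * t)).symm

theorem isLinearMap_blocks (hP : P.Monic) {r : ℕ} :
    IsLinearMap k fun (a : AdjoinRoot P) (_ : Fin r) (i : Fin m) =>
      if (i : ℕ) < R then pack Q J fun j => (rep P a).coeff (h * i + M * j) else 0 := by
  constructor
  · intro a b
    funext j i
    simp only [Pi.add_apply]
    split_ifs
    · exact (isLinearMap_pack hP J fun j => h * i + M * j).map_add a b
    · rw [add_zero]
  · intro c a
    funext j i
    simp only [Pi.smul_apply]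
    split_ifs
    · exact (isLinearMap_pack hP J fun j => h * i + M * j).map_smul c a
    · rw [smul_zero]

theorem sparseMap_block (hP : P.Monic) (hQ : Q.Monic) (hJ : J ≤ Q.natDegree) (i : Fin m) :
    SparseMap 2 fun v => if (i : ℕ) < R then
      pack Q J fun j => (rep P (ofCoords P P.natDegree v)).coeff (h * i + M * j) else 0 := by
  split_ifs
  · exact (sparseMap_pack hQ hJ fun j => sparseForm_coeff_rep_ofCoords hP _).mono one_le_two
  · exact sparseMap_zero hQ 2

theorem dftLevel_isTransform (hP : P.Monic) (hQ : Q.Monic) (hdeg : P.natDegree = R * J)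
    (hJ : J ≤ Q.natDegree) (hR : R ≤ m) (hdec : (M = 1 ∧ h = J) ∨ (h = 1 ∧ M = R))
    (hw : IsPrincipalRoot m w) (hm : (m : k) ≠ 0) :
    (dftLevel P Q N' N'' m w h M J R).IsTransform h M J R m fun i : Fin m => w ^ (i : ℕ) where
  monic_P := hP
  monic_Q := hQ
  degree_P := hdeg
  le_degree_Q := hJ
  le := hR
  blocks := hdec
  fwd_eq a i := dft_pack_eq_eval hR (rep P a) i
  bwd_eq _ hF := sum_expand_inv_smul_dft hw hm h M hF

/-- Forward, the blocks are copied coordinates; backward, `hover` lets at most two summands meet in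
each coefficient. So sparsity `2` suffices, and `27 = 12 * 2 + 3`. -/
theorem dftLevel_isDStep (H : (dftLevel P Q N' N'' m w h M J R).IsTransform h M J R m
      fun i : Fin m => w ^ (i : ℕ)) (hM : 0 < M)
    {K : ℝ} {n' n'' : ℕ → ℕ} (hdeg : P.natDegree = N' * N'') (hdegQ : Q.natDegree = N')
    (hseq : ∃ i, n' i = N' ∧ n'' i = N'') (hroot : ∃ ω : AdjoinRoot Q, IsPrincipalRoot N'' ω)
    (hm0 : 1 ≤ m) (hm : m ≤ 2 * N'') {s ν : ℕ} (hs : 2 ≤ s) (hsν : m = s ^ ν)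
    (hw : IsPrincipalRoot m w) (hK : 2 * s ≤ K) (hK' : 27 ≤ K)
    (hover : ∀ c, ∃ a b : ℕ, ∀ i < m, ∀ l < N', M * l + h * i = c → i ∈ ({a, b} : Finset ℕ))
    (hbound : ∀ i < m, ∀ l < N', M * l + h * i < 2 * P.natDegree) {orders : List ℕ}
    (horders : orders = [m]) :
    (dftLevel P Q N' N'' m w h M J R).IsDStep K n' n'' orders := by
  have hQ : Q.Monic := H.monic_Q
  have hP : P.Monic := H.monic_P
  have hJ : J ≤ Q.natDegree := H.le_degree_Q
  refine isDStep_of_isTransform H (ρ := 2) hdeg hdegQ hseq hroot ((Fintype.card_fin m).trans_le hm)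
    (r := 1) (m := m) (by rw [horders]; rfl) (by simp [horders]) one_le_two hm0
    (hm.trans (Nat.mul_le_mul_right _ (by norm_num))) (fun _ => w)
    (fun _ => ?_)
    (fun a _ i => if (i : ℕ) < R then pack Q J fun j => (rep P a).coeff (h * i + M * j) else 0)
    (fun y => y 0) (isLinearMap_blocks hP) ⟨fun _ _ => rfl, fun _ _ => rfl⟩
    (fun _ i => sparseMap_block hP hQ hJ i) ?_ (fun _ => rfl)
    (r' := 1) (m' := m) one_le_two hm0 (hm.trans (Nat.mul_le_mul_right _ (by norm_num)))
    (fun _ => w ^ (m - 1)) (fun _ => ?_) (fun v _ => v)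
    (fun y => ∑ i : Fin m, expand k M (rep Q (((m : k)⁻¹) • y 0 i)) * X ^ (h * (i : ℕ)))
    ⟨fun _ _ => rfl, fun _ _ => rfl⟩ ?_ ?_ ?_ ?_ (fun _ => rfl) ?_
  · subst hsν; exact suitableRoot_pow hs ν hw hK
  · intro i
    exact (sparseMap_coords hQ hdegQ fun l => (((0 : Fin 1), i), l)).mono one_le_two
  · subst hsν; exact suitableRoot_pow hs ν hw.pow_sub_one hK
  · exact isLinearMap_sum_expand (α := Fin m) hQ M (fun i => h * (i : ℕ))
      (u := fun (y : Fin 1 → Fin m → AdjoinRoot Q) i => ((m : k)⁻¹) • y 0 i)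
      (isLinearMap_smul_apply _ 0)
  · intro j i
    exact (sparseMap_coords hQ hdegQ fun l => (i, l)).mono one_le_two
  · intro c
    obtain ⟨a, b, hab⟩ := hover c
    refine sparseForm_coeff_sum_expand hQ hM (fun i : Fin m => h * (i : ℕ)) (r := 1) (t := 2)
      (fun i => (sparseMap_coords hQ hdegQ fun l => (((0 : Fin 1), i), l)).smul hQ _) c
      (Finset.univ.filter fun i : Fin m => (i : ℕ) ∈ ({a, b} : Finset ℕ))
      ((card_filter_mem_le m _).trans Finset.card_le_two) fun i l hl hc => ?_
    exact Finset.mem_filter.2 ⟨Finset.mem_univ _, hab i i.isLt l (hl.trans_eq hdegQ) hc⟩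
  · intro y c hc
    refine coeff_sum_expand_eq_zero hQ hM (fun i : Fin m => h * (i : ℕ)) _ c fun i l hl hlc => ?_
    have := hbound i i.isLt l (hl.trans_eq hdegQ)
    omega
  · norm_num
    exact hK'

end DFTLevel

/-! ## Multiplication via a DFT over `k` -/

section AlgorithmA

variable {k : Type u} [Field k]

theorem levelA_eq (N : ℕ) (w : k) : levelA k N w =
    dftLevel (X ^ N - 1) (X - 1) 1 N N (AdjoinRoot.of (X - 1 : k[X]) w) 1 1 1 N := by
  rw [levelA, dftLevel]
  congr 1
  · funext a
    congr 1
    funext i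
    simp [pack, AdjoinRoot.mk_C]
  · funext v
    simp [expand_one]

theorem monic_X_sub_one : (X - 1 : k[X]).Monic := by
  simpa using monic_X_sub_C (1 : k)

theorem natDegree_X_sub_one : (X - 1 : k[X]).natDegree = 1 := by
  simpa using natDegree_X_sub_C (1 : k)

theorem isPrincipalRoot_of {S : Type*} [Ring S] [Algebra k S] {N : ℕ} {w : k}
    (hw : IsPrimitiveRoot w N) : IsPrincipalRoot N (algebraMap k S w) := by
  refine ⟨by rw [← map_pow, hw.pow_eq_one, map_one], fun j hj hjN => ?_⟩
  rw [← map_pow, ← map_one (algebraMap k S), ← map_sub]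
  refine IsUnit.mem_nonZeroDivisors ((IsUnit.mk0 _ ?_).map (algebraMap k S))
  exact sub_ne_zero.2 (hw.pow_ne_one_of_pos_of_lt (by omega) hjN).symm

theorem levelA_isTransform {N : ℕ} (hN : 0 < N) {w : k} (hw : IsPrimitiveRoot w N) :
    (dftLevel (X ^ N - 1) (X - 1) 1 N N (AdjoinRoot.of (X - 1 : k[X]) w) 1 1 1 N).IsTransform
      1 1 1 N N fun i : Fin N => AdjoinRoot.of (X - 1 : k[X]) w ^ (i : ℕ) := by
  have : NeZero N := ⟨hN.ne'⟩
  refine dftLevel_isTransform ?_ monic_X_sub_one ?_ natDegree_X_sub_one.ge le_rfl (.inl ⟨rfl, rfl⟩)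
    (isPrincipalRoot_of hw) hw.neZero'.out
  · simpa using monic_X_pow_sub_C (1 : k) hN.ne'
  · simpa using natDegree_X_pow_sub_C (n := N) (r := (1 : k))

theorem levelA_isDStep {s ν : ℕ} (hs : 2 ≤ s) {w : k} (hw : IsPrimitiveRoot w (s ^ ν)) {K : ℝ}
    (hK : 2 * s ≤ K) (hK' : 27 ≤ K) :
    (levelA k (s ^ ν) w).IsDStep K (fun _ => 1) (fun i => s ^ i) [s ^ ν] := by
  have hN : 0 < s ^ ν := pow_pos (by omega) ν
  have H := levelA_isTransform hN hw
  rw [levelA_eq]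
  have hdeg : (X ^ s ^ ν - 1 : k[X]).natDegree = s ^ ν := by
    simpa using natDegree_X_pow_sub_C (n := s ^ ν) (r := (1 : k))
  refine dftLevel_isDStep H one_pos (by rw [hdeg, one_mul]) natDegree_X_sub_one ⟨ν, rfl, rfl⟩
    ⟨_, isPrincipalRoot_of hw⟩ hN (by omega) hs rfl (isPrincipalRoot_of hw) hK hK'
    -- The inner algebra has dimension one, so `l = 0` and the exponent is the block index.
    (fun c => ⟨c, c, fun i _ l hl hc => ?_⟩) (fun i hi l hl => by rw [hdeg]; omega) rfl
  rw [show i = c by omega]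
  simp

end AlgorithmA

/-! ## The Schönhage–Strassen algorithm -/

section AlgorithmSS

variable {k : Type u} [Field k]

theorem monic_polySS (ν : ℕ) : (polySS k ν).Monic := by
  rw [polySS_eq_cyclotomic]; exact cyclotomic.monic _ _

theorem natDegree_polySS (ν : ℕ) : (polySS k ν).natDegree = 2 ^ ν := by
  rw [polySS_eq_cyclotomic, natDegree_cyclotomic, Nat.totient_prime_pow_succ Nat.prime_two]
  simp

theorem two_ne_zero_of_ringChar (h2 : ringChar k ≠ 2) : (2 : k) ≠ 0 :=
  Ring.two_ne_zero h2

/-- The class of `y` is a root of `Φ_{2^(a+1)}`, hence a principal root of order `2 ^ (a + 1)` as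
`2` is invertible; its powers give the smaller orders. -/
theorem isPrincipalRoot_root_polySS (h2 : ringChar k ≠ 2) {a b : ℕ} (hab : b ≤ a + 1) :
    IsPrincipalRoot (2 ^ b) (AdjoinRoot.root (polySS k a) ^ 2 ^ (a + 1 - b)) := by
  refine IsPrincipalRoot.pow ?_ (by positivity)
  rw [← pow_add, Nat.sub_add_cancel hab, polySS_eq_cyclotomic]
  refine isPrincipalRoot_root_cyclotomic ?_
  push_cast
  exact pow_ne_zero _ (two_ne_zero_of_ringChar h2)

/-- Here `R` equals the order of the DFT, so the zero padding of `dftLevel` is empty. -/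
theorem levelSS_eq (ν : ℕ) : levelSS k ν =
    dftLevel (polySS k ν) (polySS k ((ν + 1) / 2)) (2 ^ ((ν + 1) / 2)) (2 ^ (ν / 2))
      (2 ^ (ν / 2 + 1)) (AdjoinRoot.root _ ^ 2 ^ ((ν + 1) / 2 + 1 - (ν / 2 + 1)))
      (2 ^ ((ν + 1) / 2) / 2) 1 (2 ^ ((ν + 1) / 2) / 2) (2 ^ (ν / 2 + 1)) := by
  have hw : 2 * 2 ^ ((ν + 1) / 2) / 2 ^ (ν / 2 + 1) = 2 ^ ((ν + 1) / 2 + 1 - (ν / 2 + 1)) := by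
    rw [← pow_succ', Nat.pow_div (by omega) two_pos]
  simp only [levelSS, dftLevel]
  rw [hw]
  congr 1
  · funext a
    congr 1
    funext i
    simp
  · funext v
    simp [expand_one]

theorem innerLevelSS_eq (ν : ℕ) : innerLevelSS k ν =
    dftLevel (polySS k ν) (polySS k ((ν + 1) / 2)) (2 ^ ((ν + 1) / 2)) (2 ^ (ν / 2))
      (2 * 2 ^ (ν / 2)) (AdjoinRoot.root _ ^ 2 ^ ((ν + 1) / 2 + 1 - (ν / 2 + 1)))
      1 (2 ^ (ν / 2)) (2 ^ ((ν + 1) / 2)) (2 ^ (ν / 2)) := by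
  have hw : 2 ^ ((ν + 1) / 2) / 2 ^ (ν / 2) = 2 ^ ((ν + 1) / 2 + 1 - (ν / 2 + 1)) := by
    rw [Nat.pow_div (by omega) two_pos]
    congr 1
    omega
  simp only [innerLevelSS, dftLevel]
  rw [hw]
  congr 1
  · funext a
    congr 1
    funext i
    simp
  · funext v
    simp

theorem two_pow_half_mul (ν : ℕ) : 2 ^ ν = 2 ^ ((ν + 1) / 2) * 2 ^ (ν / 2) := by
  rw [← pow_add]
  congr 1
  omega

theorem levelSS_isTransform (h2 : ringChar k ≠ 2) {ν : ℕ} (hν : 1 ≤ ν) :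
    (dftLevel (polySS k ν) (polySS k ((ν + 1) / 2)) (2 ^ ((ν + 1) / 2)) (2 ^ (ν / 2))
      (2 ^ (ν / 2 + 1)) (AdjoinRoot.root _ ^ 2 ^ ((ν + 1) / 2 + 1 - (ν / 2 + 1)))
      (2 ^ ((ν + 1) / 2) / 2) 1 (2 ^ ((ν + 1) / 2) / 2) (2 ^ (ν / 2 + 1))).IsTransform
      (2 ^ ((ν + 1) / 2) / 2) 1 (2 ^ ((ν + 1) / 2) / 2) (2 ^ (ν / 2 + 1)) (2 ^ (ν / 2 + 1))
      fun i : Fin (2 ^ (ν / 2 + 1)) =>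
        (AdjoinRoot.root _ ^ 2 ^ ((ν + 1) / 2 + 1 - (ν / 2 + 1))) ^ (i : ℕ) := by
  refine dftLevel_isTransform (monic_polySS _) (monic_polySS _) ?_ ?_ le_rfl (.inl ⟨rfl, rfl⟩)
    (isPrincipalRoot_root_polySS h2 (by omega)) ?_
  -- The hypothesis `1 ≤ ν` makes `N'` even, so that halving the block length is exact.
  · obtain ⟨a, ha⟩ : ∃ a, (ν + 1) / 2 = a + 1 := ⟨(ν + 1) / 2 - 1, by omega⟩
    rw [natDegree_polySS, two_pow_half_mul ν, ha, pow_succ, Nat.mul_div_cancel _ two_pos]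
    ring
  · rw [natDegree_polySS]
    exact Nat.div_le_self _ _
  · push_cast
    exact pow_ne_zero _ (two_ne_zero_of_ringChar h2)

theorem innerLevelSS_isTransform (h2 : ringChar k ≠ 2) (ν : ℕ) :
    (dftLevel (polySS k ν) (polySS k ((ν + 1) / 2)) (2 ^ ((ν + 1) / 2)) (2 ^ (ν / 2))
      (2 * 2 ^ (ν / 2)) (AdjoinRoot.root _ ^ 2 ^ ((ν + 1) / 2 + 1 - (ν / 2 + 1)))
      1 (2 ^ (ν / 2)) (2 ^ ((ν + 1) / 2)) (2 ^ (ν / 2))).IsTransform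
      1 (2 ^ (ν / 2)) (2 ^ ((ν + 1) / 2)) (2 ^ (ν / 2)) (2 * 2 ^ (ν / 2))
      fun i : Fin (2 * 2 ^ (ν / 2)) =>
        (AdjoinRoot.root _ ^ 2 ^ ((ν + 1) / 2 + 1 - (ν / 2 + 1))) ^ (i : ℕ) := by
  refine dftLevel_isTransform (monic_polySS _) (monic_polySS _) ?_ ?_ (by omega) (.inr ⟨rfl, rfl⟩)
    ?_ ?_
  · rw [natDegree_polySS, two_pow_half_mul ν, mul_comm]
  · rw [natDegree_polySS]
  · rw [← pow_succ']
    exact isPrincipalRoot_root_polySS h2 (by omega)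
  · push_cast
    exact mul_ne_zero (two_ne_zero_of_ringChar h2) (pow_ne_zero _ (two_ne_zero_of_ringChar h2))

theorem levelSS_isDStep (h2 : ringChar k ≠ 2) {ν : ℕ} (hν : 1 ≤ ν) {K : ℝ} (hK : 27 ≤ K) :
    (levelSS k ν).IsDStep K (fun i => 2 ^ ((i + 1) / 2)) (fun i => 2 ^ (i / 2))
      [2 * 2 ^ (ν / 2)] := by
  have H := levelSS_isTransform h2 hν
  rw [levelSS_eq]
  obtain ⟨a, ha⟩ : ∃ a, (ν + 1) / 2 = a + 1 := ⟨(ν + 1) / 2 - 1, by omega⟩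
  have hhalf : 2 ^ ((ν + 1) / 2) / 2 * 2 = 2 ^ ((ν + 1) / 2) := by
    rw [ha, pow_succ, Nat.mul_div_cancel _ two_pos]
  have hpos : 0 < 2 ^ ((ν + 1) / 2) := by positivity
  refine dftLevel_isDStep H one_pos (by rw [natDegree_polySS, two_pow_half_mul])
    (natDegree_polySS _) ⟨ν, rfl, rfl⟩ ⟨_, isPrincipalRoot_root_polySS h2 (by omega)⟩
    Nat.one_le_two_pow (by rw [pow_succ']) le_rfl rfl (isPrincipalRoot_root_polySS h2 (by omega))
    (by norm_num; linarith) hK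
    -- Elements of the inner algebra have `N'` coefficients while blocks are spaced `N' / 2` apart.
    (fun c => ⟨_, _, fun i _ l hl hc => overlap_consecutive (by omega) (by omega) hl hc⟩)
    (fun i hi l hl => ?_) (by rw [pow_succ'])
  rw [natDegree_polySS, two_pow_half_mul ν]
  rw [pow_succ] at hi
  have h4 : 1 ≤ 2 ^ (ν / 2) := Nat.one_le_two_pow
  generalize 2 ^ (ν / 2) = M at *
  generalize 2 ^ ((ν + 1) / 2) / 2 = h at *
  rw [← hhalf] at hl ⊢
  nlinarith

theorem innerLevelSS_isDStep (h2 : ringChar k ≠ 2) (ν : ℕ) {K : ℝ} (hK : 27 ≤ K) :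
    (innerLevelSS k ν).IsDStep K (fun i => 2 ^ ((i + 1) / 2)) (fun i => 2 ^ (i / 2))
      [2 * 2 ^ (ν / 2)] := by
  have H := innerLevelSS_isTransform h2 ν
  rw [innerLevelSS_eq]
  have hpos : 1 ≤ 2 ^ ((ν + 1) / 2) := Nat.one_le_two_pow
  have hpos' : 1 ≤ 2 ^ (ν / 2) := Nat.one_le_two_pow
  refine dftLevel_isDStep H (by positivity) (by rw [natDegree_polySS, two_pow_half_mul])
    (natDegree_polySS _) ⟨ν, rfl, rfl⟩ ⟨_, isPrincipalRoot_root_polySS h2 (by omega)⟩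
    (by omega) le_rfl le_rfl (pow_succ' 2 (ν / 2)).symm
    (by rw [← pow_succ']; exact isPrincipalRoot_root_polySS h2 (by omega))
    (by norm_num; linarith) hK
    (fun c => ⟨_, _, fun i hi l _ hc => overlap_interleaved hi hc⟩)
    (fun i hi l hl => ?_) rfl
  rw [natDegree_polySS, two_pow_half_mul ν]
  nlinarith

/-- With `y = x ^ N''` the modulus is preserved exactly: `x ^ (N' N'') + 1 = Q(x ^ N'')`. -/
theorem innerLevelSS_exec (h2 : ringChar k ≠ 2) (ν : ℕ) (a b : AdjoinRoot (polySS k ν)) :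
    (innerLevelSS k ν).exec (fun u v => u * v) a b = a * b := by
  have H := innerLevelSS_isTransform h2 ν
  rw [innerLevelSS_eq]
  refine H.exec_mul_of_dvd (dvd_of_eq ?_) (by omega) (by positivity) a b
  change _ = expand k (2 ^ (ν / 2)) (polySS k ((ν + 1) / 2))
  simp only [polySS, map_add, map_pow, expand_X, map_one, ← pow_mul]
  rw [mul_comm, ← two_pow_half_mul]

theorem innerSS_isD (h2 : ringChar k ≠ 2) {K : ℝ} (hK : 27 ≤ K) (ν : ℕ) :
    (innerSS k ν).IsD K (fun i => 2 ^ ((i + 1) / 2)) (fun i => 2 ^ (i / 2)) := by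
  induction ν using Nat.strong_induction_on with
  | _ ν ih =>
    rw [innerSS]
    split_ifs with hν
    · refine ⟨monic_polySS _, le_trans ?_ hK⟩
      rw [natDegree_polySS]
      interval_cases ν <;> norm_num
    · exact ⟨⟨_, innerLevelSS_isDStep h2 ν hK⟩, innerLevelSS_exec h2 ν, ih _ (by omega)⟩

end AlgorithmSS

/-! ## Back-transforms with two inverse DFTs -/

section Halves

variable {k : Type u} [Field k] {Q : k[X]}

/-- The recombination of `2 N` polynomials that are linear combinations of two families of `N`
elements of `k[y]/Q`. -/
def halvesPost (Q : k[X]) (M h N : ℕ) (A : Fin N ⊕ Fin N → Fin 2 → AdjoinRoot Q)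
    (y : Fin 2 → Fin N → AdjoinRoot Q) : k[X] :=
  ∑ i : Fin N ⊕ Fin N, expand k M (rep Q (A i 0 * y 0 (Sum.elim id id i) +
    A i 1 * y 1 (Sum.elim id id i))) *
      X ^ Sum.elim (fun i : Fin N => h * (i : ℕ)) (fun i : Fin N => h * (i + N)) i

variable {M h N : ℕ} {A : Fin N ⊕ Fin N → Fin 2 → AdjoinRoot Q}

theorem halvesPost_eq (y : Fin 2 → Fin N → AdjoinRoot Q) :
    halvesPost Q M h N A y = ∑ i : Fin N,
      (expand k M (rep Q (A (.inl i) 0 * y 0 i + A (.inl i) 1 * y 1 i)) * X ^ (h * (i : ℕ)) +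
        expand k M (rep Q (A (.inr i) 0 * y 0 i + A (.inr i) 1 * y 1 i)) *
          X ^ (h * ((i : ℕ) + N))) := by
  rw [halvesPost, Fintype.sum_sum_type, Finset.sum_add_distrib]
  rfl

theorem isLinearMap_halvesPost (hQ : Q.Monic) : IsLinearMap k (halvesPost Q M h N A) :=
  isLinearMap_sum_expand hQ M _ (u := fun (y : Fin 2 → Fin N → AdjoinRoot Q) i =>
      A i 0 * y 0 (Sum.elim id id i) + A i 1 * y 1 (Sum.elim id id i))
    ⟨fun x y => _root_.funext fun i => by simp only [Pi.add_apply]; ring,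
      fun c x => _root_.funext fun i => by simp only [Pi.smul_apply, mul_smul_comm, smul_add]⟩

/-- At most two of the `2 N` summands meet a given exponent, and each is a sum of two products with
`ρ`-sparse multipliers: `2 (ρ + ρ)`. -/
theorem sparseForm_coeff_halvesPost (hQ : Q.Monic) {N' : ℕ} (hN : Q.natDegree = N') (hM : 0 < M)
    {ρ : ℕ} (hA : ∀ i j, SparseMul ρ (A i j))
    (hover : ∀ c, ∃ a b : ℕ, ∀ i < 2 * N, ∀ l < N', M * l + h * i = c → i ∈ ({a, b} : Finset ℕ))
    (c : ℕ) : SparseForm (4 * ρ) fun v : (Fin 2 × Fin N) × Fin N' → k =>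
      (halvesPost Q M h N A fun j i => ofCoords Q N' fun l => v ((j, i), l)).coeff c := by
  obtain ⟨a, b, hab⟩ := hover c
  -- The lower and upper halves are numbered consecutively by `0, …, 2 N - 1`, which makes `hover`
  -- applicable.
  set g : Fin N ⊕ Fin N → ℕ := Sum.elim (fun i => (i : ℕ)) (fun i => (i : ℕ) + N) with hg
  have hinj : Function.Injective g := by
    rintro (i | i) (j | j) hij <;> simp only [hg, Sum.elim_inl, Sum.elim_inr] at hij
    · rw [Fin.ext hij]
    · have := i.isLt; omega
    · have := j.isLt; omega
    · rw [Fin.ext (by omega : (i : ℕ) = j)]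
  refine (sparseForm_coeff_sum_expand hQ hM _ (r := ρ * 1 + ρ * 1) (t := 2)
    (f := fun (i : Fin N ⊕ Fin N) (v : (Fin 2 × Fin N) × Fin N' → k) =>
      A i 0 * (ofCoords Q N' fun l => v ((0, Sum.elim id id i), l)) +
        A i 1 * (ofCoords Q N' fun l => v ((1, Sum.elim id id i), l)))
    (fun i => ((hA i 0).sparseMap hQ (sparseMap_coords hQ hN fun l => _)).add hQ
      ((hA i 1).sparseMap hQ (sparseMap_coords hQ hN fun l => _))) c
    (Finset.univ.filter fun i => g i ∈ ({a, b} : Finset ℕ)) ?_ fun i l hl hc => ?_).mono (by omega)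
  · exact (Finset.card_le_card_of_injOn g (fun i hi => by simpa using hi) hinj.injOn).trans
      (Finset.card_le_two (a := a) (b := b))
  · refine Finset.mem_filter.2 ⟨Finset.mem_univ _, hab _ ?_ l (hl.trans_eq hN) ?_⟩
    · rcases i with i | i <;> simp only [hg, Sum.elim_inl, Sum.elim_inr] <;> have := i.isLt <;> omega
    · rw [← hc]
      rcases i with i | i <;> rfl

theorem coeff_halvesPost_eq_zero (hQ : Q.Monic) {N' : ℕ} (hN : Q.natDegree = N') (hM : 0 < M)
    {B : ℕ} (hbound : ∀ i < 2 * N, ∀ l < N', M * l + h * i < B)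
    (y : Fin 2 → Fin N → AdjoinRoot Q) (c : ℕ) (hc : B ≤ c) :
    (halvesPost Q M h N A y).coeff c = 0 := by
  refine coeff_sum_expand_eq_zero hQ hM _ _ c fun i l hl => ?_
  rcases i with i | i <;> have := i.isLt <;> simp only [Sum.elim_inl, Sum.elim_inr]
  · have := hbound i (by omega) l (hl.trans_eq hN)
    omega
  · have := hbound (i + N) (by omega) l (hl.trans_eq hN)
    omega

end Halves

/-! ## Schönhage's algorithm -/

section AlgorithmSch

variable {k : Type u} [Field k]

theorem monic_polySch (ν : ℕ) : (polySch k ν).Monic := by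
  rw [polySch_eq_cyclotomic]; exact cyclotomic.monic _ _

theorem natDegree_polySch (ν : ℕ) : (polySch k ν).natDegree = 2 * 3 ^ ν := by
  rw [polySch_eq_cyclotomic, natDegree_cyclotomic, Nat.totient_prime_pow_succ Nat.prime_three]
  ring

theorem three_ne_zero_of_ringChar (h2 : ringChar k = 2) : (3 : k) ≠ 0 := by
  have := (ringChar.spec k 3).not.2 (by rw [h2]; norm_num)
  exact_mod_cast this

theorem isPrincipalRoot_root_polySch (h3 : (3 : k) ≠ 0) {a b : ℕ} (hab : b ≤ a + 1) :
    IsPrincipalRoot (3 ^ b) (AdjoinRoot.root (polySch k a) ^ 3 ^ (a + 1 - b)) := by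
  refine IsPrincipalRoot.pow ?_ (by positivity)
  rw [← pow_add, Nat.sub_add_cancel hab, polySch_eq_cyclotomic]
  refine isPrincipalRoot_root_cyclotomic ?_
  push_cast
  exact pow_ne_zero _ h3

/-- The modulus is `q(y ^ 3 ^ a)` with `q = y² + y + 1` of degree `2`. -/
theorem sparseMul_root_polySch (a e : ℕ) : SparseMul 2 (AdjoinRoot.root (polySch k a) ^ e) := by
  have hq : (polySch k 0).natDegree = 2 := by rw [natDegree_polySch]; norm_num
  have := sparseMul_root_pow (Q := polySch k a) (M := 3 ^ a) (by positivity) (monic_polySch (k := k) 0)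
    (by simp only [polySch, map_add, map_pow, expand_X, map_one, ← pow_mul]; congr 3 <;> ring) e
  rwa [hq] at this

/-- Interpolation from the values at the powers of `w` with exponent not divisible by `3`. -/
theorem interpolate_thirds {S : Type*} [CommRing S] [Algebra k S] {N : ℕ} {w : S}
    (hw : IsPrincipalRoot (3 * N) w) (hζ : w ^ (2 * N) + w ^ N + 1 = 0) (hN : (N : k) ≠ 0)
    (h3 : (3 : k) ≠ 0) {F : S[X]} (hF : F.degree < (2 * N : ℕ)) (i : Fin N) :
    let w' := w ^ (3 * N - 1)
    let d : Fin 2 → S := fun j => ((N : k)⁻¹) • dft N (w' ^ 3)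
      (fun l : Fin N => F.eval (w ^ (3 * (l : ℕ) + (j : ℕ) + 1))) i
    ((3 : k)⁻¹) • ((1 - w' ^ (2 * N)) * w' ^ (i : ℕ) * d 0 +
      (1 - w' ^ (4 * N)) * w' ^ (2 * (i : ℕ)) * d 1) = F.coeff i ∧
    ((3 : k)⁻¹) • ((w' ^ N - w' ^ (2 * N)) * w' ^ (i : ℕ) * d 0 +
      (w' ^ (2 * N) - w' ^ (4 * N)) * w' ^ (2 * (i : ℕ)) * d 1) = F.coeff (i + N) := by
  intro w' d
  have hN0 : 0 < N := i.pos
  have hw3 : IsPrincipalRoot N (w ^ 3) := hw.pow three_pos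
  have hw'3 : w' ^ 3 = (w ^ 3) ^ (N - 1) := by
    have : (3 * N - 1) * 3 = 3 * N * 2 + 3 * (N - 1) := by omega
    rw [← pow_mul, ← pow_mul, this, pow_add, pow_mul, hw.1, one_pow, one_mul]
  -- The point with index `3 l + j + 1` is `w ^ (j + 1) * (w ^ 3) ^ l`, so the inverse DFT for `w ^
  -- 3` recovers `F` modulo `X ^ N - w ^ ((j + 1) N)`.
  have hd : ∀ j : Fin 2, d j = (w ^ ((j : ℕ) + 1)) ^ (i : ℕ) *
      (F.coeff i + (w ^ ((j : ℕ) + 1)) ^ N * F.coeff (i + N)) := by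
    intro j
    rw [← inv_smul_dft_eval_mul hw3 hN (w ^ ((j : ℕ) + 1)) hF i, ← hw'3]
    simp only [d, ← pow_mul, ← pow_add]
    congr 2
    funext l
    congr 2
    ring
  have hinv : w' * w = 1 := by
    rw [← pow_succ, Nat.sub_add_cancel (by omega), hw.1]
  have hinvi : ∀ e, w' ^ e * w ^ e = 1 := fun e => by rw [← mul_pow, hinv, one_pow]
  have hw'N : w' ^ N = w ^ (2 * N) := by
    calc w' ^ N = w' ^ N * w ^ (3 * N) := by rw [hw.1, mul_one]
      _ = w' ^ N * w ^ N * w ^ (2 * N) := by ring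
      _ = w ^ (2 * N) := by rw [hinvi, one_mul]
  -- With `z² + z + 1 = 0`, the untwisted data are `lo + z hi` and `lo + z² hi`; the prescribed
  -- coefficients solve this system up to the factor `3`.
  set z := w ^ N with hz
  have hz2 : w ^ (2 * N) = -1 - z := by linear_combination hζ
  have hzz : z ^ 2 = -1 - z := by rw [← hz2, hz]; ring
  have e1 : w' ^ N = -1 - z := by rw [hw'N, hz2]
  have e2 : w' ^ (2 * N) = z := by
    rw [mul_comm, pow_mul, e1]
    linear_combination hzz
  have e4 : w' ^ (4 * N) = -1 - z := by
    rw [show 4 * N = 2 * N * 2 by ring, pow_mul, e2, hzz]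
  have d0 : w' ^ (i : ℕ) * d 0 = F.coeff i + z * F.coeff (i + N) := by
    rw [hd 0]
    simp only [Fin.val_zero, zero_add, pow_one]
    rw [← mul_assoc, hinvi, one_mul]
  have d1 : w' ^ (2 * (i : ℕ)) * d 1 = F.coeff i + (-1 - z) * F.coeff (i + N) := by
    rw [hd 1]
    simp only [Fin.val_one, ← pow_mul, show 1 + 1 = 2 from rfl]
    rw [← mul_assoc, hinvi, one_mul, hz2]
  have hthree : ∀ x : S, ((3 : k)⁻¹) • (3 * x) = x := by
    intro x
    rw [show (3 : S) * x = (3 : k) • x by rw [Algebra.smul_def, map_ofNat], smul_smul,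
      inv_mul_cancel₀ h3, one_smul]
  constructor
  · rw [mul_assoc, mul_assoc, d0, d1, e2, e4]
    conv_rhs => rw [← hthree (F.coeff i)]
    congr 1
    linear_combination (-2 * F.coeff (i + N)) * hzz
  · rw [mul_assoc, mul_assoc, d0, d1, e1, e2, e4]
    conv_rhs => rw [← hthree (F.coeff (i + N))]
    congr 1
    linear_combination (-4 * F.coeff (i + N)) * hzz

end AlgorithmSch

/-! ### Schönhage's step and its recursion -/

section LevelSch

variable {k : Type u} [Field k]

/-- The coefficients of the interpolation in Schönhage's back-transform. -/
def coeffSch {Q : k[X]} (N : ℕ) (w' : AdjoinRoot Q) : Fin N ⊕ Fin N → Fin 2 → AdjoinRoot Q :=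
  Sum.elim
    (fun i => ![(3 * (N : k))⁻¹ • ((1 - w' ^ (2 * N)) * w' ^ (i : ℕ)),
      (3 * (N : k))⁻¹ • ((1 - w' ^ (4 * N)) * w' ^ (2 * (i : ℕ)))])
    (fun i => ![(3 * (N : k))⁻¹ • ((w' ^ N - w' ^ (2 * N)) * w' ^ (i : ℕ)),
      (3 * (N : k))⁻¹ • ((w' ^ (2 * N) - w' ^ (4 * N)) * w' ^ (2 * (i : ℕ)))])

theorem sparseMul_coeffSch {Q : k[X]} (hQ : Q.Monic) {w' : AdjoinRoot Q} {r : ℕ} (hr : 1 ≤ r)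
    (hw' : ∀ e, SparseMul r (w' ^ e)) (N : ℕ) (i : Fin N ⊕ Fin N) (j : Fin 2) :
    SparseMul ((r + r) * r) (coeffSch N w' i j) := by
  have h1 : ∀ e, SparseMul (r + r) (1 - w' ^ e) := fun e =>
    ((sparseMul_one hQ).sub hQ (hw' e)).mono (by omega)
  have h2 : ∀ e e', SparseMul (r + r) (w' ^ e - w' ^ e') := fun e e' => (hw' e).sub hQ (hw' e')
  rcases i with i | i <;> fin_cases j
  · exact ((h1 _).mul hQ (hw' _)).smul hQ _
  · exact ((h1 _).mul hQ (hw' _)).smul hQ _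
  · exact ((h2 _ _).mul hQ (hw' _)).smul hQ _
  · exact ((h2 _ _).mul hQ (hw' _)).smul hQ _

/-- The scalings by `1/3` and `1/N` move into the coefficients, so that the maps after the DFTs have
the form of `halvesPost`. -/
theorem smul_combination {S : Type*} [CommRing S] [Algebra k S] (a b : k) (α β x y : S) :
    a⁻¹ • (α * (b⁻¹ • x) + β * (b⁻¹ • y)) =
      ((a * b)⁻¹ • α) * x + ((a * b)⁻¹ • β) * y := by
  rw [mul_inv]
  simp only [Algebra.smul_def, map_mul]
  ring

theorem levelSch_bwd (ν : ℕ)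
    (v : Fin (3 ^ (ν / 2)) × Fin 2 → AdjoinRoot (polySch k ((ν + 1) / 2))) :
    (levelSch k ν).bwd v = halvesPost (polySch k ((ν + 1) / 2)) 1 (3 ^ ((ν + 1) / 2)) (3 ^ (ν / 2))
      (coeffSch (3 ^ (ν / 2))
        ((AdjoinRoot.root _ ^ (3 ^ ((ν + 1) / 2) / 3 ^ (ν / 2))) ^ (3 * 3 ^ (ν / 2) - 1)))
      (fun j => dft (3 ^ (ν / 2)) (((AdjoinRoot.root _ ^ (3 ^ ((ν + 1) / 2) / 3 ^ (ν / 2))) ^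
        (3 * 3 ^ (ν / 2) - 1)) ^ 3) fun l => v (l, j)) := by
  rw [halvesPost_eq]
  simp only [levelSch, expand_one]
  refine Finset.sum_congr rfl fun i _ => ?_
  refine congrArg₂ (· + ·) (congrArg (fun u => rep _ u * _) ?_) (congrArg (fun u => rep _ u * _) ?_)
  · exact smul_combination _ _ _ _ _ _
  · exact smul_combination _ _ _ _ _ _

theorem root_polySch_pow (a : ℕ) : AdjoinRoot.root (polySch k a) ^ (2 * 3 ^ a) +
    AdjoinRoot.root (polySch k a) ^ 3 ^ a + 1 = 0 := by
  rw [← AdjoinRoot.mk_X, ← map_pow, ← map_pow, ← map_one (AdjoinRoot.mk _), ← map_add, ← map_add]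
  exact AdjoinRoot.mk_self

theorem three_pow_half (ν : ℕ) :
    3 ^ ((ν + 1) / 2) / 3 ^ (ν / 2) = 3 ^ ((ν + 1) / 2 + 1 - (ν / 2 + 1)) := by
  rw [Nat.pow_div (by omega) three_pos]
  congr 1
  omega

theorem three_pow_half_mul (ν : ℕ) : 3 ^ ν = 3 ^ ((ν + 1) / 2) * 3 ^ (ν / 2) := by
  rw [← pow_add]
  congr 1
  omega

theorem isPrincipalRoot_levelSch (h3 : (3 : k) ≠ 0) (ν : ℕ) : IsPrincipalRoot (3 * 3 ^ (ν / 2))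
    (AdjoinRoot.root (polySch k ((ν + 1) / 2)) ^ (3 ^ ((ν + 1) / 2) / 3 ^ (ν / 2))) := by
  rw [three_pow_half, ← pow_succ']
  exact isPrincipalRoot_root_polySch h3 (by omega)

/-- The `N''`-th power of `w` is `y ^ N₁` with `N₁ = 3 ^ ((ν + 1) / 2)`, and the equation is the
defining relation of the inner algebra. -/
theorem cubeRoot_levelSch (ν : ℕ) :
    (AdjoinRoot.root (polySch k ((ν + 1) / 2)) ^ (3 ^ ((ν + 1) / 2) / 3 ^ (ν / 2))) ^
      (2 * 3 ^ (ν / 2)) +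
    (AdjoinRoot.root (polySch k ((ν + 1) / 2)) ^ (3 ^ ((ν + 1) / 2) / 3 ^ (ν / 2))) ^
      3 ^ (ν / 2) + 1 = 0 := by
  rw [← pow_mul, ← pow_mul, Nat.div_mul_cancel (pow_dvd_pow 3 (by omega)), mul_left_comm,
    Nat.div_mul_cancel (pow_dvd_pow 3 (by omega))]
  exact root_polySch_pow _

theorem index_lt {N : ℕ} (t : Fin N × Fin 2) : 3 * (t.1 : ℕ) + (t.2 : ℕ) + 1 < 3 * N := by
  have := t.1.isLt
  have := t.2.isLt
  omega

/-- Since `z ^ N` is a cube root of unity, an exponent congruent to `1` or `2` modulo `3` turns it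
into itself or its square, both roots of `t² + t + 1`. -/
theorem cubeRoot_pow_index {S : Type*} [CommRing S] {z : S} {N : ℕ}
    (h : z ^ (2 * N) + z ^ N + 1 = 0) (l : ℕ) (j : Fin 2) :
    (z ^ (3 * l + (j : ℕ) + 1)) ^ (2 * N) + (z ^ (3 * l + (j : ℕ) + 1)) ^ N + 1 = 0 := by
  have h2 : (z ^ N) ^ 2 = -1 - z ^ N := by rw [← pow_mul, mul_comm]; linear_combination h
  have h3 : (z ^ N) ^ 3 = 1 := by rw [pow_succ, h2]; linear_combination -h2
  have h4 : (z ^ (3 * l + (j : ℕ) + 1)) ^ N = (z ^ N) ^ ((j : ℕ) + 1) := by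
    rw [← pow_mul, mul_comm, pow_mul, add_assoc, pow_add, pow_mul, h3, one_pow, one_mul]
  rw [mul_comm 2 N, pow_mul, h4]
  fin_cases j
  · simp only [zero_add, pow_one]
    linear_combination h2
  · simp only [show 1 + 1 = 2 from rfl, h2]
    linear_combination h2

theorem sum_halves {Q : k[X]} {N h M : ℕ} {A : Fin N ⊕ Fin N → Fin 2 → AdjoinRoot Q}
    {y : Fin 2 → Fin N → AdjoinRoot Q} {F : (AdjoinRoot Q)[X]}
    (hlo : ∀ i : Fin N, A (.inl i) 0 * y 0 i + A (.inl i) 1 * y 1 i = F.coeff i)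
    (hhi : ∀ i : Fin N, A (.inr i) 0 * y 0 i + A (.inr i) 1 * y 1 i = F.coeff (i + N)) :
    halvesPost Q M h N A y =
      ∑ t ∈ Finset.range (2 * N), expand k M (rep Q (F.coeff t)) * X ^ (h * t) := by
  rw [halvesPost_eq, sum_range_two_mul, Finset.sum_range]
  exact Finset.sum_congr rfl fun i _ => by rw [hlo, hhi]

theorem levelSch_isTransform (h3 : (3 : k) ≠ 0) (ν : ℕ) :
    (levelSch k ν).IsTransform (3 ^ ((ν + 1) / 2)) 1 (3 ^ ((ν + 1) / 2)) (2 * 3 ^ (ν / 2))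
      (2 * 3 ^ (ν / 2)) fun t : Fin (3 ^ (ν / 2)) × Fin 2 =>
        (AdjoinRoot.root (polySch k ((ν + 1) / 2)) ^ (3 ^ ((ν + 1) / 2) / 3 ^ (ν / 2))) ^
          (3 * (t.1 : ℕ) + (t.2 : ℕ) + 1) where
  monic_P := monic_polySch ν
  monic_Q := monic_polySch _
  degree_P := by rw [natDegree_polySch, three_pow_half_mul ν]; ring
  le_degree_Q := (Nat.le_mul_of_pos_left _ two_pos).trans_eq (natDegree_polySch _).symm
  le := le_rfl
  blocks := .inl ⟨rfl, rfl⟩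
  fwd_eq a t := by
    refine Eq.trans ?_ (dft_pack_eq_eval (m := 3 * 3 ^ (ν / 2)) (by omega) (rep _ a)
      ⟨3 * (t.1 : ℕ) + (t.2 : ℕ) + 1, index_lt t⟩)
    simp only [one_mul]
    rfl
  bwd_eq F hF := by
    have hN : ((3 ^ (ν / 2) : ℕ) : k) ≠ 0 := by push_cast; exact pow_ne_zero _ h3
    have key := interpolate_thirds (isPrincipalRoot_levelSch h3 ν) (cubeRoot_levelSch ν) hN h3 hF
    exact (levelSch_bwd ν _).trans (sum_halves
      (fun i => (smul_combination _ _ _ _ _ _).symm.trans (key i).1)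
      (fun i => (smul_combination _ _ _ _ _ _).symm.trans (key i).2))

theorem levelSch_isDStep (h3 : (3 : k) ≠ 0) (ν : ℕ) {K : ℝ} (hK : 387 ≤ K) :
    (levelSch k ν).IsDStep K (fun i => 2 * 3 ^ ((i + 1) / 2)) (fun i => 3 ^ (i / 2))
      [3 * 3 ^ (ν / 2)] := by
  have H := levelSch_isTransform h3 ν
  have hQ := monic_polySch (k := k) ((ν + 1) / 2)
  have hdegQ := natDegree_polySch (k := k) ((ν + 1) / 2)
  have hw := isPrincipalRoot_levelSch h3 ν
  have hdeg := natDegree_polySch (k := k) ν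
  rw [three_pow_half_mul ν, ← mul_assoc] at hdeg
  have h1 : 1 ≤ 3 ^ (ν / 2) := Nat.one_le_pow _ _ three_pos
  have h1' : 1 ≤ 3 ^ ((ν + 1) / 2) := Nat.one_le_pow _ _ three_pos
  -- A factor `1 - w' ^ e` or a difference of powers is `4`-sparse, times a `2`-sparse power gives
  -- `8`, and `halvesPost` multiplies by `4`; `387 = 12 * 32 + 3`.
  refine isDStep_of_isTransform H (ρ := 32) hdeg hdegQ ⟨ν, rfl, rfl⟩
    ⟨_, hw.pow three_pos⟩ (by simp [mul_comm])
    (r := 1) (m := 3 * 3 ^ (ν / 2)) rfl (by simp) one_le_two (by omega) le_rfl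
    (fun _ => AdjoinRoot.root _ ^ (3 ^ ((ν + 1) / 2) / 3 ^ (ν / 2)))
    (fun _ => ?_) _ (fun y t => y 0 ⟨3 * (t.1 : ℕ) + (t.2 : ℕ) + 1, index_lt t⟩)
    (isLinearMap_blocks (R := 2 * 3 ^ (ν / 2)) (h := 3 ^ ((ν + 1) / 2)) (M := 1)
      (J := 3 ^ ((ν + 1) / 2)) (monic_polySch ν)) ⟨fun _ _ => rfl, fun _ _ => rfl⟩
    (fun _ i => (sparseMap_block (monic_polySch ν) hQ
      (by rw [hdegQ]; omega) i).mono (by norm_num)) ?_ (fun x => ?_)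
    (r' := 2) (m' := 3 ^ (ν / 2)) le_rfl h1 (by omega)
    (fun _ => ((AdjoinRoot.root _ ^ (3 ^ ((ν + 1) / 2) / 3 ^ (ν / 2))) ^
      (3 * 3 ^ (ν / 2) - 1)) ^ 3) (fun _ => ?_) (fun v j i => v (i, j))
    (halvesPost _ 1 (3 ^ ((ν + 1) / 2)) (3 ^ (ν / 2)) _)
    ⟨fun _ _ => rfl, fun _ _ => rfl⟩ (isLinearMap_halvesPost hQ) ?_ ?_ ?_ (levelSch_bwd ν) ?_
  · rw [← pow_succ'] at hw ⊢
    exact suitableRoot_pow (by norm_num) _ hw (by norm_num; linarith)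
  · intro t
    exact (sparseMap_coords hQ hdegQ fun l =>
      (((0 : Fin 1), (⟨3 * (t.1 : ℕ) + (t.2 : ℕ) + 1, index_lt t⟩ : Fin (3 * 3 ^ (ν / 2)))), l)).mono
        (by norm_num)
  · simp only [one_mul]
  · exact suitableRoot_pow (by norm_num) _ (hw.pow_sub_one.pow three_pos) (by norm_num; linarith)
  · intro j i
    exact (sparseMap_coords hQ hdegQ fun l => ((i, j), l)).mono (by norm_num)
  · refine sparseForm_coeff_halvesPost hQ hdegQ one_pos (ρ := 8) (fun i j => ?_) fun c =>
      ⟨_, _, fun i _ l hl hc => overlap_consecutive (by omega) le_rfl hl hc⟩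
    refine sparseMul_coeffSch hQ one_le_two (fun e => ?_) _ i j
    rw [← pow_mul, ← pow_mul]
    exact sparseMul_root_polySch _ _
  · refine fun y c hc => coeff_halvesPost_eq_zero hQ hdegQ one_pos (fun i hi l hl => ?_) y c hc
    rw [hdeg]
    nlinarith [Nat.mul_le_mul_left (3 ^ ((ν + 1) / 2)) (Nat.le_sub_one_of_lt hi),
      Nat.sub_add_cancel (by omega : 1 ≤ 2 * 3 ^ (ν / 2)), Nat.mul_le_mul h1' h1]
  · norm_num
    exact hK

/-- With `t = x ^ N₁`, where `N₁ = 3 ^ ((ν + 1) / 2)`, the modulus is `t ^ (2 N'') + t ^ N'' + 1`.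
Thus the wrap-around is in the outer variable, while inner products have degree below `deg Q`. -/
theorem levelSch_exec (h3 : (3 : k) ≠ 0) (ν : ℕ) (a b : AdjoinRoot (polySch k ν)) :
    (levelSch k ν).exec (fun u v => u * v) a b = a * b := by
  refine (levelSch_isTransform h3 ν).exec_mul_of_fold ?_ ?_ (by positivity) (by positivity) ?_ a b
  · rw [polySch, three_pow_half_mul ν]
    congr 2
    ring
  · change _ ≤ (polySch k ((ν + 1) / 2)).natDegree + 1
    rw [natDegree_polySch]
    omega
  · intro t
    exact cubeRoot_pow_index (cubeRoot_levelSch ν) t.1 t.2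

theorem innerSch_isD (h3 : (3 : k) ≠ 0) {K : ℝ} (hK : 387 ≤ K) (ν : ℕ) :
    (innerSch k ν).IsD K (fun i => 2 * 3 ^ ((i + 1) / 2)) (fun i => 3 ^ (i / 2)) := by
  induction ν using Nat.strong_induction_on with
  | _ ν ih =>
    rw [innerSch]
    split_ifs with hν
    · refine ⟨monic_polySch _, le_trans ?_ hK⟩
      rw [natDegree_polySch]
      interval_cases ν <;> norm_num
    · exact ⟨⟨_, levelSch_isDStep h3 ν hK⟩, levelSch_exec h3 ν, ih _ (by omega)⟩

end LevelSch

/-! ## The Cantor–Kaltofen algorithm -/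

section AlgorithmCK

variable {k : Type u} [Field k]

theorem natCast_ne_zero_of_not_dvd {s : ℕ} (hs : ¬ ringChar k ∣ s) : (s : k) ≠ 0 :=
  (ringChar.spec k s).not.2 hs

/-- Immediate from `Φ_{s^(a+1)}(y) = Φ_s(y^(s^a))`; this root of `Φ_s` is the one at which `1 - η`
is inverted. -/
theorem root_cyclotomic_pow_aeval {s : ℕ} (hs : s ≠ 0) (a : ℕ) :
    aeval (AdjoinRoot.root (cyclotomic (s ^ (a + 1)) k) ^ s ^ a) (cyclotomic s k) = 0 := by
  have h := cyclotomic_pow_add_eq_expand (k := k) hs 0 a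
  rw [zero_add, pow_one, add_comm 1 a] at h
  change (cyclotomic s k).eval₂ (AdjoinRoot.of _) _ = 0
  rw [← Level.IsTransform.mk_expand, ← h]
  exact AdjoinRoot.mk_self

theorem isPrincipalRoot_root_cyclotomic_pow {s : ℕ} (hs : (s : k) ≠ 0) {a b : ℕ}
    (hab : b ≤ a + 1) : IsPrincipalRoot (s ^ b)
      (AdjoinRoot.root (cyclotomic (s ^ (a + 1)) k) ^ s ^ (a + 1 - b)) := by
  have hs0 : s ≠ 0 := by rintro rfl; simp at hs
  refine IsPrincipalRoot.pow ?_ (by positivity)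
  rw [← pow_add, Nat.sub_add_cancel hab]
  refine isPrincipalRoot_root_cyclotomic ?_
  push_cast
  exact pow_ne_zero _ hs

theorem sparseMul_root_cyclotomic {s : ℕ} (hs : 0 < s) (a e : ℕ) :
    SparseMul s (AdjoinRoot.root (cyclotomic (s ^ (a + 1)) k) ^ e) := by
  have h := cyclotomic_pow_add_eq_expand (k := k) hs.ne' 0 a
  rw [zero_add, pow_one, add_comm 1 a] at h
  refine (sparseMul_root_pow (pow_pos hs a) (cyclotomic.monic s k) h e).mono ?_
  rw [natDegree_cyclotomic]
  exact Nat.totient_le s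

/-- The value of the `s`-th cyclotomic polynomial at `1`. -/
def cyclotomicOne (s : ℕ) : ℕ := if IsPrimePow s then s.minFac else 1

theorem cyclotomicOne_dvd (s : ℕ) : cyclotomicOne s ∣ s := by
  rw [cyclotomicOne]
  split_ifs
  · exact s.minFac_dvd
  · exact one_dvd s

theorem eval_one_cyclotomic {s : ℕ} (hs : 2 ≤ s) :
    (cyclotomic s ℤ).eval 1 = (cyclotomicOne s : ℤ) := by
  rw [cyclotomicOne]
  split_ifs with h
  · obtain ⟨p, e, hp, he, rfl⟩ := (isPrimePow_nat_iff _).1 h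
    have : Fact p.Prime := ⟨hp⟩
    obtain ⟨e, rfl⟩ : ∃ d, e = d + 1 := ⟨e - 1, by omega⟩
    rw [eval_one_cyclotomic_prime_pow, hp.pow_minFac (by omega)]
  · rw [eval_one_cyclotomic_not_prime_pow, Nat.cast_one]
    intro p hp e he
    rcases Nat.eq_zero_or_pos e with rfl | he0
    · simp at he; omega
    · exact h ((isPrimePow_nat_iff _).2 ⟨p, e, hp, he0, he⟩)

/-- The inverse of `1 - η`, for a root `η` of the `s`-th cyclotomic polynomial. -/
theorem inverse_one_sub {S : Type*} [CommRing S] [Algebra k S] {s : ℕ} (hs : 2 ≤ s)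
    (hsk : (s : k) ≠ 0) {η : S} (hη : aeval η (cyclotomic s k) = 0) :
    ((cyclotomicOne s : k)⁻¹ •
      ∏ i ∈ (Finset.range s).filter (fun i => 2 ≤ i ∧ Nat.Coprime i s), (1 - η ^ i)) * (1 - η) =
      1 := by
  rw [← aeval_cyclotomic_int] at hη
  have h := prod_coprime_one_sub_pow_eq (by omega) hη
  -- The index `1` is split off from the product over all `j` coprime to `s`; the remaining product
  -- is the cofactor of `1 - η`.
  have hset : (Finset.range s).filter (fun j => Nat.Coprime j s) =
      insert 1 ((Finset.range s).filter fun i => 2 ≤ i ∧ Nat.Coprime i s) := by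
    ext i
    simp only [Finset.mem_filter, Finset.mem_range, Finset.mem_insert]
    constructor
    · rintro ⟨hi, hc⟩
      rcases Nat.lt_or_ge i 2 with h2 | h2
      · left
        have : i ≠ 0 := by rintro rfl; simp at hc; omega
        omega
      · exact .inr ⟨hi, h2, hc⟩
    · rintro (rfl | ⟨hi, -, hc⟩)
      · exact ⟨by omega, Nat.coprime_one_left s⟩
      · exact ⟨hi, hc⟩
  rw [hset, Finset.prod_insert (by simp), pow_one, eval_one_cyclotomic hs] at h
  rw [smul_mul_assoc, mul_comm, h]
  -- The value of `Φ_s` at `1` divides `s`, which is nonzero in `k`.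
  have hτ : (cyclotomicOne s : k) ≠ 0 := by
    obtain ⟨c, hc⟩ := cyclotomicOne_dvd s
    intro h0
    rw [hc, Nat.cast_mul, h0, zero_mul] at hsk
    exact hsk rfl
  rw [Int.cast_natCast, ← map_natCast (algebraMap k S), Algebra.smul_def, ← map_mul,
    inv_mul_cancel₀ hτ, map_one]

/-- Interpolation from the values at the points `w ^ l` and `ξ w ^ l`. -/
theorem interpolate_halves {S : Type*} [CommRing S] [Algebra k S] {N : ℕ} {w ξ ξ' inv : S}
    (hw : IsPrincipalRoot N w) (hN : (N : k) ≠ 0) (hξ : ξ' * ξ = 1)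
    (hinv : inv * (1 - ξ ^ N) = 1) {F : S[X]} (hF : F.degree < (2 * N : ℕ)) (i : Fin N) :
    let c₁ := ((N : k)⁻¹) • dft N (w ^ (N - 1)) (fun l : Fin N => F.eval (w ^ (l : ℕ))) i
    let c₂ := ξ' ^ (i : ℕ) *
      (((N : k)⁻¹) • dft N (w ^ (N - 1)) (fun l : Fin N => F.eval (ξ * w ^ (l : ℕ))) i)
    inv * (c₂ - ξ ^ N * c₁) = F.coeff i ∧ inv * (c₁ - c₂) = F.coeff (i + N) := by
  intro c₁ c₂
  -- The two DFTs give `F` modulo `X ^ N - 1` and `X ^ N - ξ ^ N`: the system `lo + hi`, `lo + ξ ^ N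
  -- hi`, solved by inverting `1 - ξ ^ N`.
  have h1 : c₁ = F.coeff i + F.coeff (i + N) := by
    have := inv_smul_dft_eval_mul hw hN 1 hF i
    simpa only [one_mul, one_pow] using this
  have h2 : c₂ = F.coeff i + ξ ^ N * F.coeff (i + N) := by
    simp only [c₂]
    rw [inv_smul_dft_eval_mul hw hN ξ hF i, ← mul_assoc, ← mul_pow, hξ, one_pow, one_mul]
  rw [h1, h2]
  constructor
  · linear_combination F.coeff i * hinv
  · linear_combination F.coeff (i + N) * hinv

/-- The step of the Cantor–Kaltofen algorithm, for arbitrary roots of unity. -/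
def twoDftLevel (P Q : k[X]) (N₁ N₂ : ℕ) (w ξ ξ' inv : AdjoinRoot Q) : Level k P where
  N' := N₁
  N'' := N₂
  Q := Q
  idx := Fin N₂ ⊕ Fin N₂
  fwd := fun a =>
    let c : Fin N₂ → AdjoinRoot Q := fun i => pack Q N₁ fun j => (rep _ a).coeff (i + N₂ * j)
    Sum.elim (dft N₂ w c) (dft N₂ w fun i => ξ ^ (i : ℕ) * c i)
  bwd := fun v =>
    let c₁ : Fin N₂ → AdjoinRoot Q := fun i =>
      ((N₂ : k)⁻¹) • dft N₂ (w ^ (N₂ - 1)) (fun l => v (Sum.inl l)) i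
    let c₂ : Fin N₂ → AdjoinRoot Q := fun i =>
      ξ' ^ (i : ℕ) * (((N₂ : k)⁻¹) • dft N₂ (w ^ (N₂ - 1)) (fun l => v (Sum.inr l)) i)
    ∑ i : Fin N₂, (expand k N₂ (rep Q (inv * (c₂ i - ξ ^ N₂ * c₁ i))) * X ^ (i : ℕ) +
      expand k N₂ (rep Q (inv * (c₁ i - c₂ i))) * X ^ ((i : ℕ) + N₂))

/-- The coefficients of the interpolation in the back-transform. -/
def coeffCK {Q : k[X]} (N : ℕ) (ξ ξ' inv : AdjoinRoot Q) :
    Fin N ⊕ Fin N → Fin 2 → AdjoinRoot Q :=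
  Sum.elim
    (fun i => ![(-(N : k)⁻¹) • (inv * ξ ^ N), ((N : k)⁻¹) • (inv * ξ' ^ (i : ℕ))])
    (fun i => ![((N : k)⁻¹) • (inv * ξ' ^ 0), (-(N : k)⁻¹) • (inv * ξ' ^ (i : ℕ))])

variable {P Q : k[X]} {N₁ N₂ : ℕ} {w ξ ξ' inv : AdjoinRoot Q}

/-- All four coefficients are, up to scalars, `inv` times a power of `ξ` or `ξ'`; the trivial power
`ξ' ^ 0` keeps this shape uniform. -/
theorem sparseMul_coeffCK (hQ : Q.Monic) {r r' : ℕ} (hξ : ∀ e, SparseMul r (ξ ^ e))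
    (hξ' : ∀ e, SparseMul r (ξ' ^ e)) (hinv : SparseMul r' inv) (i : Fin N₂ ⊕ Fin N₂)
    (j : Fin 2) : SparseMul (r' * r) (coeffCK N₂ ξ ξ' inv i j) := by
  rcases i with i | i <;> fin_cases j
  · exact (hinv.mul hQ (hξ _)).smul hQ _
  · exact (hinv.mul hQ (hξ' _)).smul hQ _
  · exact (hinv.mul hQ (hξ' _)).smul hQ _
  · exact (hinv.mul hQ (hξ' _)).smul hQ _

theorem twoDftLevel_bwd (v : Fin N₂ ⊕ Fin N₂ → AdjoinRoot Q) :
    (twoDftLevel P Q N₁ N₂ w ξ ξ' inv).bwd v = halvesPost Q N₂ 1 N₂ (coeffCK N₂ ξ ξ' inv)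
      fun j => dft N₂ (w ^ (N₂ - 1)) (![fun l => v (.inl l), fun l => v (.inr l)] j) := by
  rw [halvesPost_eq]
  simp only [twoDftLevel, one_mul]
  refine Finset.sum_congr rfl fun i _ => ?_
  refine congrArg₂ (· + ·) (congrArg (fun u => expand k N₂ (rep _ u) * _) ?_)
    (congrArg (fun u => expand k N₂ (rep _ u) * _) ?_) <;>
  · simp only [coeffCK, Sum.elim_inl, Sum.elim_inr, Matrix.cons_val_zero, Matrix.cons_val_one,
      Algebra.smul_def, map_neg]
    ring

theorem dft_mul_pack_eq_eval (p : k[X]) (z : AdjoinRoot Q) (l : Fin N₂) :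
    dft N₂ w (fun i => z ^ (i : ℕ) * pack Q N₁ fun j => p.coeff (i + N₂ * j)) l =
      ((outerPoly N₂ (block 1 N₂ N₁ p)).map (AdjoinRoot.mk Q)).eval (z * w ^ (l : ℕ)) := by
  rw [eval_map_outerPoly_block, Finset.sum_range, dft]
  refine Finset.sum_congr rfl fun i _ => ?_
  rw [one_mul, pow_mul]
  ring

theorem twoDftLevel_isTransform (hP : P.Monic) (hQ : Q.Monic) (hdeg : P.natDegree = N₁ * N₂)
    (hdegQ : Q.natDegree = N₁) (hw : IsPrincipalRoot N₂ w) (hN : (N₂ : k) ≠ 0) (hξ : ξ' * ξ = 1)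
    (hinv : inv * (1 - ξ ^ N₂) = 1) :
    (twoDftLevel P Q N₁ N₂ w ξ ξ' inv).IsTransform 1 N₂ N₁ N₂ (2 * N₂)
      (Sum.elim (fun l : Fin N₂ => w ^ (l : ℕ)) fun l : Fin N₂ => ξ * w ^ (l : ℕ)) where
  monic_P := hP
  monic_Q := hQ
  degree_P := hdeg.trans (mul_comm _ _)
  le_degree_Q := hdegQ.ge
  le := by omega
  blocks := .inr ⟨rfl, rfl⟩
  fwd_eq a l := by
    rcases l with l | l
    · have h := dft_mul_pack_eq_eval (Q := Q) (N₁ := N₁) (w := w) (rep P a) 1 l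
      simp only [one_pow, one_mul] at h
      exact h
    · exact dft_mul_pack_eq_eval (rep _ a) ξ l
  bwd_eq F hF := by
    have key := interpolate_halves hw hN hξ hinv hF
    change ∑ i : Fin N₂, _ = _
    rw [sum_range_two_mul, Finset.sum_range]
    refine Finset.sum_congr rfl fun i _ => ?_
    refine congrArg₂ (· + ·) ?_ ?_
    · exact (congrArg (fun u => expand k N₂ (rep Q u) * X ^ (i : ℕ)) (key i).1).trans
        (by rw [one_mul]; rfl)
    · exact (congrArg (fun u => expand k N₂ (rep Q u) * X ^ ((i : ℕ) + N₂)) (key i).2).trans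
        (by rw [one_mul]; rfl)

/-- The twist `ξ ^ (i j)` with `j = 0, 1` yields the inputs of both DFTs by one formula. -/
theorem isLinearMap_twoDft_pre (hP : P.Monic) (ξ : AdjoinRoot Q) :
    IsLinearMap k fun (a : AdjoinRoot P) (j : Fin 2) (i : Fin N₂) =>
      ξ ^ ((i : ℕ) * j) * pack Q N₁ fun l => (rep P a).coeff (i + N₂ * l) :=
  ⟨fun a b => by
    funext j i
    simp only [(isLinearMap_pack hP N₁ fun l => i + N₂ * l).map_add, mul_add, Pi.add_apply],
  fun c a => by
    funext j i
    simp only [(isLinearMap_pack hP N₁ fun l => i + N₂ * l).map_smul, mul_smul_comm,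
      Pi.smul_apply]⟩

theorem twoDftLevel_isDStep
    (H : (twoDftLevel P Q N₁ N₂ w ξ ξ' inv).IsTransform 1 N₂ N₁ N₂ (2 * N₂)
      (Sum.elim (fun l : Fin N₂ => w ^ (l : ℕ)) fun l : Fin N₂ => ξ * w ^ (l : ℕ)))
    {K : ℝ} {n' n'' : ℕ → ℕ} (hdeg : P.natDegree = N₁ * N₂) (hdegQ : Q.natDegree = N₁)
    (hN₂ : 1 ≤ N₂) (hseq : ∃ i, n' i = N₁ ∧ n'' i = N₂) {s ν : ℕ} (hs : 2 ≤ s)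
    (hsν : N₂ = s ^ ν) (hw : IsPrincipalRoot N₂ w) {r r' : ℕ} (hr' : 1 ≤ r')
    (hr : 1 ≤ r) (hξ : ∀ e, SparseMul r (ξ ^ e))
    (hξ' : ∀ e, SparseMul r (ξ' ^ e)) (hinv : SparseMul r' inv) (hK : 2 * s ≤ K)
    (hK' : 12 * ((4 * (r' * r) : ℕ) : ℝ) + 3 ≤ K) :
    (twoDftLevel P Q N₁ N₂ w ξ ξ' inv).IsDStep K n' n'' [N₂, N₂] := by
  have hQ : Q.Monic := H.monic_Q
  have hP : P.Monic := H.monic_P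
  have hρ : r ≤ 4 * (r' * r) := by nlinarith
  refine isDStep_of_isTransform H (ρ := 4 * (r' * r)) hdeg hdegQ hseq ⟨w, hw⟩
    (by simp only [Fintype.card_sum, Fintype.card_fin]; omega)
    (r := 2) (m := N₂) rfl (by simp) le_rfl hN₂ (by omega) (fun _ => w) (fun _ => ?_)
    _ (fun y => Sum.elim (y 0) (y 1)) (isLinearMap_twoDft_pre (N₁ := N₁) hP ξ) ?_ ?_ ?_ (fun x => ?_)
    (r' := 2) (m' := N₂) le_rfl hN₂ (by omega) (fun _ => w ^ (N₂ - 1)) (fun _ => ?_)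
    (fun v j => ![fun l => v (.inl l), fun l => v (.inr l)] j)
    (halvesPost Q N₂ 1 N₂ (coeffCK N₂ ξ ξ' inv)) ?_ (isLinearMap_halvesPost hQ) ?_ ?_ ?_
    (twoDftLevel_bwd (P := P) (N₁ := N₁)) hK'
  · subst hsν; exact suitableRoot_pow hs ν hw hK
  · constructor
    · intro x y; funext i; rcases i with i | i <;> rfl
    · intro c x; funext i; rcases i with i | i <;> rfl
  · intro j i
    refine ((hξ _).sparseMap hQ (sparseMap_pack (r := 1) hQ hdegQ.ge fun l =>
      sparseForm_coeff_rep_ofCoords hP _)).mono (by omega)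
  · rintro (i | i)
    · exact (sparseMap_coords hQ hdegQ fun l => (((0 : Fin 2), i), l)).mono (by omega)
    · exact (sparseMap_coords hQ hdegQ fun l => (((1 : Fin 2), i), l)).mono (by omega)
  · change Sum.elim _ _ = Sum.elim _ _
    simp only [Fin.val_zero, Fin.val_one, mul_zero, mul_one, pow_zero, one_mul]
  · subst hsν; exact suitableRoot_pow hs ν hw.pow_sub_one hK
  · constructor
    · intro x y; funext j i; fin_cases j <;> rfl
    · intro c x; funext j i; fin_cases j <;> rfl
  · intro j i
    fin_cases j
    · exact (sparseMap_coords hQ hdegQ fun l => ((.inl i : Fin N₂ ⊕ Fin N₂), l)).mono (by omega)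
    · exact (sparseMap_coords hQ hdegQ fun l => ((.inr i : Fin N₂ ⊕ Fin N₂), l)).mono (by omega)
  · exact sparseForm_coeff_halvesPost hQ hdegQ hN₂ (sparseMul_coeffCK hQ hξ hξ' hinv) fun c =>
      ⟨_, _, fun i hi l _ hc => overlap_interleaved hi hc⟩
  · refine fun y c hc => coeff_halvesPost_eq_zero hQ hdegQ hN₂ (fun i hi l hl => ?_) y c hc
    rw [hdeg]
    nlinarith

end AlgorithmCK

/-! ### The Cantor–Kaltofen step and its recursion -/

section LevelCK

variable {k : Type u} [Field k] {s ν : ℕ}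

/-- The constant of the scheme for the Cantor–Kaltofen algorithm. -/
def constCK (s : ℕ) : ℝ := 12 * ((4 * ((1 + s) ^ s * s) : ℕ) : ℝ) + 3 + 4 * (s : ℝ) ^ 2

/-- The exponents satisfy `ν = (⌊ν/2⌋ + 1) + (⌈ν/2⌉ - 1)`, which needs `ν ≥ 1` because of the
truncated subtraction. -/
theorem natDegree_cyclotomic_pow (hs : 2 ≤ s) (hν : 1 ≤ ν) :
    (cyclotomic (s ^ ν) k).natDegree =
      Nat.totient (s ^ (ν / 2 + 1)) * s ^ ((ν + 1) / 2 - 1) := by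
  rw [natDegree_cyclotomic, ← totient_pow_add (by omega)]
  congr 2
  omega

theorem isPrincipalRoot_levelCK (hs : 2 ≤ s) (hsk : (s : k) ≠ 0) (ν : ℕ) :
    IsPrincipalRoot (s ^ ((ν + 1) / 2 - 1))
      (AdjoinRoot.root (cyclotomic (s ^ (ν / 2 + 1)) k) ^
        (s ^ (ν / 2 + 1) / s ^ ((ν + 1) / 2 - 1))) := by
  rw [Nat.pow_div (by omega) (by omega)]
  exact isPrincipalRoot_root_cyclotomic_pow hsk (by omega)

theorem levelCK_isTransform (hs : 2 ≤ s) (hsk : (s : k) ≠ 0) (hν : 1 ≤ ν) :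
    (levelCK k s ν).IsTransform 1 (s ^ ((ν + 1) / 2 - 1)) (Nat.totient (s ^ (ν / 2 + 1)))
      (s ^ ((ν + 1) / 2 - 1)) (2 * s ^ ((ν + 1) / 2 - 1))
      (Sum.elim (fun l : Fin (s ^ ((ν + 1) / 2 - 1)) =>
          (AdjoinRoot.root (cyclotomic (s ^ (ν / 2 + 1)) k) ^
            (s ^ (ν / 2 + 1) / s ^ ((ν + 1) / 2 - 1))) ^ (l : ℕ))
        fun l : Fin (s ^ ((ν + 1) / 2 - 1)) =>
          AdjoinRoot.root (cyclotomic (s ^ (ν / 2 + 1)) k) ^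
            (s ^ (ν / 2 + 1) / (s * s ^ ((ν + 1) / 2 - 1))) *
          (AdjoinRoot.root (cyclotomic (s ^ (ν / 2 + 1)) k) ^
            (s ^ (ν / 2 + 1) / s ^ ((ν + 1) / 2 - 1))) ^ (l : ℕ)) := by
  have hdvd : s * s ^ ((ν + 1) / 2 - 1) ∣ s ^ (ν / 2 + 1) := by
    rw [← pow_succ']
    exact pow_dvd_pow s (by omega)
  have hpos : 0 < s ^ ((ν + 1) / 2 - 1) := pow_pos (by omega) _
  have hs0 : s ≠ 0 := by omega
  have hroot := isPrincipalRoot_root_cyclotomic (k := k) (n := s ^ (ν / 2 + 1))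
    (by push_cast; exact pow_ne_zero _ hsk)
  refine twoDftLevel_isTransform (cyclotomic.monic _ _) (cyclotomic.monic _ _)
    (natDegree_cyclotomic_pow hs hν) (natDegree_cyclotomic _ _) (isPrincipalRoot_levelCK hs hsk ν)
    (by push_cast; exact pow_ne_zero _ hsk) ?_ ?_
  · rw [← pow_succ, Nat.sub_add_cancel (Nat.mul_pos (by omega) hpos), ← pow_mul,
      Nat.div_mul_cancel hdvd]
    exact hroot.1
  · simp only [pow_mul _ (s ^ ((ν + 1) / 2 - 1))]
    refine inverse_one_sub hs hsk ?_
    -- Thus `ξ ^ N₂` is `y ^ s ^ (ν / 2)`, a root of `Φ_s`.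
    have h1 : s ^ (ν / 2 + 1) / (s * s ^ ((ν + 1) / 2 - 1)) * s ^ ((ν + 1) / 2 - 1) = s ^ (ν / 2) := by
      refine Nat.eq_of_mul_eq_mul_left (by omega : 0 < s) ?_
      rw [mul_left_comm, Nat.div_mul_cancel hdvd, pow_succ']
    rw [← pow_mul, h1]
    exact root_cyclotomic_pow_aeval hs0 _

/-- Powers of `y` are `s`-sparse, as `deg Φ_s ≤ s`. The inverse of `1 - ξ ^ N''` is, up to a scalar,
a product of at most `s` factors `1 - y ^ e`, each `(1 + s)`-sparse. Hence the constant depends on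
`s` alone. -/
theorem levelCK_isDStep (hs : 2 ≤ s) (hsk : (s : k) ≠ 0) (hν : 1 ≤ ν) {K : ℝ}
    (hK : constCK s ≤ K) :
    (levelCK k s ν).IsDStep K (fun i => Nat.totient (s ^ ((i + 1) / 2 + 1)))
      (fun i => s ^ ((i + 1 + 1) / 2 - 1)) [s ^ ((ν + 1) / 2 - 1), s ^ ((ν + 1) / 2 - 1)] := by
  have hs1 : (1 : ℝ) ≤ s := by exact_mod_cast (by omega : 1 ≤ s)
  have hρ : (0 : ℝ) ≤ ((4 * ((1 + s) ^ s * s) : ℕ) : ℝ) := Nat.cast_nonneg _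
  rw [constCK] at hK
  have hsparse : ∀ e, SparseMul s (AdjoinRoot.root (cyclotomic (s ^ (ν / 2 + 1)) k) ^ e) :=
    fun e => sparseMul_root_cyclotomic (by omega) _ e
  have hQ := cyclotomic.monic (s ^ (ν / 2 + 1)) k
  -- The order sequence starts at `ν = 1`, hence the index `ν - 1`.
  refine twoDftLevel_isDStep (levelCK_isTransform hs hsk hν) (natDegree_cyclotomic_pow hs hν)
    (natDegree_cyclotomic _ _) (Nat.one_le_pow _ _ (by omega)) ⟨ν - 1, ?_, ?_⟩ hs rfl
    (isPrincipalRoot_levelCK hs hsk ν) (r := s) (r' := (1 + s) ^ s) (Nat.one_le_pow _ _ (by omega))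
    (by omega) (fun e => ?_) (fun e => ?_) ?_ (by nlinarith) (by nlinarith)
  · rw [Nat.sub_add_cancel hν]
  · rw [Nat.sub_add_cancel hν]
  · rw [← pow_mul]; exact hsparse _
  · rw [← pow_mul, ← pow_mul]; exact hsparse _
  · refine SparseMul.smul hQ ?_ _
    refine (SparseMul.prod hQ _ (r := 1 + s) fun i _ => ?_).mono
      (Nat.pow_le_pow_right (by omega) ((Finset.card_filter_le _ _).trans_eq (Finset.card_range s)))
    rw [← pow_mul]
    exact (sparseMul_one hQ).sub hQ (hsparse _)

/-- Substituting `y = x ^ N''` turns the inner modulus exactly into `Φ_{s^ν}`. -/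
theorem levelCK_exec (hs : 2 ≤ s) (hsk : (s : k) ≠ 0) (hν : 1 ≤ ν)
    (a b : AdjoinRoot (cyclotomic (s ^ ν) k)) :
    (levelCK k s ν).exec (fun u v => u * v) a b = a * b := by
  refine (levelCK_isTransform hs hsk hν).exec_mul_of_dvd (dvd_of_eq ?_) (by omega)
    (pow_pos (by omega) _) a b
  refine Eq.trans ?_ (cyclotomic_pow_add_eq_expand (by omega) _ _)
  congr 2
  omega

/-- The map `ν ↦ ν / 2 + 1` fixes `2` and decreases every `ν ≥ 3`; the recursion therefore ends in
dimension at most `s ^ 2`, which the constant covers. -/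
theorem innerCK_isD (hs : 2 ≤ s) (hsk : (s : k) ≠ 0) {K : ℝ} (hK : constCK s ≤ K) (ν : ℕ) :
    (innerCK k s ν).IsD K (fun i => Nat.totient (s ^ ((i + 1) / 2 + 1)))
      (fun i => s ^ ((i + 1 + 1) / 2 - 1)) := by
  induction ν using Nat.strong_induction_on with
  | _ ν ih =>
    rw [innerCK]
    split_ifs with hν
    · refine ⟨cyclotomic.monic _ _, le_trans ?_ hK⟩
      rw [natDegree_cyclotomic, constCK]
      have h1 : Nat.totient (s ^ ν) ≤ s ^ 2 :=
        (Nat.totient_le _).trans (Nat.pow_le_pow_right (by omega) hν)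
      have h2 : ((Nat.totient (s ^ ν) : ℕ) : ℝ) ≤ (s : ℝ) ^ 2 := by exact_mod_cast h1
      have hρ : (0 : ℝ) ≤ ((4 * ((1 + s) ^ s * s) : ℕ) : ℝ) := Nat.cast_nonneg _
      nlinarith [sq_nonneg (s : ℝ)]
    · exact ⟨⟨_, levelCK_isDStep hs hsk (by omega) hK⟩, levelCK_exec hs hsk (by omega),
        ih _ (by omega)⟩

end LevelCK

/-! ## Order sequences -/

section OrderSequence

variable {k : Type u} [Field k]

theorem isConstSparseOrderSequence_of_geometric {n' n'' : ℕ → ℕ} {d q : ℕ} (hd : 0 < d)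
    (hq : 2 ≤ q) (h : ∀ i, n' i * n'' i = d * q ^ i) (c : ℝ)
    (halg : ∀ i, ∃ Q : k[X], Q.Monic ∧ Q.natDegree = n' i ∧
      ∃ ω : AdjoinRoot Q, SuitableRoot c (n'' i) ω) :
    IsConstSparseOrderSequence k n' n'' := by
  refine ⟨fun _ => q, ⟨fun _ => show (1 : ℝ) < q by exact_mod_cast hq, fun i => ?_, c, fun i => ?_⟩, q,
    fun _ => le_rfl⟩
  · have hpos : 0 < d * q ^ i := Nat.mul_pos hd (pow_pos (by omega) i)
    have hsucc : d * q ^ (i + 1) = q * (d * q ^ i) := by ring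
    rw [h, h, hsucc]
    refine ⟨by nlinarith, by push_cast; exact le_rfl, Dvd.intro_left q rfl⟩
  · obtain ⟨Q, hQ, hdeg, ω, hω⟩ := halg i
    refine ⟨AdjoinRoot Q, inferInstance, inferInstance, ?_, ω, hω⟩
    rw [← hdeg]
    exact finrank_quotient_span_eq_natDegree

theorem isConstSparseOrderSequence_A {s : ℕ} (hs : 2 ≤ s) {w : ℕ → k}
    (hw : ∀ ν, IsPrimitiveRoot (w ν) (s ^ ν)) :
    IsConstSparseOrderSequence k (fun _ => 1) fun i => s ^ i :=
  isConstSparseOrderSequence_of_geometric one_pos hs (fun _ => rfl) (2 * s) fun i =>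
    ⟨X - 1, monic_X_sub_one, natDegree_X_sub_one, _,
      suitableRoot_pow hs i (isPrincipalRoot_of (hw i)) le_rfl⟩

theorem isConstSparseOrderSequence_SS (h2 : ringChar k ≠ 2) :
    IsConstSparseOrderSequence k (fun i => 2 ^ ((i + 1) / 2)) fun i => 2 ^ (i / 2) :=
  isConstSparseOrderSequence_of_geometric one_pos le_rfl
    (fun i => by rw [one_mul]; exact (two_pow_half_mul i).symm) (2 * (2 : ℕ)) fun i =>
    ⟨_, monic_polySS _, natDegree_polySS _, _,
      suitableRoot_pow le_rfl _ (isPrincipalRoot_root_polySS h2 (by omega)) le_rfl⟩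

theorem isConstSparseOrderSequence_Sch (h3 : (3 : k) ≠ 0) :
    IsConstSparseOrderSequence k (fun i => 2 * 3 ^ ((i + 1) / 2)) fun i => 3 ^ (i / 2) :=
  isConstSparseOrderSequence_of_geometric (q := 3) two_pos (by norm_num)
    (fun i => by rw [three_pow_half_mul i, mul_assoc]) (2 * (3 : ℕ)) fun i =>
    ⟨_, monic_polySch _, natDegree_polySch _, _,
      suitableRoot_pow (by norm_num) _ (isPrincipalRoot_root_polySch h3 (by omega)) le_rfl⟩

theorem isConstSparseOrderSequence_CK {s : ℕ} (hs : 2 ≤ s) (hsk : (s : k) ≠ 0) :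
    IsConstSparseOrderSequence k (fun i => Nat.totient (s ^ ((i + 1) / 2 + 1)))
      fun i => s ^ ((i + 1 + 1) / 2 - 1) :=
  isConstSparseOrderSequence_of_geometric (Nat.totient_pos.2 (by omega : 0 < s)) hs
    (fun i => by
      -- Both sides equal `φ(s ^ (i + 1))`, so the sequence is geometric with first term `φ(s)`.
      have h1 := totient_pow_add (by omega : s ≠ 0) ((i + 1) / 2) ((i + 1 + 1) / 2 - 1)
      have h2 := totient_pow_add (by omega : s ≠ 0) 0 i
      rw [zero_add, pow_one] at h2
      rw [← h1, ← h2]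
      congr 2
      omega) (2 * s) fun i =>
    ⟨_, cyclotomic.monic _ k, natDegree_cyclotomic _ _, _,
      suitableRoot_pow hs _ (isPrincipalRoot_levelCK hs hsk (i + 1)) le_rfl⟩

end OrderSequence

/-! ## The exponents -/

section Exponents

theorem le_pow_ceil_logb {s : ℕ} (hs : 2 ≤ s) {x : ℝ} (hx : 1 ≤ x) :
    x ≤ (s : ℝ) ^ ⌈Real.logb s x⌉₊ ∧ (s : ℝ) ^ ⌈Real.logb s x⌉₊ ≤ s * x := by
  have hs1 : (1 : ℝ) < s := by exact_mod_cast hs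
  have hs0 : (0 : ℝ) < s := by linarith
  have hx0 : 0 < x := by linarith
  have hlog : (s : ℝ) ^ Real.logb s x = x := Real.rpow_logb hs0 hs1.ne' hx0
  constructor
  · calc x = (s : ℝ) ^ Real.logb s x := hlog.symm
      _ ≤ (s : ℝ) ^ ((⌈Real.logb s x⌉₊ : ℕ) : ℝ) :=
        Real.rpow_le_rpow_of_exponent_le hs1.le (Nat.le_ceil _)
      _ = _ := Real.rpow_natCast _ _
  · calc (s : ℝ) ^ ⌈Real.logb s x⌉₊ = (s : ℝ) ^ ((⌈Real.logb s x⌉₊ : ℕ) : ℝ) :=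
        (Real.rpow_natCast _ _).symm
      _ ≤ (s : ℝ) ^ (Real.logb s x + 1) :=
        Real.rpow_le_rpow_of_exponent_le hs1.le (Nat.ceil_lt_add_one (Real.logb_nonneg hs1 hx)).le
      _ = s * x := by rw [Real.rpow_add hs0, hlog, Real.rpow_one, mul_comm]

theorem pow_expA_bounds {s n : ℕ} (hs : 2 ≤ s) (hn : 1 ≤ n) :
    2 * n - 1 ≤ s ^ expA s n ∧ ((s ^ expA s n : ℕ) : ℝ) ≤ 2 * s * n := by
  have hn' : (1 : ℝ) ≤ n := by exact_mod_cast hn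
  have h := le_pow_ceil_logb hs (x := 2 * n - 1) (by linarith)
  change _ ≤ (s : ℝ) ^ expA s n ∧ (s : ℝ) ^ expA s n ≤ _ at h
  have hs0 : (0 : ℝ) ≤ s := Nat.cast_nonneg s
  constructor
  · have h1 : ((2 * n : ℕ) : ℝ) ≤ ((s ^ expA s n + 1 : ℕ) : ℝ) := by push_cast; linarith [h.1]
    have := Nat.cast_le.1 h1
    omega
  · push_cast
    nlinarith [h.2]

theorem pow_expSch_bounds {n : ℕ} (hn : 2 ≤ n) :
    2 * n - 1 ≤ 2 * 3 ^ expSch n ∧ ((2 * 3 ^ expSch n : ℕ) : ℝ) ≤ 6 * n := by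
  have hn' : (2 : ℝ) ≤ n := by exact_mod_cast hn
  have h := le_pow_ceil_logb (s := 3) (by norm_num) (x := n - 1 / 2) (by linarith)
  change _ ≤ ((3 : ℕ) : ℝ) ^ expSch n ∧ ((3 : ℕ) : ℝ) ^ expSch n ≤ _ at h
  push_cast at h
  constructor
  · have h1 : ((2 * n : ℕ) : ℝ) ≤ ((2 * 3 ^ expSch n + 1 : ℕ) : ℝ) := by push_cast; linarith [h.1]
    have := Nat.cast_le.1 h1
    omega
  · push_cast
    linarith [h.2]

/-- In increasing order the `i`-th element is at least `i + 1`, so `p / (p - 1) ≤ (i + 1) / i`, and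
these bounds telescope. -/
theorem prod_le_card_mul_prod_pred (T : Finset ℕ) (hT : ∀ p ∈ T, 2 ≤ p) :
    ∏ p ∈ T, p ≤ (T.card + 1) * ∏ p ∈ T, (p - 1) := by
  induction T using Finset.induction_on_max with
  | empty => simp
  | insert M T hmax ih =>
    have hM : M ∉ T := fun h => lt_irrefl _ (hmax M h)
    have ih' := ih fun p hp => hT p (Finset.mem_insert_of_mem hp)
    have hM2 := hT M (Finset.mem_insert_self M T)
    have hcard : T.card + 2 ≤ M := by
      have hsub : T ⊆ Finset.Ico 2 M := fun p hp =>
        Finset.mem_Ico.2 ⟨hT p (Finset.mem_insert_of_mem hp), hmax p hp⟩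
      have := Finset.card_le_card hsub
      rw [Nat.card_Ico] at this
      omega
    rw [Finset.prod_insert hM, Finset.prod_insert hM, Finset.card_insert_of_notMem hM]
    obtain ⟨m, rfl⟩ : ∃ m, M = m + 1 := ⟨M - 1, by omega⟩
    rw [Nat.add_sub_cancel]
    calc (m + 1) * ∏ p ∈ T, p ≤ (m + 1) * ((T.card + 1) * ∏ p ∈ T, (p - 1)) := by gcongr
      _ = ((m + 1) * (T.card + 1)) * ∏ p ∈ T, (p - 1) := by ring
      _ ≤ ((T.card + 1 + 1) * m) * ∏ p ∈ T, (p - 1) := by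
        refine Nat.mul_le_mul_right _ ?_
        nlinarith
      _ = _ := by ring

/-- With `r` the number of prime factors, `s / φ(s) = ∏ p / (p - 1) ≤ r + 1`, and `2 ^ r ≤ s` gives
`r + 1 ≤ log s + 1 ≤ 2 log s`. -/
theorem le_totient_mul_logb {s : ℕ} (hs : 2 ≤ s) :
    (s : ℝ) ≤ Nat.totient s * (2 * Real.logb 2 s) := by
  have hprime : ∀ p ∈ s.primeFactors, 2 ≤ p := fun p hp => (Nat.prime_of_mem_primeFactors hp).two_le
  have h1 := prod_le_card_mul_prod_pred s.primeFactors hprime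
  have h2 := Nat.totient_mul_prod_primeFactors s
  have hpos : 0 < ∏ p ∈ s.primeFactors, (p - 1) := Finset.prod_pos fun p hp => by
    have := hprime p hp
    omega
  have h3 : s ≤ Nat.totient s * (s.primeFactors.card + 1) := by
    refine Nat.le_of_mul_le_mul_right ?_ hpos
    calc s * ∏ p ∈ s.primeFactors, (p - 1) = Nat.totient s * ∏ p ∈ s.primeFactors, p := h2.symm
      _ ≤ Nat.totient s * ((s.primeFactors.card + 1) * ∏ p ∈ s.primeFactors, (p - 1)) := by gcongr
      _ = _ := by ring
  have h4 : 2 ^ s.primeFactors.card ≤ s :=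
    (Finset.pow_card_le_prod _ _ _ hprime).trans
      (Nat.le_of_dvd (by omega) (Nat.prod_primeFactors_dvd s))
  have hs2 : (2 : ℝ) ≤ s := by exact_mod_cast hs
  have hlog1 : (1 : ℝ) ≤ Real.logb 2 s := by
    rw [Real.le_logb_iff_rpow_le (by norm_num) (by linarith)]
    simpa using hs2
  have hlog : (s.primeFactors.card : ℝ) ≤ Real.logb 2 s := by
    rw [Real.le_logb_iff_rpow_le (by norm_num) (by linarith), Real.rpow_natCast]
    exact_mod_cast h4
  calc (s : ℝ) ≤ Nat.totient s * (s.primeFactors.card + 1) := by exact_mod_cast h3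
    _ ≤ Nat.totient s * (2 * Real.logb 2 s) := by gcongr; linarith

theorem totient_pow_succ {s : ℕ} (hs : 2 ≤ s) (ν : ℕ) :
    Nat.totient (s ^ (ν + 1)) = Nat.totient s * s ^ ν := by
  have := totient_pow_add (by omega : s ≠ 0) 0 ν
  rwa [zero_add, pow_one, add_comm 1 ν] at this

/-- From `φ(s ^ ν) = s ^ ν φ(s) / s ≥ s ^ ν / (2 log s)`, the choice `s ^ ν ≥ (4 n - 2) log s`
suffices. Rounding up costs at most a factor `s`, and `log s ≤ s` gives the upper bound. -/
theorem expCK_bounds {s n : ℕ} (hs : 2 ≤ s) (hn : 2 ≤ n) :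
    2 * n - 1 ≤ Nat.totient (s ^ expCK s n) ∧
      ((Nat.totient (s ^ expCK s n) : ℕ) : ℝ) ≤ 4 * s ^ 2 * n := by
  have hn' : (2 : ℝ) ≤ n := by exact_mod_cast hn
  have hs2 : (2 : ℝ) ≤ s := by exact_mod_cast hs
  have hlog1 : (1 : ℝ) ≤ Real.logb 2 s := by
    rw [Real.le_logb_iff_rpow_le (by norm_num) (by linarith)]
    simpa using hs2
  have hlogs : Real.logb 2 s ≤ s := by
    rw [Real.logb_le_iff_le_rpow (by norm_num) (by linarith), Real.rpow_natCast]
    exact_mod_cast s.lt_two_pow_self.le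
  have hx : (1 : ℝ) ≤ (4 * n - 2) * Real.logb 2 s := by nlinarith
  have h := le_pow_ceil_logb hs hx
  change _ ≤ (s : ℝ) ^ expCK s n ∧ (s : ℝ) ^ expCK s n ≤ _ at h
  constructor
  · obtain ⟨ν, hν⟩ : ∃ ν, expCK s n = ν + 1 := by
      refine Nat.exists_eq_succ_of_ne_zero fun h0 => ?_
      rw [h0, pow_zero] at h
      nlinarith [h.1]
    rw [hν] at h ⊢
    rw [totient_pow_succ hs]
    have h1 := le_totient_mul_logb hs
    have h2 : (4 * n - 2) * Real.logb 2 s ≤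
        2 * (Nat.totient s * s ^ ν) * Real.logb 2 s := by
      calc (4 * n - 2) * Real.logb 2 s ≤ (s : ℝ) ^ (ν + 1) := h.1
        _ = s ^ ν * s := pow_succ _ _
        _ ≤ s ^ ν * (Nat.totient s * (2 * Real.logb 2 s)) := by gcongr
        _ = _ := by ring
    have h3 := le_of_mul_le_mul_right h2 (by linarith)
    have h4 : ((2 * n : ℕ) : ℝ) ≤ ((Nat.totient s * s ^ ν + 1 : ℕ) : ℝ) := by
      push_cast
      linarith
    have := Nat.cast_le.1 h4
    omega
  · have h1 : ((Nat.totient (s ^ expCK s n) : ℕ) : ℝ) ≤ (s : ℝ) ^ expCK s n := by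
      exact_mod_cast Nat.totient_le _
    refine h1.trans (h.2.trans ?_)
    have h2 : (4 * n - 2) * Real.logb 2 s ≤ 4 * n * s := by
      have : (0 : ℝ) ≤ 4 * n - 2 := by linarith
      nlinarith
    nlinarith

/-- The other choice of exponent shows that the set is nonempty. By minimality the preceding totient
is below `2 n - 1`, and one more factor `s` multiplies it by `s`, except from exponent `0` to `1`,
which is treated apart. -/
theorem leastExpCK_bounds {s n : ℕ} (hs : 2 ≤ s) (hn : 2 ≤ n) :
    2 * n - 1 ≤ Nat.totient (s ^ leastExpCK s n) ∧
      ((Nat.totient (s ^ leastExpCK s n) : ℕ) : ℝ) ≤ 4 * s ^ 2 * n := by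
  have hne : {ν : ℕ | 2 * n - 1 ≤ Nat.totient (s ^ ν)}.Nonempty := ⟨_, (expCK_bounds hs hn).1⟩
  have hmem : 2 * n - 1 ≤ Nat.totient (s ^ leastExpCK s n) := Nat.sInf_mem hne
  refine ⟨hmem, ?_⟩
  have hs2 : (2 : ℝ) ≤ s := by exact_mod_cast hs
  have hn' : (2 : ℝ) ≤ n := by exact_mod_cast hn
  rcases Nat.lt_or_ge (leastExpCK s n) 2 with h | h
  · have h1 : Nat.totient (s ^ leastExpCK s n) ≤ s ^ 1 :=
      (Nat.totient_le _).trans (Nat.pow_le_pow_right (by omega) (by omega))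
    have h2 : ((Nat.totient (s ^ leastExpCK s n) : ℕ) : ℝ) ≤ (s : ℝ) := by
      rw [pow_one] at h1
      exact_mod_cast h1
    nlinarith [mul_nonneg (by linarith : (0 : ℝ) ≤ s) (by linarith : (0 : ℝ) ≤ n)]
  · obtain ⟨ν, hν⟩ : ∃ ν, leastExpCK s n = ν + 2 := ⟨leastExpCK s n - 2, by omega⟩
    have hlt : ¬ 2 * n - 1 ≤ Nat.totient (s ^ (ν + 1)) :=
      Nat.notMem_of_lt_sInf (s := {ν : ℕ | 2 * n - 1 ≤ Nat.totient (s ^ ν)})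
        (show ν + 1 < leastExpCK s n by omega)
    have h1 : Nat.totient (s ^ (ν + 1)) ≤ 2 * n := by omega
    have h2 : Nat.totient (s ^ (ν + 2)) = Nat.totient (s ^ (ν + 1)) * s := by
      rw [totient_pow_succ hs, totient_pow_succ hs, pow_succ, mul_assoc]
    rw [hν, h2]
    have h3 : ((Nat.totient (s ^ (ν + 1)) : ℕ) : ℝ) ≤ 2 * n := by exact_mod_cast h1
    push_cast
    nlinarith [mul_nonneg (by linarith : (0 : ℝ) ≤ s) (by linarith : (0 : ℝ) ≤ n)]

end Exponents

/-! ### Assembling the four instances -/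

section Instances

variable {k : Type u} [Field k]

/-- The inner algorithm being correct, a step that multiplies in `k[x]` gives a correct algorithm. -/
theorem PolyAlg.run_eq_of_bounds {A : PolyAlg k} {K : ℝ} {n' n'' : ℕ → ℕ} {n : ℕ}
    (hinner : A.inner.IsD K n' n'') (hP : A.P.Monic) (hn : 1 ≤ n) (hdeg : 2 * n - 1 ≤ A.P.natDegree)
    (h : ∀ a b : k[X], a.degree < n → b.degree < n →
      A.top.bwd (fun i => A.top.fwd (AdjoinRoot.mk _ a) i * A.top.fwd (AdjoinRoot.mk _ b) i) =
        a * b) (a b : k[X]) (ha : a.degree < n) (hb : b.degree < n) : A.run a b = a * b := by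
  have hnat : ∀ c : k[X], c.degree < n → c.natDegree ≤ n - 1 := fun c hc =>
    natDegree_le_iff_coeff_eq_zero.2 fun m hm => (degree_lt_iff_coeff_zero _ _).1 hc _ (by omega)
  refine PolyAlg.run_eq hinner hP ?_ (h a b ha hb)
  rw [degree_eq_natDegree hP.ne_zero]
  exact degree_mul_lt_of_natDegree_le (hnat a ha) (hnat b hb) (by omega)

theorem isInstanceOfD_algA {s : ℕ} (hs : 2 ≤ s) {w : ℕ → k}
    (hw : ∀ ν, IsPrimitiveRoot (w ν) (s ^ ν)) :
    IsInstanceOfD 1 (algA k s w) (fun n => X ^ s ^ expA s n - 1) (fun _ => 1)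
      (fun n => s ^ expA s n) (fun n => [s ^ expA s n]) := by
  have hs0 : (0 : ℝ) ≤ s := Nat.cast_nonneg s
  -- The summand `2 s` serves both the FFT constant and the bound `N ≤ 2 s n`; `27` pays for the
  -- linear maps.
  refine ⟨2 * s + 27, _, _, isConstSparseOrderSequence_A hs hw, fun n hn => ?_⟩
  have hb := pow_expA_bounds hs hn
  have hn0 : (0 : ℝ) ≤ n := Nat.cast_nonneg n
  have hpos : 0 < s ^ expA s n := pow_pos (by omega) _
  have hdeg : (X ^ s ^ expA s n - 1 : k[X]).natDegree = s ^ expA s n := natDegree_X_pow_sub_C (r := 1)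
  have hinner : (algA k s w n).inner.IsD (2 * s + 27) (fun _ => 1) (fun i => s ^ i) :=
    ⟨monic_X_sub_one, by
      change ((X - 1 : k[X]).natDegree : ℝ) ≤ _
      rw [natDegree_X_sub_one]
      push_cast
      linarith⟩
  have hprod : ∀ a b : k[X], a.degree < n → b.degree < n →
      (algA k s w n).top.bwd (fun i => (algA k s w n).top.fwd (AdjoinRoot.mk _ a) i *
        (algA k s w n).top.fwd (AdjoinRoot.mk _ b) i) = a * b := fun a b ha hb' => by
    change (levelA k (s ^ expA s n) (w (expA s n))).bwd (fun i =>
      (levelA k (s ^ expA s n) (w (expA s n))).fwd (AdjoinRoot.mk _ a) i *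
        (levelA k (s ^ expA s n) (w (expA s n))).fwd (AdjoinRoot.mk _ b) i) = a * b
    rw [levelA_eq]
    refine (levelA_isTransform hpos (hw _)).bwd_fwd_mul_fwd_consecutive one_pos ?_ ?_ ?_ hpos ha hb'
    · rw [hdeg]; omega
    · change 2 * 1 ≤ (X - 1 : k[X]).natDegree + 1
      rw [natDegree_X_sub_one]
    · omega
  refine ⟨⟨rfl, rfl, rfl⟩, ⟨by rw [one_mul]; exact hb.1, ?_⟩,
    levelA_isDStep hs (hw _) (by linarith) (by linarith), hprod, hinner,
    PolyAlg.run_eq_of_bounds hinner ?_ hn ?_ hprod⟩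
  · rw [one_mul]
    nlinarith [hb.2]
  · exact monic_X_pow_sub_C 1 hpos.ne'
  · exact hb.1.trans_eq hdeg.symm

theorem isInstanceOfD_algSS (h2 : ringChar k ≠ 2) :
    IsInstanceOfD 3 (algSS k) (fun n => X ^ 2 ^ expSS n + 1) (fun n => 2 ^ ((expSS n + 1) / 2))
      (fun n => 2 ^ (expSS n / 2)) (fun n => [2 * 2 ^ (expSS n / 2)]) := by
  refine ⟨27, _, _, isConstSparseOrderSequence_SS h2, fun n hn => ?_⟩
  have hb := pow_expA_bounds le_rfl (by omega : 1 ≤ n)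
  have hexp : expA 2 n = expSS n := by simp [expA, expSS]
  rw [hexp] at hb
  -- For `ν = 0` the half blocks would be empty; `n ≥ 3` excludes this.
  have hν : 1 ≤ expSS n := by
    by_contra! h0
    rw [Nat.lt_one_iff.1 h0, pow_zero] at hb
    omega
  have hn0 : (0 : ℝ) ≤ n := Nat.cast_nonneg n
  have hdeg := natDegree_polySS (k := k) (expSS n)
  have hinner : (algSS k n).inner.IsD 27 (fun i => 2 ^ ((i + 1) / 2)) (fun i => 2 ^ (i / 2)) :=
    innerSS_isD h2 le_rfl _
  obtain ⟨a₁, ha₁⟩ : ∃ a, (expSS n + 1) / 2 = a + 1 := ⟨(expSS n + 1) / 2 - 1, by omega⟩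
  have hhalf : 2 ^ ((expSS n + 1) / 2) / 2 * 2 = 2 ^ ((expSS n + 1) / 2) := by
    rw [ha₁, pow_succ, Nat.mul_div_cancel _ two_pos]
  have hpos : 0 < 2 ^ ((expSS n + 1) / 2) := pow_pos two_pos _
  have hprod : ∀ a b : k[X], a.degree < n → b.degree < n →
      (algSS k n).top.bwd (fun i => (algSS k n).top.fwd (AdjoinRoot.mk _ a) i *
        (algSS k n).top.fwd (AdjoinRoot.mk _ b) i) = a * b := fun a b ha hb' => by
    change (levelSS k (expSS n)).bwd (fun i =>
      (levelSS k (expSS n)).fwd (AdjoinRoot.mk _ a) i *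
        (levelSS k (expSS n)).fwd (AdjoinRoot.mk _ b) i) = a * b
    rw [levelSS_eq]
    refine (levelSS_isTransform h2 hν).bwd_fwd_mul_fwd_consecutive (by omega) ?_ ?_ ?_
      (pow_pos two_pos _) ha hb'
    · rw [hdeg]; omega
    · change _ ≤ (polySS k ((expSS n + 1) / 2)).natDegree + 1
      rw [natDegree_polySS]
      omega
    -- Block length times number of evaluation points is `2 ^ ν ≥ 2 n - 1`, enough for the whole
    -- product.
    · have : 2 ^ ((expSS n + 1) / 2) / 2 * 2 ^ (expSS n / 2 + 1) = 2 ^ expSS n := by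
        rw [two_pow_half_mul (expSS n), ← hhalf]
        simp only [Nat.mul_div_cancel _ two_pos]
        ring
      omega
  refine ⟨⟨rfl, rfl, rfl⟩, ?_, levelSS_isDStep h2 hν le_rfl, hprod, hinner,
    PolyAlg.run_eq_of_bounds hinner (monic_polySS _) (by omega) (hb.1.trans_eq hdeg.symm) hprod⟩
  rw [← two_pow_half_mul]
  refine ⟨hb.1, hb.2.trans ?_⟩
  push_cast
  linarith

theorem isInstanceOfD_algSch (h2 : ringChar k = 2) :
    IsInstanceOfD 3 (algSch k) (fun n => X ^ (2 * 3 ^ expSch n) + X ^ 3 ^ expSch n + 1)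
      (fun n => 2 * 3 ^ ((expSch n + 1) / 2)) (fun n => 3 ^ (expSch n / 2))
      (fun n => [3 * 3 ^ (expSch n / 2)]) := by
  have h3 := three_ne_zero_of_ringChar h2
  refine ⟨387, _, _, isConstSparseOrderSequence_Sch h3, fun n hn => ?_⟩
  have hb := pow_expSch_bounds (by omega : 2 ≤ n)
  have hn0 : (0 : ℝ) ≤ n := Nat.cast_nonneg n
  have hdeg := natDegree_polySch (k := k) (expSch n)
  have hmul : 2 * 3 ^ ((expSch n + 1) / 2) * 3 ^ (expSch n / 2) = 2 * 3 ^ expSch n := by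
    rw [mul_assoc, ← three_pow_half_mul]
  have hinner : (algSch k n).inner.IsD 387 (fun i => 2 * 3 ^ ((i + 1) / 2)) (fun i => 3 ^ (i / 2)) :=
    innerSch_isD h3 le_rfl _
  have hprod : ∀ a b : k[X], a.degree < n → b.degree < n →
      (algSch k n).top.bwd (fun i => (algSch k n).top.fwd (AdjoinRoot.mk _ a) i *
        (algSch k n).top.fwd (AdjoinRoot.mk _ b) i) = a * b := fun a b ha hb' => by
    refine (levelSch_isTransform h3 (expSch n)).bwd_fwd_mul_fwd_consecutive (pow_pos three_pos _)
      ?_ ?_ ?_ (by positivity) ha hb'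
    · rw [hdeg]; omega
    · change _ ≤ (polySch k ((expSch n + 1) / 2)).natDegree + 1
      rw [natDegree_polySch]
      omega
    · have : 3 ^ ((expSch n + 1) / 2) * (2 * 3 ^ (expSch n / 2)) = 2 * 3 ^ expSch n := by
        rw [← hmul]; ring
      omega
  refine ⟨⟨rfl, rfl, rfl⟩, ?_, levelSch_isDStep h3 _ le_rfl, hprod, hinner,
    PolyAlg.run_eq_of_bounds hinner (monic_polySch _) (by omega) (hb.1.trans_eq hdeg.symm) hprod⟩
  rw [hmul]
  exact ⟨hb.1, hb.2.trans (by linarith)⟩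

/-- The choice of the exponent enters only through the two-sided estimate `he`, so both choices are
handled at once. -/
theorem isInstanceOfD_algCK {s : ℕ} (hs : 2 ≤ s) (hsk : (s : k) ≠ 0) {e : ℕ → ℕ}
    (he : ∀ n, 2 ≤ n → 2 * n - 1 ≤ Nat.totient (s ^ e n) ∧
      ((Nat.totient (s ^ e n) : ℕ) : ℝ) ≤ 4 * s ^ 2 * n) :
    IsInstanceOfD (s ^ 3) (algCK k s e) (fun n => cyclotomic (s ^ e n) k)
      (fun n => Nat.totient (s ^ (e n / 2 + 1))) (fun n => s ^ ((e n + 1) / 2 - 1))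
      (fun n => [s ^ ((e n + 1) / 2 - 1), s ^ ((e n + 1) / 2 - 1)]) := by
  refine ⟨constCK s, _, _, isConstSparseOrderSequence_CK hs hsk, fun n hn => ?_⟩
  have hn2 : 2 ≤ n := by
    have := Nat.pow_le_pow_left hs 3
    omega
  have hb := he n hn2
  have hν : 1 ≤ e n := by
    by_contra! h0
    rw [Nat.lt_one_iff.1 h0, pow_zero, Nat.totient_one] at hb
    omega
  have hdeg := natDegree_cyclotomic (s ^ e n) k
  have hmul : Nat.totient (s ^ (e n / 2 + 1)) * s ^ ((e n + 1) / 2 - 1) = Nat.totient (s ^ e n) := by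
    rw [← natDegree_cyclotomic_pow (k := k) hs hν, hdeg]
  have hpos : 0 < s ^ ((e n + 1) / 2 - 1) := pow_pos (by omega) _
  have hinner : (algCK k s e n).inner.IsD (constCK s)
      (fun i => Nat.totient (s ^ ((i + 1) / 2 + 1))) (fun i => s ^ ((i + 1 + 1) / 2 - 1)) :=
    innerCK_isD hs hsk le_rfl _
  have hQ : (levelCK k s (e n)).Q.natDegree = Nat.totient (s ^ (e n / 2 + 1)) :=
    natDegree_cyclotomic _ _
  have hprod : ∀ a b : k[X], a.degree < n → b.degree < n →
      (algCK k s e n).top.bwd (fun i => (algCK k s e n).top.fwd (AdjoinRoot.mk _ a) i *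
        (algCK k s e n).top.fwd (AdjoinRoot.mk _ b) i) = a * b := fun a b ha hb' => by
    refine (levelCK_isTransform hs hsk hν).bwd_fwd_mul_fwd_interleaved hpos ?_ ?_ ?_ (by omega) ha hb'
    · rw [hdeg]; omega
    · rw [hQ, mul_comm (s ^ _), hmul]
      omega
    · rw [hQ]
      exact Nat.totient_pos.2 (pow_pos (by omega) _)
  refine ⟨⟨rfl, rfl, rfl⟩, ?_, levelCK_isDStep hs hsk hν le_rfl, hprod, hinner,
    PolyAlg.run_eq_of_bounds hinner (cyclotomic.monic _ _) (by omega) (hb.1.trans_eq hdeg.symm)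
      hprod⟩
  rw [hmul]
  refine ⟨hb.1, hb.2.trans ?_⟩
  gcongr
  rw [constCK]
  have hρ : (0 : ℝ) ≤ ((4 * ((1 + s) ^ s * s) : ℕ) : ℝ) := Nat.cast_nonneg _
  linarith

end Instances

end DFTMul

end

theorem mainTheorem4 {k : Type u} [Field k] :
    -- the algorithm `𝒜`
    (∀ (s : ℕ) (w : ℕ → k), 2 ≤ s → (∀ ν, IsPrimitiveRoot (w ν) (s ^ ν)) →
      DFTMul.IsInstanceOfD 1 (DFTMul.algA k s w)
        (fun n => X ^ s ^ DFTMul.expA s n - 1)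
        (fun _ => 1)
        (fun n => s ^ DFTMul.expA s n)
        (fun n => [s ^ DFTMul.expA s n])) ∧
    -- the Schönhage–Strassen algorithm
    (ringChar k ≠ 2 →
      DFTMul.IsInstanceOfD 3 (DFTMul.algSS k)
        (fun n => X ^ 2 ^ DFTMul.expSS n + 1)
        (fun n => 2 ^ ((DFTMul.expSS n + 1) / 2))
        (fun n => 2 ^ (DFTMul.expSS n / 2))
        (fun n => [2 * 2 ^ (DFTMul.expSS n / 2)])) ∧
    -- Schönhage's algorithm
    (ringChar k = 2 →
      DFTMul.IsInstanceOfD 3 (DFTMul.algSch k)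
        (fun n => X ^ (2 * 3 ^ DFTMul.expSch n) + X ^ 3 ^ DFTMul.expSch n + 1)
        (fun n => 2 * 3 ^ ((DFTMul.expSch n + 1) / 2))
        (fun n => 3 ^ (DFTMul.expSch n / 2))
        (fun n => [3 * 3 ^ (DFTMul.expSch n / 2)])) ∧
    -- the Cantor–Kaltofen algorithm, for both choices of the exponent
    (∀ s : ℕ, 2 ≤ s → ¬ ringChar k ∣ s →
      ∀ e : ℕ → ℕ, e = DFTMul.leastExpCK s ∨ e = DFTMul.expCK s →
      DFTMul.IsInstanceOfD (s ^ 3) (DFTMul.algCK k s e)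
        (fun n => cyclotomic (s ^ e n) k)
        (fun n => Nat.totient (s ^ (e n / 2 + 1)))
        (fun n => s ^ ((e n + 1) / 2 - 1))
        (fun n => [s ^ ((e n + 1) / 2 - 1), s ^ ((e n + 1) / 2 - 1)])) := by
  refine ⟨fun s w hs hw => DFTMul.isInstanceOfD_algA hs hw, DFTMul.isInstanceOfD_algSS,
    DFTMul.isInstanceOfD_algSch, fun s hs hsk e he => ?_⟩
  refine DFTMul.isInstanceOfD_algCK hs (DFTMul.natCast_ne_zero_of_not_dvd hsk) fun n hn => ?_
  rcases he with rfl | rfl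
  · exact DFTMul.leastExpCK_bounds hs hn
  · exact DFTMul.expCK_bounds hs hn
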